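/- Digraphs are finite, with at most one arc $(u,v)$ for each ordered pair of vertices (loops allowed). A set $W$ of vertices of $G$ is a \emph{dfvs} if deleting $W$ makes $G$ acyclic. For disjoint vertex sets $X,Y$, an $(X,Y)$-cut is a set of arcs meeting every path from $X$ to $Y$; a cut $S$ is \emph{important} if it is inclusion-wise minimal and there is no $(X,Y)$-cut $S'$ with $|S'|\le|S|$ such that the set of vertices reachable from $X$ in $G-S'$ strictly contains the set of vertices reachable from $X$ in $G-S$. For a vertex $w$, let $\mathrm{expand}(G,w)$ be obtained from $G$ by splitting $w$ into $w^-$ and $w^+$ joined by an arc $(w^-,w^+)$, where the arcs into $w$ now enter $w^-$ and the arcs out of $w$ now leave $w^+$. Consider the following recursive algorithm DFAS-V$(G,W,k)$, where $G$ is a digraph, $W$ a dfvs of $G$ (the hint) and $k\ge 0$ an integer. \begin{enumerate} \item If $G$ is acyclic, return $\emptyset$. Otherwise, if $k=0$, return nil. \item While some $w\in W$ lies on no cycle of $G$, remove such a $w$ from $W$. \item For each $w\in W$ and for each important $(\{w^+\},(W\setminus\{w\})\cup\{w^-\})$-cut $S$ of $\mathrm{expand}(G,w)$ with $|S|\le k$: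 let $F$ be the result of DFAS-V$(G-S,\,W\setminus\{w\},\,k-|S|)$, where the arcs of $S$ are identified with the corresponding arcs of $G$; if $F\ne$ nil, return $F\cup S$. \item Return nil. \end{enumerate} \textbf{Theorem.} On all inputs with $|W|\le k+1$, the algorithm DFAS-V$(G,W,k)$ runs in $\mathcal O(k!\,2^{o(k)}(n+m))$ time, where $n\ge 1$ and $m$ are the numbers of vertices and arcs of $G$. That is, there are a program for the unit-cost random access machine (with addition and subtraction), a function $g:\mathbb N\to\mathbb R$ with $g(k)=o(k)$, and a constant $C$ such that, on every such input (given as a list of the arcs, a list of the hint vertices, and $k$), the program carries out an execution of DFAS-V$(G,W,k)$, writing out in order all vertices discarded in step 2, all choices of $w$ and of $S$ in step 3, and all values returned by the calls, and halts within $C\cdot k!\cdot 2^{g(k)}\cdot(n+m)$ time units. -/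

import Mathlib

namespace DFAS

/-! ### Directed graphs, cuts, hints -/

section Graphs

variable {V : Type*}

/-- `G - S`: the digraph `G` with all arcs of `S` removed. -/
def deleteArcs (G : Digraph V) (S : Finset (V × V)) : Digraph V where
  Adj u v := G.Adj u v ∧ (u, v) ∉ S

/-- No vertex lies on a cycle (a directed path with at least one arc from a vertex to itself). -/
def IsAcyclic (G : Digraph V) : Prop :=
  ∀ v, ¬ Relation.TransGen G.Adj v v

/-- Some cycle of `G` contains `w`. -/
def OnCycle (G : Digraph V) (w : V) : Prop :=
  Relation.TransGen G.Adj w w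

/-- `W` is a directed feedback vertex set: deleting the vertices of `W` (here: making them
isolated) leaves an acyclic digraph. -/
def IsDFVS (G : Digraph V) (W : Finset V) : Prop :=
  IsAcyclic (⟨fun u v => G.Adj u v ∧ u ∉ W ∧ v ∉ W⟩ : Digraph V)

/-- The set of vertices reachable from `X` in `G`. -/
def reachSet (G : Digraph V) (X : Set V) : Set V :=
  {v | ∃ x ∈ X, Relation.ReflTransGen G.Adj x v}

/-- `S` is an `(X, Y)`-cut of `G`: a set of arcs of `G` that meets every path from `X` to `Y`. -/
def IsCut (G : Digraph V) (X Y : Set V) (S : Finset (V × V)) : Prop :=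
  (∀ e ∈ S, G.Adj e.1 e.2) ∧ Disjoint (reachSet (deleteArcs G S) X) Y

/-- `S` is an important `(X, Y)`-cut: it is inclusion-wise minimal, and no `(X, Y)`-cut that is
not larger leaves a strictly larger set of vertices reachable from `X`. -/
def IsImportantCut (G : Digraph V) (X Y : Set V) (S : Finset (V × V)) : Prop :=
  IsCut G X Y S ∧ (∀ S', S' ⊂ S → ¬ IsCut G X Y S') ∧
    ∀ S', IsCut G X Y S' → S'.card ≤ S.card →
      ¬ reachSet (deleteArcs G S) X ⊂ reachSet (deleteArcs G S') X

variable [DecidableEq V]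

/-- The vertices of the expanded graph are those of `Option V`, with `w⁻ = some w`, `w⁺ = none`,
and every other vertex `v` is `some v`. An arc `(u, v)` of `G` becomes `(u, v)`, where a tail `w`
is read as `w⁺` and a head `w` is read as `w⁻`. -/
def expandArc (w : V) (e : V × V) : Option V × Option V :=
  (if e.1 = w then none else some e.1, some e.2)

/-- `expand(G, w, (w⁻, w⁺))`: split `w` into `w⁻` and `w⁺` joined by the arc `(w⁻, w⁺)`. -/
def expand (G : Digraph V) (w : V) : Digraph (Option V) where
  Adj x y := (x = some w ∧ y = none) ∨ ∃ e : V × V, G.Adj e.1 e.2 ∧ expandArc w e = (x, y)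

/-- The important `({w⁺}, (W \ w) ∪ {w⁻})`-cuts of `expand(G, w, (w⁻, w⁺))` of size at most `k`. -/
def importantCuts (G : Digraph V) (W : Finset V) (k : ℕ) (w : V) :
    Set (Finset (Option V × Option V)) :=
  {S | IsImportantCut (expand G w) {none} (some '' (↑(W.erase w) : Set V) ∪ {some w}) S ∧
    S.card ≤ k}

/-- `a` lists, without repetition, the arcs of `G` that correspond to the arcs in `S`. -/
def ListsCut (G : Digraph V) (w : V) (S : Finset (Option V × Option V)) (a : List (V × V)) : Prop :=
  a.Nodup ∧ ∀ e, e ∈ a ↔ G.Adj e.1 e.2 ∧ expandArc w e ∈ S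

end Graphs

/-! ### The algorithm `DFAS-V` -/

/-- The observable events of an execution of `DFAS-V`: a vertex is discarded from the hint by the
while loop, an iteration of the loop over hint vertices begins, an iteration of the loop over
important cuts begins (and calls the algorithm recursively), a call returns (`none` is `nil`). -/
inductive Event (V : Type*)
  | discard (w : V)
  | vertex (w : V)
  | cut (a : List (V × V))
  | ret (r : Option (List (V × V)))

section Algorithm

variable {V : Type*} [DecidableEq V]

/-- `r` lists the elements of the returned set, if any, without repetition. -/
def ListsResult : Option (List (V × V)) → Option (Finset (V × V)) → Prop
  | none, none => True
  | some l, some F => l.Nodup ∧ l.toFinset = F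
  | _, _ => False

/-- The while loop: as long as some `w ∈ W` is on no cycle, remove such a `w` from `W`.
`Prune G W log W'`: the loop, started with `W`, can end with `W'` and produce the events `log`. -/
inductive Prune (G : Digraph V) : Finset V → List (Event V) → Finset V → Prop
  | done {W} : (∀ w ∈ W, OnCycle G w) → Prune G W [] W
  | step {W w log W'} : w ∈ W → ¬ OnCycle G w → Prune G (W.erase w) log W' →
      Prune G W (.discard w :: log) W'

mutual

/-- `Run G W k log res`: the call `DFAS-V(G, W, k)` has an execution that produces the sequence of
events `log` and returns `res`. (The order in which the loops traverse their ranges is free.) -/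
inductive Run : Digraph V → Finset V → ℕ → List (Event V) → Option (Finset (V × V)) → Prop
  | acyclic {G W k} : IsAcyclic G → Run G W k [.ret (some [])] (some ∅)
  | exhausted {G W} : ¬ IsAcyclic G → Run G W 0 [.ret none] none
  | branch {G W k log₁ W' log₂ res r} : ¬ IsAcyclic G → k ≠ 0 → Prune G W log₁ W' →
      EachVertex G W' k W' log₂ res → ListsResult r res →
      Run G W k (log₁ ++ log₂ ++ [.ret r]) res

/-- The outer loop over hint vertices; `U` is the set of vertices that are still to be treated. -/
inductive EachVertex : Digraph V → Finset V → ℕ → Finset V → List (Event V) →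
    Option (Finset (V × V)) → Prop
  | done {G W k} : EachVertex G W k ∅ [] none
  | next {G W k U w log₁ log₂ res} : w ∈ U →
      EachCut G W k w (importantCuts G W k w) log₁ none →
      EachVertex G W k (U.erase w) log₂ res →
      EachVertex G W k U (.vertex w :: (log₁ ++ log₂)) res
  | found {G W k U w log F} : w ∈ U →
      EachCut G W k w (importantCuts G W k w) log (some F) →
      EachVertex G W k U (.vertex w :: log) (some F)

/-- The inner loop over important cuts; `U` is the set of cuts that are still to be treated. -/
inductive EachCut : Digraph V → Finset V → ℕ → V → Set (Finset (Option V × Option V)) →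
    List (Event V) → Option (Finset (V × V)) → Prop
  | done {G W k w} : EachCut G W k w ∅ [] none
  | next {G W k w U S a log₁ log₂ res} : S ∈ U → ListsCut G w S a →
      Run (deleteArcs G a.toFinset) (W.erase w) (k - S.card) log₁ none →
      EachCut G W k w (U \ {S}) log₂ res →
      EachCut G W k w U (.cut a :: (log₁ ++ log₂)) res
  | found {G W k w U S a log F} : S ∈ U → ListsCut G w S a →
      Run (deleteArcs G a.toFinset) (W.erase w) (k - S.card) log (some F) →
      EachCut G W k w U (.cut a :: log) (some (F ∪ a.toFinset))

end

end Algorithm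

/-! ### Random access machines with unit costs -/

/-- Expressions over registers and memory; subtraction on `ℕ` is truncated. -/
inductive Expr
  | lit (c : ℕ)
  | reg (x : ℕ)
  | add (e f : Expr)
  | sub (e f : Expr)
  | load (e : Expr)

/-- Program code. `call i` calls the `i`-th procedure; there are no parameters and no local
variables, so only return addresses are kept implicitly. -/
inductive Cmd
  | skip
  | assign (x : ℕ) (e : Expr)
  | store (e f : Expr)
  | emit (e : Expr)
  | seq (c d : Cmd)
  | ite (e : Expr) (c d : Cmd)
  | loop (e : Expr) (c : Cmd)
  | call (i : ℕ)

/-- A program: a finite table of procedures and a main command. -/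
structure Program where
  procs : List Cmd
  main : Cmd

/-- Registers, memory, and the words written to the output tape so far. -/
structure State where
  reg : ℕ → ℕ
  mem : ℕ → ℕ
  out : List ℕ

/-- The value of an expression. -/
def Expr.eval (s : State) : Expr → ℕ
  | .lit c => c
  | .reg x => s.reg x
  | .add e f => e.eval s + f.eval s
  | .sub e f => e.eval s - f.eval s
  | .load e => s.mem (e.eval s)

/-- The cost of an expression: one time unit for each constant, register access, addition,
subtraction and memory access. -/
def Expr.cost : Expr → ℕ
  | .lit _ => 1
  | .reg _ => 1
  | .add e f => e.cost + f.cost + 1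
  | .sub e f => e.cost + f.cost + 1
  | .load e => e.cost + 1

/-- `Exec procs c s t s'`: started in state `s`, the command `c` halts after exactly `t` time units
in state `s'`. Every assignment, store, output, test and call costs one unit in addition to
the cost of the expressions involved. A test succeeds when its value is nonzero. -/
inductive Exec (procs : List Cmd) : Cmd → State → ℕ → State → Prop
  | skip {s} : Exec procs .skip s 1 s
  | assign {s x e} : Exec procs (.assign x e) s (e.cost + 1)
      { s with reg := Function.update s.reg x (e.eval s) }
  | store {s e f} : Exec procs (.store e f) s (e.cost + f.cost + 1)
      { s with mem := Function.update s.mem (e.eval s) (f.eval s) }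
  | emit {s e} : Exec procs (.emit e) s (e.cost + 1) { s with out := s.out ++ [e.eval s] }
  | seq {s t s₁ t₁ s₂ c d} : Exec procs c s t s₁ → Exec procs d s₁ t₁ s₂ →
      Exec procs (.seq c d) s (t + t₁) s₂
  | ite_true {s t s₁ e c d} : e.eval s ≠ 0 → Exec procs c s t s₁ →
      Exec procs (.ite e c d) s (e.cost + 1 + t) s₁
  | ite_false {s t s₁ e c d} : e.eval s = 0 → Exec procs d s t s₁ →
      Exec procs (.ite e c d) s (e.cost + 1 + t) s₁
  | loop_exit {s e c} : e.eval s = 0 → Exec procs (.loop e c) s (e.cost + 1) s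
  | loop_step {s t s₁ t₁ s₂ e c} : e.eval s ≠ 0 → Exec procs c s t s₁ →
      Exec procs (.loop e c) s₁ t₁ s₂ →
      Exec procs (.loop e c) s (e.cost + 1 + t + t₁) s₂
  | call {s t s₁ i c} : procs[i]? = some c → Exec procs c s t s₁ →
      Exec procs (.call i) s (t + 1) s₁

/-- The initial state: the input words in the first memory cells, zero everywhere else. -/
def initState (input : List ℕ) : State where
  reg _ := 0
  mem i := input.getD i 0
  out := []

/-- On this input, the program halts after exactly `t` time units with this output. -/
def Program.HaltsWith (P : Program) (input : List ℕ) (t : ℕ) (output : List ℕ) : Prop :=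
  ∃ s, Exec P.procs P.main (initState input) t s ∧ s.out = output

/-! ### Input and output formats -/

/-- A list of arcs as a list of words. -/
def encodeArcs {n : ℕ} (l : List (Fin n × Fin n)) : List ℕ :=
  l.flatMap fun e => [(e.1 : ℕ), (e.2 : ℕ)]

/-- The input words for a digraph with vertices `0, …, n - 1`, a list of its arcs, a list of
the hint vertices, and the parameter `k`. -/
def encodeInput {n : ℕ} (arcs : List (Fin n × Fin n)) (hint : List (Fin n)) (k : ℕ) : List ℕ :=
  [n, arcs.length, hint.length, k] ++ encodeArcs arcs ++ hint.map (fun w => (w : ℕ))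

/-- An event as a list of words: a tag followed by the data. -/
def Event.encode {n : ℕ} : Event (Fin n) → List ℕ
  | .discard w => [0, (w : ℕ)]
  | .vertex w => [1, (w : ℕ)]
  | .cut a => 2 :: a.length :: encodeArcs a
  | .ret none => [3]
  | .ret (some l) => 4 :: l.length :: encodeArcs l

end DFAS

/-!
Running-time analysis of the algorithm `DFAS-V`, on a unit-cost random access machine.

The program is written for a more convenient machine with named registers and arrays. Its
translation to the random access machine slows it down by a constant factor only (`Runs.compile`),
and its correctness and running time are derived with weakest preconditions (`WP`).

An important cut is the boundary of an *important set*, a vertex set such that every larger set on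
the source side has a larger boundary (`isImportantCut_iff`). The important cuts are enumerated by
branching: a node of the enumeration tree consists of a set `X` of vertices that stay on the source
side and a set `D` of arcs chosen for the cut. As the size of the boundary is submodular, `X` can be
replaced by its furthest minimum cut `M` (`Furthest.cutsAt_eq`); then an arc leaving `M` is either
chosen or its head is added to `M` (`cutsAt_branch`). If no arc leaves `M`, then `D` is the only
candidate, and whether `D` is an important cut can be read off from one more flow computation
(`IsNode.leaf_good`, `IsNode.leaf_bad₁`, `IsNode.leaf_bad₂`). The two branches have no cut in common,
so every important cut is found exactly once and the enumeration is an execution of the inner loop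
of the algorithm (`Covers.union`, `Covers.eachCut`). A furthest minimum cut of size at most `b` takes
at most `b + 1` augmentations, each in linear time (`wp_maxFlow`). Finally, since the hint is
a feedback vertex set, the digraph is acyclic if and only if no hint vertex lies on a cycle
(`IsDFVS.isAcyclic`).

For the running time, let `0 < z ≤ 1 / 2` and suppose that the recursive calls following the choice
of a cut of size `d` take time at most `Λ (z - z²)^d`. A node with `d` chosen arcs and minimum cut
size `l` is charged `Λ (z - z²)^d z^l`. Branching leads to `(d + 1, l - 1)` and to `(d, l + 1)`, and
`(z - z²) z^(l - 1) + z^(l + 1) = z^l`; hence all recursive calls below the node are paid for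
(`enumSpec`). The potential `2 b + 2 - l`, where `b` is the number of arcs that may still be chosen,
decreases in both branches, so the tree has fewer than `4^(k + 1)` nodes. At the root `l ≥ 1`,
because `w` lies on a cycle. An induction on the number `q` of hint vertices (`dfasSpec_succ`,
`dfasSpec`) bounds the time by a multiple of
`q! ((1 + z) / (1 - z))^q (z - z²)^(q - 1 - k) (n + m)`, with a factor that depends on `z` only. For
`q = k + 1` and `z = 1 / (2 √(k + 1))` this is `k! 2^O(√k) (n + m)` (`timeBound_le`), and `√k` is
`o(k)`.
-/

namespace DFAS

open Function

/-! ### A machine with named registers and arrays -/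

/-- Register names. `n` and `m` hold the size of the digraph, `len` the number `n + m + 1`, `k` the
parameter of the current call, `w` the current hint vertex and `b` the number of arcs that may still
be chosen at the current node of the enumeration tree. The flow computation is bounded by `cap` and
finds the value `val`; `sp` is the stack pointer, and `ret` tells whether a call has found a set. -/
inductive Reg
  | n | m | len | k | w | b | x | val | cap | i | v | e | u | tp | cnt | sp | ret | h
  deriving DecidableEq

/-- Array names. Indexed by arcs: the tails `T0` and heads `H0` of the input, the status `ST` in the
current instance, the usable arcs `C`, the flow `FL`, the tails `TT` in the expanded graph, the
residual tails `RT` and heads `RH`, the links `NXT` of the chains of arcs, and the result `RES`.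
Indexed by vertices, with the number `n` for `w⁺`: the hint `HF`, the sources `XM` and the targets
`YM` of the flow, the starts `CUR` of the chains, the data `VIS` and `PAR` of the search, and the
hint vertices `OC` on cycles. `STK` is the stack of the search, and the arrays in the last line are
the stacks of the recursion. -/
inductive Arr
  | T0 | H0 | ST | HF | XM | YM | C | FL | TT | RT | RH | CUR | NXT | VIS | PAR | STK | OC | RES
  | SST | SHF | SXM | SK | SW | SB | SE
  deriving DecidableEq

/-- Expressions of the array machine. -/
inductive Term
  | lit (c : ℕ)
  | reg (r : Reg)
  | add (e f : Term)
  | sub (e f : Term)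
  | get (a : Arr) (e : Term)

instance : Add Term := ⟨Term.add⟩
instance : Sub Term := ⟨Term.sub⟩
instance (c : ℕ) : OfNat Term c := ⟨Term.lit c⟩
instance : Coe Reg Term := ⟨Term.reg⟩

/-- Commands of the array machine; `read r e` copies the input word number `e` into a register. -/
inductive Code
  | skip
  | assign (r : Reg) (e : Term)
  | set (a : Arr) (i e : Term)
  | emit (e : Term)
  | read (r : Reg) (e : Term)
  | seq (c d : Code)
  | ite (e : Term) (c d : Code)
  | loop (e : Term) (c : Code)
  | call (i : ℕ)

/-- Configurations of the array machine: registers, infinitely many cells in each array, the output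
written so far, and the read-only input. -/
structure Conf where
  reg : Reg → ℕ
  mem : Arr → ℕ → ℕ
  out : List ℕ
  inp : List ℕ

/-- The configuration `s` with a new value in one register. -/
def Conf.setReg (s : Conf) (r : Reg) (x : ℕ) : Conf :=
  { s with reg := Function.update s.reg r x }

/-- The configuration `s` with new contents of one array. -/
def Conf.setMem (s : Conf) (a : Arr) (M : ℕ → ℕ) : Conf :=
  { s with mem := Function.update s.mem a M }

/-- The configuration `s` with some words appended to the output. -/
def Conf.write (s : Conf) (l : List ℕ) : Conf := { s with out := s.out ++ l }

namespace Conf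

variable (s : Conf) (r r' : Reg) (a a' : Arr) (x : ℕ) (M : ℕ → ℕ) (l l' : List ℕ)

@[simp] theorem reg_setReg : (s.setReg r x).reg r' = if r' = r then x else s.reg r' := by
  simp [setReg, Function.update_apply]
@[simp] theorem mem_setReg : (s.setReg r x).mem = s.mem := rfl
@[simp] theorem out_setReg : (s.setReg r x).out = s.out := rfl
@[simp] theorem inp_setReg : (s.setReg r x).inp = s.inp := rfl
@[simp] theorem reg_setMem : (s.setMem a M).reg = s.reg := rfl
@[simp] theorem mem_setMem : (s.setMem a M).mem a' = if a' = a then M else s.mem a' := by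
  simp [setMem, Function.update_apply]
@[simp] theorem out_setMem : (s.setMem a M).out = s.out := rfl
@[simp] theorem inp_setMem : (s.setMem a M).inp = s.inp := rfl
@[simp] theorem reg_write : (s.write l).reg = s.reg := rfl
@[simp] theorem mem_write : (s.write l).mem = s.mem := rfl
@[simp] theorem out_write : (s.write l).out = s.out ++ l := rfl

theorem setReg_setReg (y : ℕ) : (s.setReg r x).setReg r y = s.setReg r y := by
  simp [setReg]
theorem setMem_setMem (M' : ℕ → ℕ) : (s.setMem a M).setMem a M' = s.setMem a M' := by
  simp [setMem]
theorem setReg_comm (y : ℕ) (h : r ≠ r') :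
    (s.setReg r x).setReg r' y = (s.setReg r' y).setReg r x := by
  simp [setReg, Function.update_comm h]
theorem setMem_setReg : (s.setReg r x).setMem a M = (s.setMem a M).setReg r x := rfl
theorem write_write : (s.write l).write l' = s.write (l ++ l') := by simp [write]
theorem write_setReg : (s.setReg r x).write l = (s.write l).setReg r x := rfl
theorem write_nil : s.write [] = s := by simp [write]
theorem setMem_mem (h : s.mem a = M) : s.setMem a M = s := by subst h; simp [setMem]

end Conf

/-- The value of an expression of the array machine. -/
def Term.eval (s : Conf) : Term → ℕ
  | .lit c => c
  | .reg r => s.reg r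
  | .add e f => e.eval s + f.eval s
  | .sub e f => e.eval s - f.eval s
  | .get a e => s.mem a (e.eval s)

namespace Term

@[simp] theorem eval_zero (s : Conf) : (0 : Term).eval s = 0 := rfl
@[simp] theorem eval_one (s : Conf) : (1 : Term).eval s = 1 := rfl
@[simp] theorem eval_two (s : Conf) : (2 : Term).eval s = 2 := rfl
@[simp] theorem eval_three (s : Conf) : (3 : Term).eval s = 3 := rfl
@[simp] theorem eval_four (s : Conf) : (4 : Term).eval s = 4 := rfl
@[simp] theorem eval_reg (s r) : (Term.reg r).eval s = s.reg r := rfl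
@[simp] theorem eval_add (s) (e f : Term) : (e + f).eval s = e.eval s + f.eval s := rfl
@[simp] theorem eval_sub (s) (e f : Term) : (e - f).eval s = e.eval s - f.eval s := rfl
@[simp] theorem eval_get (s a e) : (Term.get a e).eval s = s.mem a (e.eval s) := rfl

/-- Negation: `1` if the value is `0`, otherwise `0`. -/
def not (e : Term) : Term := 1 - e

/-- Conjunction, up to the choice of the nonzero value. -/
def and (e f : Term) : Term := 1 - ((1 - e) + (1 - f))

/-- Equality test. -/
def eq (e f : Term) : Term := 1 - ((e - f) + (f - e))

@[simp] theorem eval_not (s) (e : Term) : e.not.eval s = if e.eval s = 0 then 1 else 0 := by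
  simp only [not, eval_sub, eval_one]; split <;> omega
@[simp] theorem eval_and (s) (e f : Term) :
    (e.and f).eval s = if e.eval s ≠ 0 ∧ f.eval s ≠ 0 then 1 else 0 := by
  simp only [and, eval_sub, eval_one, eval_add]; split <;> omega
@[simp] theorem eval_eq (s) (e f : Term) :
    (e.eq f).eval s = if e.eval s = f.eval s then 1 else 0 := by
  simp only [eq, eval_sub, eval_one, eval_add]; split <;> omega

end Term

/-- `Runs procs c s t s'`: the command `c` leads from `s` to `s'` by executing `t` basic commands.
Evaluating an expression is free here; a read beyond the end of the input blocks. -/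
inductive Runs (procs : List Code) : Code → Conf → ℕ → Conf → Prop
  | skip {s} : Runs procs .skip s 1 s
  | assign {s r e} : Runs procs (.assign r e) s 1 (s.setReg r (e.eval s))
  | set {s a i e} : Runs procs (.set a i e) s 1
      (s.setMem a (Function.update (s.mem a) (i.eval s) (e.eval s)))
  | emit {s e} : Runs procs (.emit e) s 1 (s.write [e.eval s])
  | read {s r e} : e.eval s < s.inp.length → Runs procs (.read r e) s 1
      (s.setReg r (s.inp.getD (e.eval s) 0))
  | seq {s t s₁ t₁ s₂ c d} : Runs procs c s t s₁ → Runs procs d s₁ t₁ s₂ →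
      Runs procs (.seq c d) s (t + t₁) s₂
  | ite_true {s t s₁ e c d} : e.eval s ≠ 0 → Runs procs c s t s₁ →
      Runs procs (.ite e c d) s (1 + t) s₁
  | ite_false {s t s₁ e c d} : e.eval s = 0 → Runs procs d s t s₁ →
      Runs procs (.ite e c d) s (1 + t) s₁
  | loop_exit {s e c} : e.eval s = 0 → Runs procs (.loop e c) s 1 s
  | loop_step {s t s₁ t₁ s₂ e c} : e.eval s ≠ 0 → Runs procs c s t s₁ →
      Runs procs (.loop e c) s₁ t₁ s₂ →
      Runs procs (.loop e c) s (1 + t + t₁) s₂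
  | call {s t s₁ i c} : procs[i]? = some c → Runs procs c s t s₁ →
      Runs procs (.call i) s (t + 1) s₁

/-! ### Compilation to the random access machine -/

theorem Arr.ctorIdx_injective : Function.Injective Arr.ctorIdx := by
  intro a a' h
  cases a <;> cases a' <;> first | rfl | exact absurd h (by decide)

theorem Arr.ctorIdx_lt (a : Arr) : a.ctorIdx < 32 := by
  cases a <;> decide

theorem Reg.ctorIdx_injective : Function.Injective Reg.ctorIdx := by
  intro a a' h
  cases a <;> cases a' <;> first | rfl | exact absurd h (by decide)

/-- `e + e` as an expression of the random access machine. -/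
def Expr.double (e : Expr) : Expr := .add e e

/-- The address of a cell: register `0` holds the length of the input, and behind the input the
arrays are interleaved with stride `32`. -/
def cellAddr (a : Arr) (e : Expr) : Expr :=
  .add (.add (.reg 0) (.lit a.ctorIdx)) e.double.double.double.double.double

/-- Translation of expressions. Register `r` becomes register `r.ctorIdx + 1`. -/
def Term.compile : Term → Expr
  | .lit c => .lit c
  | .reg r => .reg (r.ctorIdx + 1)
  | .add e f => .add e.compile f.compile
  | .sub e f => .sub e.compile f.compile
  | .get a e => .load (cellAddr a e.compile)

/-- Translation of commands. -/
def Code.compile : Code → Cmd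
  | .skip => .skip
  | .assign r e => .assign (r.ctorIdx + 1) e.compile
  | .set a i e => .store (cellAddr a i.compile) e.compile
  | .emit e => .emit e.compile
  | .read r e => .assign (r.ctorIdx + 1) (.load e.compile)
  | .seq c d => .seq c.compile d.compile
  | .ite e c d => .ite e.compile c.compile d.compile
  | .loop e c => .loop e.compile c.compile
  | .call i => .call i

/-- A bound on the cost of each single step of the translation of a command. -/
def Code.stepCost : Code → ℕ
  | .skip => 1
  | .assign _ e => e.compile.cost + 1
  | .set a i e => (cellAddr a i.compile).cost + e.compile.cost + 1
  | .emit e => e.compile.cost + 1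
  | .read _ e => e.compile.cost + 2
  | .seq c d => max c.stepCost d.stepCost
  | .ite e c d => max (e.compile.cost + 1) (max c.stepCost d.stepCost)
  | .loop e c => max (e.compile.cost + 1) c.stepCost
  | .call _ => 1

/-- The state `s` of the random access machine represents the configuration `h`. -/
structure Represents (h : Conf) (s : State) : Prop where
  base : s.reg 0 = h.inp.length
  reg : ∀ r : Reg, s.reg (r.ctorIdx + 1) = h.reg r
  mem : ∀ (a : Arr) i, s.mem (h.inp.length + a.ctorIdx + 32 * i) = h.mem a i
  out : s.out = h.out
  inp : ∀ i, i < h.inp.length → s.mem i = h.inp.getD i 0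

theorem Term.compile_eval {h : Conf} {s : State} (hs : Represents h s) (e : Term) :
    e.compile.eval s = e.eval h := by
  induction e with
  | lit c => rfl
  | reg r => exact hs.reg r
  | add e f he hf => simp only [compile, Expr.eval, he, hf, Term.eval]
  | sub e f he hf => simp only [compile, Expr.eval, he, hf, Term.eval]
  | get a e he =>
    simp only [compile, Expr.eval, cellAddr, Expr.double, he, Term.eval, hs.base, ← hs.mem]
    congr 1; omega

theorem cellAddr_eval {h : Conf} {s : State} (hs : Represents h s) (a : Arr) (e : Term) :
    (cellAddr a e.compile).eval s = h.inp.length + a.ctorIdx + 32 * e.eval h := by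
  simp only [cellAddr, Expr.eval, Expr.double, Term.compile_eval hs, hs.base]; omega

theorem Represents.update_reg {h : Conf} {s : State} (hs : Represents h s) (r : Reg) (x : ℕ) :
    Represents (h.setReg r x)
      { s with reg := Function.update s.reg (r.ctorIdx + 1) x } where
  base := by simpa using hs.base
  reg r' := by
    by_cases hr : r' = r
    · subst hr; simp
    · rw [Conf.reg_setReg, if_neg hr]
      have : r'.ctorIdx ≠ r.ctorIdx := fun hh => hr (Reg.ctorIdx_injective hh)
      simp [this, hs.reg]
  mem := hs.mem
  out := hs.out
  inp := hs.inp

/-- The simulation: a run of the array machine is matched by its translation, with a constant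
factor that depends on the program only. -/
theorem Runs.compile {procs : List Code} {K : ℕ} (hK : ∀ c ∈ procs, c.stepCost ≤ K)
    {c : Code} {h : Conf} {t : ℕ} {h' : Conf} (hr : Runs procs c h t h') :
    c.stepCost ≤ K → 1 ≤ K → ∀ s, Represents h s →
      ∃ t' s', Exec (procs.map Code.compile) c.compile s t' s' ∧ Represents h' s' ∧ t' ≤ K * t := by
  induction hr with
  | skip => intro hc h1 s hs; exact ⟨_, s, .skip, hs, by omega⟩
  | assign =>
    intro hc h1 s hs
    refine ⟨_, _, .assign, ?_, by simpa [Code.stepCost] using hc⟩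
    rw [Term.compile_eval hs]; exact hs.update_reg _ _
  | @set h a i e =>
    intro hc h1 s hs
    refine ⟨_, _, .store, ?_, by simpa [Code.stepCost] using hc⟩
    rw [Term.compile_eval hs, cellAddr_eval hs]
    refine ⟨hs.base, hs.reg, ?_, hs.out, ?_⟩
    · intro a' i'
      simp only [Conf.mem_setMem, Conf.inp_setMem]
      have h1 := a.ctorIdx_lt
      have h2 := a'.ctorIdx_lt
      by_cases ha : a' = a
      · subst ha
        by_cases hi : i' = i.eval h
        · subst hi; simp
        · simp only [if_true, Function.update_of_ne hi]
          rw [Function.update_of_ne (by omega)]; exact hs.mem _ _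
      · have : a'.ctorIdx ≠ a.ctorIdx := fun hh => ha (Arr.ctorIdx_injective hh)
        simp only [if_neg ha]
        rw [Function.update_of_ne (by omega)]; exact hs.mem _ _
    · intro j hj
      simp only [Conf.inp_setMem] at hj ⊢
      rw [Function.update_of_ne (by omega)]; exact hs.inp j hj
  | emit =>
    intro hc h1 s hs
    refine ⟨_, _, .emit, ?_, by simpa [Code.stepCost] using hc⟩
    rw [Term.compile_eval hs]
    exact ⟨hs.base, hs.reg, hs.mem, by simp [hs.out], hs.inp⟩
  | @read h r e hlt =>
    intro hc h1 s hs
    refine ⟨_, _, .assign, ?_, by simp only [Code.stepCost] at hc; simp [Expr.cost]; omega⟩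
    simp only [Expr.eval, Term.compile_eval hs, hs.inp _ hlt]; exact hs.update_reg _ _
  | seq _ _ ih1 ih2 =>
    intro hc h1 s hs
    simp only [Code.stepCost, max_le_iff] at hc
    obtain ⟨t1, s1, e1, r1, l1⟩ := ih1 hc.1 h1 s hs
    obtain ⟨t2, s2, e2, r2, l2⟩ := ih2 hc.2 h1 s1 r1
    exact ⟨_, s2, .seq e1 e2, r2, by rw [mul_add]; omega⟩
  | ite_true hne _ ih =>
    intro hc h1 s hs
    simp only [Code.stepCost, max_le_iff] at hc
    obtain ⟨t1, s1, e1, r1, l1⟩ := ih hc.2.1 h1 s hs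
    exact ⟨_, s1, .ite_true (by rwa [Term.compile_eval hs]) e1, r1, by rw [mul_add]; omega⟩
  | ite_false hne _ ih =>
    intro hc h1 s hs
    simp only [Code.stepCost, max_le_iff] at hc
    obtain ⟨t1, s1, e1, r1, l1⟩ := ih hc.2.2 h1 s hs
    exact ⟨_, s1, .ite_false (by rwa [Term.compile_eval hs]) e1, r1, by rw [mul_add]; omega⟩
  | loop_exit hne =>
    intro hc h1 s hs
    simp only [Code.stepCost, max_le_iff] at hc
    exact ⟨_, s, .loop_exit (by rwa [Term.compile_eval hs]), hs, by omega⟩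
  | loop_step hne _ _ ih1 ih2 =>
    intro hc h1 s hs
    have hc' := hc
    simp only [Code.stepCost, max_le_iff] at hc
    obtain ⟨t1, s1, e1, r1, l1⟩ := ih1 hc.2 h1 s hs
    obtain ⟨t2, s2, e2, r2, l2⟩ := ih2 hc' h1 s1 r1
    exact ⟨_, s2, .loop_step (by rwa [Term.compile_eval hs]) e1 e2, r2, by
      rw [mul_add, mul_add]; omega⟩
  | @call _ _ _ i c hi _ ih =>
    intro hc h1 s hs
    obtain ⟨t1, s1, e1, r1, l1⟩ := ih (hK _ (List.mem_of_getElem? hi)) h1 s hs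
    exact ⟨_, s1, .call (by simp [hi]) e1, r1, by rw [mul_add]; omega⟩

/-! ### Weakest preconditions with running times -/

/-- `WP P c s Q`: from `s`, the command `c` halts after some number `t` of steps in some `s'` such
that `Q t s'` holds. -/
def WP (P : List Code) (c : Code) (s : Conf) (Q : ℕ → Conf → Prop) : Prop :=
  ∃ t s', Runs P c s t s' ∧ Q t s'

/-- Sequential composition of a list of commands. -/
def block : List Code → Code
  | [] => .skip
  | [c] => c
  | c :: d :: l => .seq c (block (d :: l))

section WP

variable {P : List Code} {s : Conf} {Q : ℕ → Conf → Prop}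

theorem WP.mono {c : Code} {Q' : ℕ → Conf → Prop} (h : WP P c s Q)
    (hQ : ∀ t s', Q t s' → Q' t s') : WP P c s Q' := by
  obtain ⟨t, s', h1, h2⟩ := h; exact ⟨t, s', h1, hQ _ _ h2⟩

@[simp] theorem wp_skip : WP P .skip s Q ↔ Q 1 s :=
  ⟨by rintro ⟨t, s', h, hQ⟩; cases h; exact hQ, fun h => ⟨_, _, .skip, h⟩⟩

@[simp] theorem wp_assign {r e} : WP P (.assign r e) s Q ↔
    Q 1 (s.setReg r (e.eval s)) :=
  ⟨by rintro ⟨t, s', h, hQ⟩; cases h; exact hQ, fun h => ⟨_, _, .assign, h⟩⟩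

@[simp] theorem wp_set {a i e} : WP P (.set a i e) s Q ↔
    Q 1 (s.setMem a (Function.update (s.mem a) (i.eval s) (e.eval s))) :=
  ⟨by rintro ⟨t, s', h, hQ⟩; cases h; exact hQ, fun h => ⟨_, _, .set, h⟩⟩

@[simp] theorem wp_emit {e} : WP P (.emit e) s Q ↔ Q 1 (s.write [e.eval s]) :=
  ⟨by rintro ⟨t, s', h, hQ⟩; cases h; exact hQ, fun h => ⟨_, _, .emit, h⟩⟩

theorem wp_read {r e} (he : e.eval s < s.inp.length)
    (h : Q 1 (s.setReg r (s.inp.getD (e.eval s) 0))) :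
    WP P (.read r e) s Q := ⟨_, _, .read he, h⟩

@[simp] theorem wp_seq {c d} : WP P (.seq c d) s Q ↔
    WP P c s fun t s₁ => WP P d s₁ fun t₁ s₂ => Q (t + t₁) s₂ := by
  constructor
  · rintro ⟨t, s', h, hQ⟩
    cases h with
    | seq h1 h2 => exact ⟨_, _, h1, _, _, h2, hQ⟩
  · rintro ⟨t, s', h, t', s'', h', hQ⟩
    exact ⟨_, _, .seq h h', hQ⟩

theorem wp_ite {e c d} (h1 : e.eval s ≠ 0 → WP P c s fun t => Q (1 + t))
    (h0 : e.eval s = 0 → WP P d s fun t => Q (1 + t)) : WP P (.ite e c d) s Q := by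
  by_cases h : e.eval s = 0
  · obtain ⟨t, s', h2, h3⟩ := h0 h; exact ⟨_, _, .ite_false h h2, h3⟩
  · obtain ⟨t, s', h2, h3⟩ := h1 h; exact ⟨_, _, .ite_true h h2, h3⟩

theorem wp_call {i c} (hi : P[i]? = some c) (h : WP P c s fun t => Q (t + 1)) :
    WP P (.call i) s Q := by
  obtain ⟨t, s', h2, h3⟩ := h; exact ⟨_, _, .call hi h2, h3⟩

@[simp] theorem wp_block_one {c} : WP P (block [c]) s Q ↔ WP P c s Q := Iff.rfl
@[simp] theorem wp_block_cons {c d l} : WP P (block (c :: d :: l)) s Q ↔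
    WP P c s fun t s₁ => WP P (block (d :: l)) s₁ fun t₁ s₂ => Q (t + t₁) s₂ := wp_seq

/-! ### Frames: what a command leaves unchanged -/

/-- Does the command possibly write this register? (A call may write everything.) -/
def Code.wr : Code → Reg → Bool
  | .skip, _ => false
  | .assign r _, r' => decide (r = r')
  | .set _ _ _, _ => false
  | .emit _, _ => false
  | .read r _, r' => decide (r = r')
  | .seq c d, r => c.wr r || d.wr r
  | .ite _ c d, r => c.wr r || d.wr r
  | .loop _ c, r => c.wr r
  | .call _, _ => true

/-- Does the command possibly write this array? -/
def Code.wa : Code → Arr → Bool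
  | .set a _ _, a' => decide (a = a')
  | .seq c d, r => c.wa r || d.wa r
  | .ite _ c d, r => c.wa r || d.wa r
  | .loop _ c, r => c.wa r
  | .call _, _ => true
  | _, _ => false

/-- Does the command possibly write output? -/
def Code.wo : Code → Bool
  | .emit _ => true
  | .seq c d => c.wo || d.wo
  | .ite _ c d => c.wo || d.wo
  | .loop _ c => c.wo
  | .call _ => true
  | _ => false

/-- `s'` differs from `s` only in what the command `c` can write. -/
structure Frame (c : Code) (s s' : Conf) : Prop where
  reg : ∀ r, c.wr r = false → s'.reg r = s.reg r
  mem : ∀ a, c.wa a = false → s'.mem a = s.mem a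
  out : c.wo = false → s'.out = s.out
  inp : s'.inp = s.inp

theorem Frame.refl (c s) : Frame c s s := ⟨fun _ _ => rfl, fun _ _ => rfl, fun _ => rfl, rfl⟩

theorem Frame.trans {c s₁ s₂ s₃} (h : Frame c s₁ s₂) (h' : Frame c s₂ s₃) : Frame c s₁ s₃ :=
  ⟨fun r hr => (h'.reg r hr).trans (h.reg r hr), fun r hr => (h'.mem r hr).trans (h.mem r hr),
    fun hr => (h'.out hr).trans (h.out hr), h'.inp.trans h.inp⟩

theorem Runs.frame {c s t s'} (h : Runs P c s t s') : Frame c s s' := by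
  induction h with
  | skip => exact .refl _ _
  | assign =>
    refine ⟨fun r hr => ?_, fun _ _ => rfl, fun _ => rfl, rfl⟩
    simp only [Code.wr, decide_eq_false_iff_not] at hr
    exact Function.update_of_ne (Ne.symm hr) _ _
  | set =>
    refine ⟨fun _ _ => rfl, fun r hr => ?_, fun _ => rfl, rfl⟩
    simp only [Code.wa, decide_eq_false_iff_not] at hr
    exact Function.update_of_ne (Ne.symm hr) _ _
  | emit => exact ⟨fun _ _ => rfl, fun _ _ => rfl, fun h => by simp [Code.wo] at h, rfl⟩
  | read =>
    refine ⟨fun r hr => ?_, fun _ _ => rfl, fun _ => rfl, rfl⟩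
    simp only [Code.wr, decide_eq_false_iff_not] at hr
    exact Function.update_of_ne (Ne.symm hr) _ _
  | seq _ _ h1 h2 =>
    refine ⟨fun r hr => ?_, fun r hr => ?_, fun hr => ?_, h2.inp.trans h1.inp⟩
    · simp only [Code.wr, Bool.or_eq_false_iff] at hr
      exact (h2.reg r hr.2).trans (h1.reg r hr.1)
    · simp only [Code.wa, Bool.or_eq_false_iff] at hr
      exact (h2.mem r hr.2).trans (h1.mem r hr.1)
    · simp only [Code.wo, Bool.or_eq_false_iff] at hr
      exact (h2.out hr.2).trans (h1.out hr.1)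
  | ite_true _ _ h =>
    refine ⟨fun r hr => ?_, fun r hr => ?_, fun hr => ?_, h.inp⟩
    · simp only [Code.wr, Bool.or_eq_false_iff] at hr; exact h.reg r hr.1
    · simp only [Code.wa, Bool.or_eq_false_iff] at hr; exact h.mem r hr.1
    · simp only [Code.wo, Bool.or_eq_false_iff] at hr; exact h.out hr.1
  | ite_false _ _ h =>
    refine ⟨fun r hr => ?_, fun r hr => ?_, fun hr => ?_, h.inp⟩
    · simp only [Code.wr, Bool.or_eq_false_iff] at hr; exact h.reg r hr.2
    · simp only [Code.wa, Bool.or_eq_false_iff] at hr; exact h.mem r hr.2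
    · simp only [Code.wo, Bool.or_eq_false_iff] at hr; exact h.out hr.2
  | loop_exit => exact .refl _ _
  | loop_step _ _ _ h1 h2 =>
    exact ⟨fun r hr => (h2.reg r hr).trans (h1.reg r hr),
      fun r hr => (h2.mem r hr).trans (h1.mem r hr),
      fun hr => (h2.out hr).trans (h1.out hr), h2.inp.trans h1.inp⟩
  | call _ _ h => exact ⟨fun r hr => by simp [Code.wr] at hr, fun r hr => by simp [Code.wa] at hr,
      fun hr => by simp [Code.wo] at hr, h.inp⟩

theorem WP.frame {c : Code} (h : WP P c s Q) : WP P c s fun t s' => Frame c s s' ∧ Q t s' := by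
  obtain ⟨t, s', h1, h2⟩ := h; exact ⟨t, s', h1, h1.frame, h2⟩

/-- The loop rule. The invariant carries a time budget from which each iteration is paid. -/
theorem wp_loop {e : Term} {c : Code} (inv : ℕ → Conf → Prop) {T : ℕ} (h0 : inv T s)
    (hstep : ∀ T s₁, Frame c s s₁ → inv T s₁ → e.eval s₁ ≠ 0 →
      WP P c s₁ fun t s₂ => ∃ T', inv T' s₂ ∧ 1 + t + T' ≤ T)
    (hexit : ∀ T' s₁ t, Frame c s s₁ → inv T' s₁ → e.eval s₁ = 0 → t + T' ≤ T + 1 → Q t s₁) :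
    WP P (.loop e c) s Q := by
  suffices H : ∀ T s₁, Frame c s s₁ → inv T s₁ → WP P (.loop e c) s₁ fun t s₂ =>
      ∃ T', Frame c s s₂ ∧ inv T' s₂ ∧ e.eval s₂ = 0 ∧ t + T' ≤ T + 1 by
    obtain ⟨t, s', h1, T', h2, h3, h4, h5⟩ := H T s (.refl _ _) h0
    exact ⟨t, s', h1, hexit T' s' t h2 h3 h4 h5⟩
  intro T
  induction T using Nat.strong_induction_on with
  | _ T ih =>
    intro s₁ hf hi
    by_cases he : e.eval s₁ = 0
    · exact ⟨_, _, .loop_exit he, T, hf, hi, he, by omega⟩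
    · obtain ⟨t, s₂, h1, T', h2, h3⟩ := hstep T s₁ hf hi he
      obtain ⟨t', s₃, h4, T'', h5, h6, h7, h8⟩ := ih T' (by omega) s₂ (hf.trans h1.frame) h2
      exact ⟨_, _, .loop_step he h1 h4, T'', h5, h6, h7, by omega⟩

/-! ### Standard loops -/

/-- `for i < bound: c`. -/
def forLoop (bound : Term) (c : Code) : Code :=
  block [.assign .i 0, .loop (bound - Reg.i) (block [c, .assign .i (Reg.i + 1)])]

/-- The body may use the counter, takes time at most `cost`, and leads from `inv j` to `inv (j + 1)`. -/
theorem wp_forLoop {bound : Term} {c : Code} (nb cost : ℕ) (inv : ℕ → Conf → Prop)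
    (h0 : inv 0 (s.setReg .i 0)) (hb : ∀ j s₁, inv j s₁ → bound.eval s₁ = nb)
    (hi : ∀ j s₁, inv j s₁ → s₁.reg .i = j)
    (hstep : ∀ j < nb, ∀ s₁, inv j s₁ → s₁.reg .i = j →
      WP P c s₁ fun t s₂ => t ≤ cost ∧ s₂.reg .i = j ∧ inv (j + 1) (s₂.setReg .i (j + 1)))
    (hQ : ∀ s₁ t, inv nb s₁ → t ≤ (cost + 2) * nb + 2 → Q t s₁) :
    WP P (forLoop bound c) s Q := by
  simp only [forLoop, wp_block_cons, wp_block_one, wp_assign, Term.eval_zero]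
  refine wp_loop (T := (cost + 2) * nb) (fun T s₁ => ∃ j ≤ nb, T = (cost + 2) * (nb - j) ∧
    inv j s₁) ⟨0, by omega, by simp, h0⟩ ?_ ?_
  · rintro T s₁ - ⟨j, hj, rfl, h⟩ he
    have h2 := hi j s₁ h
    have h3 : j < nb := by simp [hb j s₁ h, h2] at he; omega
    rw [wp_block_cons]
    refine (hstep j h3 s₁ h h2).mono ?_
    rintro t s₂ ⟨h4, h5, h6⟩
    simp only [wp_block_one, wp_assign, Term.eval_add, Term.eval_reg, h5, Term.eval_one]
    refine ⟨_, ⟨j + 1, h3, rfl, h6⟩, ?_⟩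
    obtain ⟨d, rfl⟩ : ∃ d, nb = j + 1 + d := ⟨nb - (j + 1), by omega⟩
    rw [show j + 1 + d - j = d + 1 by omega, show j + 1 + d - (j + 1) = d by omega, mul_add]
    omega
  · rintro T' s₁ t - ⟨j, hj, rfl, h⟩ he ht
    have h2 := hi j s₁ h
    obtain rfl : j = nb := by simp [hb j s₁ h, h2] at he; omega
    exact hQ _ _ h (by omega)

/-- `for i < bound: a[off + i] := if c then e else f`. -/
def fillAt (a : Arr) (off bound c e f : Term) : Code :=
  forLoop bound (.ite c (.set a (off + Reg.i) e) (.set a (off + Reg.i) f))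

/-- The condition and the two values are only evaluated in states in which the cell itself has not
been written yet, so the new value may depend on the old one. -/
theorem wp_fillAt {a : Arr} {off bound c e f : Term} (nb o : ℕ) (F : ℕ → ℕ)
    (hb : ∀ j M, bound.eval ((s.setReg .i j).setMem a M) = nb)
    (ho : ∀ j M, off.eval ((s.setReg .i j).setMem a M) = o)
    (hF : ∀ j < nb, ∀ M : ℕ → ℕ, M (o + j) = s.mem a (o + j) →
      (if c.eval ((s.setReg .i j).setMem a M) ≠ 0 then e.eval ((s.setReg .i j).setMem a M)
      else f.eval ((s.setReg .i j).setMem a M)) = F j)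
    (hQ : ∀ t ≤ 4 * nb + 2, Q t ((s.setReg .i nb).setMem a
        fun x => if o ≤ x ∧ x < o + nb then F (x - o) else s.mem a x)) :
    WP P (fillAt a off bound c e f) s Q := by
  refine wp_forLoop nb 2 (fun j s₁ => s₁ = (s.setReg .i j).setMem a
    fun x => if o ≤ x ∧ x < o + j then F (x - o) else s.mem a x) ?_ ?_ ?_ ?_ ?_
  · rw [Conf.setMem_mem]
    funext x
    rw [if_neg (by omega)]; rfl
  · rintro j s₁ rfl; exact hb _ _
  · rintro j s₁ rfl; simp
  · rintro j hj s₁ rfl -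
    have hF' := hF j hj (fun x => if o ≤ x ∧ x < o + j then F (x - o) else s.mem a x) (by simp)
    have hmem : (Function.update
        (fun x => if o ≤ x ∧ x < o + j then F (x - o) else s.mem a x) (o + j) (F j)) =
        fun x => if o ≤ x ∧ x < o + (j + 1) then F (x - o) else s.mem a x := by
      funext x
      by_cases hx : x = o + j
      · subst hx; simp
      · rw [Function.update_of_ne hx]
        have : (o ≤ x ∧ x < o + j) ↔ (o ≤ x ∧ x < o + (j + 1)) := by omega
        simp only [this]
    refine wp_ite (fun hc => ?_) (fun hc => ?_)
    · rw [if_pos hc] at hF'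
      rw [wp_set]
      simp [ho, hF', hmem, Conf.setMem_setMem, ← Conf.setMem_setReg, Conf.setReg_setReg]
    · rw [if_neg (by simpa using hc)] at hF'
      rw [wp_set]
      simp [ho, hF', hmem, Conf.setMem_setMem, ← Conf.setMem_setReg, Conf.setReg_setReg]
  · rintro s₁ t rfl ht
    exact hQ t ht

/-- `for i < bound: a[i] := if c then e else f`. -/
def fill (a : Arr) (bound c e f : Term) : Code := fillAt a 0 bound c e f

theorem wp_fill {a : Arr} {bound c e f : Term} (nb : ℕ) (F : ℕ → ℕ)
    (hb : ∀ j M, bound.eval ((s.setReg .i j).setMem a M) = nb)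
    (hF : ∀ j < nb, ∀ M : ℕ → ℕ, M j = s.mem a j →
      (if c.eval ((s.setReg .i j).setMem a M) ≠ 0 then e.eval ((s.setReg .i j).setMem a M)
      else f.eval ((s.setReg .i j).setMem a M)) = F j)
    (hQ : ∀ t ≤ 4 * nb + 2, Q t ((s.setReg .i nb).setMem a
        fun x => if x < nb then F x else s.mem a x)) :
    WP P (fill a bound c e f) s Q := by
  refine wp_fillAt nb 0 F hb (fun j M => rfl) (by simpa using hF) ?_
  simpa using hQ

/-- `x := 0; for i < bound: if c then x := i + 1`. -/
def find (bound c : Term) : Code :=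
  block [.assign .x 0, forLoop bound (.ite c (.assign .x (Reg.i + 1)) .skip)]

/-- `find` returns `0` if no index has the property, and otherwise `j + 1` for some such index `j`. -/
theorem wp_find {bound c : Term} (nb : ℕ) (p : ℕ → Prop)
    (hb : ∀ y j, bound.eval ((s.setReg .x y).setReg .i j) = nb)
    (hc : ∀ j < nb, ∀ y, c.eval ((s.setReg .x y).setReg .i j) ≠ 0 ↔ p j)
    (hQ : ∀ t ≤ 4 * nb + 3, ∀ y, ((y = 0 ∧ ∀ j < nb, ¬ p j) ∨ ∃ j < nb, y = j + 1 ∧ p j) →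
      Q t ((s.setReg .x y).setReg .i nb)) :
    WP P (find bound c) s Q := by
  simp only [find, wp_block_cons, wp_block_one, wp_assign, Term.eval_zero]
  refine wp_forLoop nb 2 (fun j s₁ => ∃ y, s₁ = (s.setReg .x y).setReg .i j ∧
    ((y = 0 ∧ ∀ j' < j, ¬ p j') ∨ ∃ j' < nb, y = j' + 1 ∧ p j')) ?_ ?_ ?_ ?_ ?_
  · exact ⟨0, rfl, by simp⟩
  · rintro j s₁ ⟨y, rfl, -⟩; exact hb _ _
  · rintro j s₁ ⟨y, rfl, -⟩; simp
  · rintro j hj s₁ ⟨y, rfl, h⟩ -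
    refine wp_ite (fun h1 => ?_) (fun h1 => ?_)
    · rw [hc j hj y] at h1
      simp only [wp_assign]
      refine ⟨le_rfl, by simp, j + 1, ?_, .inr ⟨j, hj, rfl, h1⟩⟩
      simp [Conf.setReg_comm _ .i .x, Conf.setReg_setReg]
    · have h2 : ¬ p j := by rw [← hc j hj y]; simpa using h1
      simp only [wp_skip]
      refine ⟨le_rfl, by simp, y, by simp [Conf.setReg_setReg], ?_⟩
      rcases h with ⟨h, h'⟩ | h
      · refine .inl ⟨h, fun j' hjj => ?_⟩
        rcases Nat.lt_succ_iff_lt_or_eq.mp hjj with h3 | rfl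
        · exact h' j' h3
        · exact h2
      · exact .inr h
  · rintro s₁ t ⟨y, rfl, h⟩ ht
    exact hQ _ (by omega) y h

/-- `cnt := 0; for i < bound: if c then cnt := cnt + 1`. -/
def count (bound c : Term) : Code :=
  block [.assign .cnt 0, forLoop bound (.ite c (.assign .cnt (Reg.cnt + 1)) .skip)]

theorem wp_count {bound c : Term} (nb : ℕ) (p : ℕ → Prop) [DecidablePred p]
    (hb : ∀ y j, bound.eval ((s.setReg .cnt y).setReg .i j) = nb)
    (hc : ∀ j < nb, ∀ y, c.eval ((s.setReg .cnt y).setReg .i j) ≠ 0 ↔ p j)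
    (hQ : ∀ t ≤ 4 * nb + 3, Q t
      ((s.setReg .cnt ((List.range nb).filter (fun j => p j)).length).setReg .i nb)) :
    WP P (count bound c) s Q := by
  simp only [count, wp_block_cons, wp_block_one, wp_assign, Term.eval_zero]
  refine wp_forLoop nb 2 (fun j s₁ => s₁ =
    (s.setReg .cnt ((List.range j).filter (fun j => p j)).length).setReg .i j) ?_ ?_ ?_ ?_ ?_
  · simp
  · rintro j s₁ rfl; exact hb _ _
  · rintro j s₁ rfl; simp
  · rintro j hj s₁ rfl -
    refine wp_ite (fun h1 => ?_) (fun h1 => ?_)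
    · rw [hc j hj] at h1
      simp [List.range_succ, List.filter_append, h1, Conf.setReg_comm _ .i .cnt,
        Conf.setReg_setReg]
    · have h2 : ¬ p j := by rw [← hc j hj]; simpa using h1
      simp [List.range_succ, List.filter_append, h2, Conf.setReg_setReg]
  · rintro s₁ t rfl ht
    exact hQ _ (by omega)

/-- `for i < bound: if c then emit e and f`. -/
def emitPairs (bound c e f : Term) : Code :=
  forLoop bound (.ite c (.seq (.emit e) (.emit f)) .skip)

theorem wp_emitPairs {bound c e f : Term} (nb : ℕ) (p : ℕ → Prop) [DecidablePred p] (E F : ℕ → ℕ)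
    (hb : ∀ j l, bound.eval ((s.write l).setReg .i j) = nb)
    (hc : ∀ j < nb, ∀ l, c.eval ((s.write l).setReg .i j) ≠ 0 ↔ p j)
    (he : ∀ j < nb, ∀ l, e.eval ((s.write l).setReg .i j) = E j)
    (hf : ∀ j < nb, ∀ l, f.eval ((s.write l).setReg .i j) = F j)
    (hQ : ∀ t ≤ 5 * nb + 2, Q t ((s.write (((List.range nb).filter (fun j => p j)).flatMap
      fun j => [E j, F j])).setReg .i nb)) :
    WP P (emitPairs bound c e f) s Q := by
  refine wp_forLoop nb 3 (fun j s₁ => s₁ = (s.write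
    (((List.range j).filter (fun j => p j)).flatMap fun j => [E j, F j])).setReg .i j)
    ?_ ?_ ?_ ?_ ?_
  · simp [Conf.write_nil]
  · rintro j s₁ rfl; exact hb _ _
  · rintro j s₁ rfl; simp
  · rintro j hj s₁ rfl -
    refine wp_ite (fun h1 => ?_) (fun h1 => ?_)
    · rw [hc j hj] at h1
      simp only [wp_seq, wp_emit, he j hj, Conf.write_setReg, Conf.write_write, hf j hj]
      simp [List.range_succ, List.filter_append, h1, Conf.setReg_setReg]
    · have h2 : ¬ p j := by rw [← hc j hj]; simpa using h1
      simp [List.range_succ, List.filter_append, h2, Conf.setReg_setReg]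
  · rintro s₁ t rfl ht
    exact hQ _ (by omega)

end WP

/-! ### Backward search in a residual network -/

/-- `NXT` chains the usable arcs (those with `C e ≠ 0`) that have the same residual head `RH e`, in
decreasing order; `0` ends a chain and `e + 1` stands for the arc `e`. -/
structure Chained (m : ℕ) (C RH NXT : ℕ → ℕ) : Prop where
  le : ∀ e < m, C e ≠ 0 → NXT e ≤ e
  good : ∀ e < m, C e ≠ 0 → NXT e ≠ 0 → C (NXT e - 1) ≠ 0 ∧ RH (NXT e - 1) = RH e
  max : ∀ e < m, C e ≠ 0 → ∀ e' < e, C e' ≠ 0 → RH e' = RH e → e' < NXT e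

/-- `CUR v` starts a chain of arcs with residual head `v`. -/
structure Heads (N m : ℕ) (C RH CUR : ℕ → ℕ) : Prop where
  le : ∀ v < N, CUR v ≤ m
  good : ∀ v < N, CUR v ≠ 0 → C (CUR v - 1) ≠ 0 ∧ RH (CUR v - 1) = v

/-- Computes the residual tails and heads of the arcs, and chains the usable arcs by their heads. -/
def buildResidual : Code := block [
  fill .RT Reg.m (.get .FL Reg.i) (.get .H0 Reg.i) (.get .TT Reg.i),
  fill .RH Reg.m (.get .FL Reg.i) (.get .TT Reg.i) (.get .H0 Reg.i),
  fill .CUR (Reg.n + 1) 1 0 0,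
  forLoop Reg.m (.ite (.get .C Reg.i)
    (.seq (.set .NXT Reg.i (.get .CUR (.get .RH Reg.i)))
      (.set .CUR (.get .RH Reg.i) (Reg.i + 1))) .skip)]

/-- The tail of the arc `e` in the residual network. -/
def Conf.rt (s : Conf) (e : ℕ) : ℕ := if s.mem .FL e ≠ 0 then s.mem .H0 e else s.mem .TT e

/-- The head of the arc `e` in the residual network. -/
def Conf.rh (s : Conf) (e : ℕ) : ℕ := if s.mem .FL e ≠ 0 then s.mem .TT e else s.mem .H0 e

theorem wp_buildResidual {P : List Code} {s : Conf} {Q : ℕ → Conf → Prop} {N m : ℕ}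
    (hN : s.reg .n + 1 = N) (hm : s.reg .m = m)
    (hT : ∀ e < m, s.mem .TT e < N) (hH : ∀ e < m, s.mem .H0 e < N)
    (hQ : ∀ t s', Frame buildResidual s s' → t ≤ 13 * m + 4 * N + 8 →
      (∀ e < m, s'.mem .RT e = s.rt e) → (∀ e < m, s'.mem .RH e = s.rh e) →
      Chained m (s.mem .C) s.rh (s'.mem .NXT) → Heads N m (s.mem .C) s.rh (s'.mem .CUR) →
      (∀ e < m, s.mem .C e ≠ 0 → e < s'.mem .CUR (s.rh e)) → Q t s') :
    WP P buildResidual s Q := by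
  have hrh : ∀ e < m, s.rh e < N := by
    intro e he; unfold Conf.rh; split
    · exact hT e he
    · exact hH e he
  suffices h : WP P buildResidual s fun t s' => t ≤ 13 * m + 4 * N + 8 ∧
      (∀ e < m, s'.mem .RT e = s.rt e) ∧ (∀ e < m, s'.mem .RH e = s.rh e) ∧
      Chained m (s.mem .C) s.rh (s'.mem .NXT) ∧ Heads N m (s.mem .C) s.rh (s'.mem .CUR) ∧
      (∀ e < m, s.mem .C e ≠ 0 → e < s'.mem .CUR (s.rh e)) by
    refine h.frame.mono ?_
    rintro t s' ⟨hf, h1, h2, h3, h4, h5, h6⟩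
    exact hQ t s' hf h1 h2 h3 h4 h5 h6
  simp only [buildResidual, wp_block_cons, wp_block_one]
  refine wp_fill m s.rt (by simp [hm]) (by simp [Conf.rt]) fun t1 ht1 => ?_
  refine wp_fill m s.rh (by simp [hm]) (by simp [Conf.rh]) fun t2 ht2 => ?_
  refine wp_fill N (fun _ => 0) (by simp [hN]) (by simp) fun t3 ht3 => ?_
  refine wp_forLoop m 3 (fun j s₁ => s₁.reg .i = j ∧ s₁.reg .m = m ∧ s₁.mem .C = s.mem .C ∧
    (∀ e < m, s₁.mem .RT e = s.rt e) ∧ (∀ e < m, s₁.mem .RH e = s.rh e) ∧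
    Chained j (s.mem .C) s.rh (s₁.mem .NXT) ∧ Heads N j (s.mem .C) s.rh (s₁.mem .CUR) ∧
    (∀ e < j, s.mem .C e ≠ 0 → e < s₁.mem .CUR (s.rh e))) ?_ ?_ ?_ ?_ ?_
  · simp only [Conf.reg_setReg, Conf.reg_setMem, Conf.mem_setReg, Conf.mem_setMem]
    refine ⟨rfl, by simp [hm], by simp, ?_, ?_, ⟨by simp, by simp, by simp⟩, ⟨?_, ?_⟩, by simp⟩
    · intro e he; simp [he]
    · intro e he; simp [he]
    · intro v hv; simp [hv]
    · intro v hv; simp [hv]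
  · rintro j s₁ ⟨-, h, -⟩; simp [h]
  · rintro j s₁ ⟨h, -⟩; exact h
  · rintro j hj s₁ ⟨h1, h2, h3, h4, h5, h6, h7, h8⟩ -
    have hv := hrh j hj
    refine wp_ite (fun hc => ?_) (fun hc => ?_)
    · simp only [Term.eval_get, Term.eval_reg, h1, h3] at hc
      simp only [wp_seq, wp_set, Term.eval_get, Term.eval_reg, h1, Conf.mem_setMem, Conf.reg_setMem,
        Conf.reg_setReg, Conf.mem_setReg, h5 j hj, Term.eval_add, Term.eval_one, reduceCtorEq,
        if_false, if_true, h2, h3]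
      refine ⟨by omega, trivial, trivial, trivial, trivial, h4, h5, ⟨?_, ?_, ?_⟩, ⟨?_, ?_⟩, ?_⟩
      · intro e he hce
        rcases Nat.lt_succ_iff_lt_or_eq.mp he with he | rfl
        · rw [update_of_ne (by omega)]; exact h6.le e he hce
        · rw [update_self]; exact h7.le _ hv
      · intro e he hce
        rcases Nat.lt_succ_iff_lt_or_eq.mp he with he | rfl
        · rw [update_of_ne (by omega)]; exact h6.good e he hce
        · rw [update_self]; exact h7.good _ hv
      · intro e he hce e' he' hce' hh
        rcases Nat.lt_succ_iff_lt_or_eq.mp he with he | rfl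
        · rw [update_of_ne (by omega)]; exact h6.max e he hce e' he' hce' hh
        · rw [update_self, ← hh]; exact h8 e' he' hce'
      · intro v hv'
        by_cases hvj : v = s.rh j
        · subst hvj; simp
        · rw [update_of_ne hvj]; have := h7.le v hv'; omega
      · intro v hv'
        by_cases hvj : v = s.rh j
        · subst hvj; simpa using hc
        · rw [update_of_ne hvj]; exact h7.good v hv'
      · intro e he hce
        by_cases hvj : s.rh e = s.rh j
        · rw [hvj, update_self]; exact he
        · rw [update_of_ne hvj]
          rcases Nat.lt_succ_iff_lt_or_eq.mp he with he | rfl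
          · exact h8 e he hce
          · exact absurd rfl hvj
    · simp only [Term.eval_get, Term.eval_reg, h1, h3] at hc
      simp only [wp_skip, Conf.reg_setReg, Conf.mem_setReg, if_true, reduceCtorEq, if_false, h2, h3]
      have aux : ∀ e < j + 1, s.mem .C e ≠ 0 → e < j := by
        intro e he hce
        rcases Nat.lt_succ_iff_lt_or_eq.mp he with he | rfl
        · exact he
        · exact absurd hc hce
      refine ⟨by omega, h1, trivial, trivial, trivial, h4, h5, ⟨?_, ?_, ?_⟩, ⟨?_, ?_⟩, ?_⟩
      · intro e he hce; exact h6.le e (aux e he hce) hce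
      · intro e he hce; exact h6.good e (aux e he hce) hce
      · intro e he hce; exact h6.max e (aux e he hce) hce
      · intro v hv'; exact (h7.le v hv').trans (Nat.le_succ j)
      · exact h7.good
      · intro e he hce; exact h8 e (aux e he hce) hce
  · rintro s₁ t ⟨-, -, -, h4, h5, h6, h7, h8⟩ ht
    exact ⟨by omega, h4, h5, h6, h7, h8⟩

/-- The invariant of the search. `STK` holds, below `tp`, the vertices that may still have
unprocessed arcs, and `CUR v` starts the chain of the unprocessed arcs with residual head `v`.
`VIS` numbers the visited vertices, so that along the arcs `PAR` these numbers decrease until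
a target (`Y v ≠ 0`) is reached. -/
structure SearchInv (N m : ℕ) (C rt rh Y CUR VIS PAR STK : ℕ → ℕ) (tp cnt : ℕ) : Prop where
  heads : Heads N m C rh CUR
  proc : ∀ e < m, C e ≠ 0 → CUR (rh e) ≤ e → VIS (rh e) ≠ 0 ∧ VIS (rt e) ≠ 0
  stk : ∀ v < N, VIS v ≠ 0 → CUR v ≠ 0 → ∃ j < tp, STK j = v
  stk_lt : ∀ j < tp, STK j < N
  target : ∀ v < N, Y v ≠ 0 → VIS v ≠ 0
  par : ∀ u < N, VIS u ≠ 0 → Y u ≠ 0 ∨ (PAR u < m ∧ C (PAR u) ≠ 0 ∧ rt (PAR u) = u ∧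
    VIS (rh (PAR u)) ≠ 0 ∧ VIS (rh (PAR u)) < VIS u)
  vis_le : ∀ v < N, VIS v ≤ cnt
  cnt_pos : 1 ≤ cnt
  cnt_le : cnt + ((Finset.range N).filter fun v => VIS v = 0).card ≤ N + 1

/-- The number of unprocessed arcs. -/
def unprocessed (m : ℕ) (C rh CUR : ℕ → ℕ) : ℕ :=
  ((Finset.range m).filter fun e => C e ≠ 0 ∧ e < CUR (rh e)).card

namespace SearchInv

variable {N m : ℕ} {C rt rh Y CUR VIS PAR STK NXT : ℕ → ℕ} {tp cnt : ℕ}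

/-- The vertex on top of the stack is dropped. -/
theorem pop (h : SearchInv N m C rt rh Y CUR VIS PAR STK tp cnt)
    (hv : VIS (STK (tp - 1)) = 0 ∨ CUR (STK (tp - 1)) = 0) :
    SearchInv N m C rt rh Y CUR VIS PAR STK (tp - 1) cnt := by
  refine ⟨h.heads, h.proc, ?_, fun j hj => h.stk_lt j (by omega), h.target, h.par, h.vis_le,
    h.cnt_pos, h.cnt_le⟩
  intro v hv1 hv2 hv3
  obtain ⟨j, hj, rfl⟩ := h.stk v hv1 hv2 hv3
  by_cases hjj : j = tp - 1
  · subst hjj; rcases hv with hv | hv <;> contradiction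
  · exact ⟨j, by omega, rfl⟩

/-- The next arc into a visited vertex `v` is taken, and its tail is already visited. -/
theorem advance (h : SearchInv N m C rt rh Y CUR VIS PAR STK tp cnt) (hn : Chained m C rh NXT)
    {v : ℕ} (hvN : v < N) (hv : VIS v ≠ 0) (hc : CUR v ≠ 0) (hu : VIS (rt (CUR v - 1)) ≠ 0) :
    SearchInv N m C rt rh Y (update CUR v (NXT (CUR v - 1))) VIS PAR STK tp cnt := by
  have h1 := h.heads.le v hvN
  obtain ⟨h2, h3⟩ := h.heads.good v hvN hc
  have h4 : CUR v - 1 < m := by omega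
  refine ⟨⟨?_, ?_⟩, ?_, ?_, h.stk_lt, h.target, h.par, h.vis_le, h.cnt_pos, h.cnt_le⟩
  · intro w hw
    by_cases hwv : w = v
    · subst hwv; rw [update_self]; have := hn.le _ h4 h2; omega
    · rw [update_of_ne hwv]; exact h.heads.le w hw
  · intro w hw
    by_cases hwv : w = v
    · subst hwv; rw [update_self]; intro h5; have := hn.good _ h4 h2 h5
      rwa [h3] at this
    · rw [update_of_ne hwv]; exact h.heads.good w hw
  · intro e he hce hle
    by_cases hwv : rh e = v
    · rw [hwv, update_self] at hle
      refine ⟨by rwa [hwv], ?_⟩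
      rcases lt_trichotomy e (CUR v - 1) with hlt | rfl | hgt
      · have := hn.max _ h4 h2 e hlt hce (by rw [hwv, h3]); omega
      · exact hu
      · exact (h.proc e he hce (by rw [hwv]; omega)).2
    · rw [update_of_ne hwv] at hle; exact h.proc e he hce hle
  · intro w hw hw1 hw2
    refine h.stk w hw hw1 ?_
    by_cases hwv : w = v
    · subst hwv; exact hc
    · rwa [update_of_ne hwv] at hw2

theorem unprocessed_lt (h : SearchInv N m C rt rh Y CUR VIS PAR STK tp cnt)
    (hn : Chained m C rh NXT) {v : ℕ} (hvN : v < N) (hc : CUR v ≠ 0) :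
    unprocessed m C rh (update CUR v (NXT (CUR v - 1))) < unprocessed m C rh CUR := by
  have h1 := h.heads.le v hvN
  obtain ⟨h2, h3⟩ := h.heads.good v hvN hc
  have h4 : CUR v - 1 < m := by omega
  have h5 := hn.le _ h4 h2
  apply Finset.card_lt_card
  rw [Finset.ssubset_iff_of_subset]
  · refine ⟨CUR v - 1, ?_, ?_⟩
    · simp only [Finset.mem_filter, Finset.mem_range, h3]; exact ⟨h4, h2, by omega⟩
    · simp only [Finset.mem_filter, Finset.mem_range, h3, update_self]; omega
  · intro e
    simp only [Finset.mem_filter, Finset.mem_range]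
    rintro ⟨he, hce, hlt⟩
    refine ⟨he, hce, ?_⟩
    by_cases hwv : rh e = v
    · rw [hwv, update_self] at hlt; rw [hwv]; omega
    · rwa [update_of_ne hwv] at hlt

theorem unvisited_lt {u : ℕ} (huN : u < N) (hu : VIS u = 0) {c : ℕ} (hc : c ≠ 0) :
    ((Finset.range N).filter fun v => update VIS u c v = 0).card <
      ((Finset.range N).filter fun v => VIS v = 0).card := by
  apply Finset.card_lt_card
  rw [Finset.ssubset_iff_of_subset]
  · exact ⟨u, by simp [huN, hu], by simp [hc]⟩
  · intro v
    simp only [Finset.mem_filter, Finset.mem_range]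
    rintro ⟨h1, h2⟩
    refine ⟨h1, ?_⟩
    by_cases hvu : v = u
    · rwa [hvu]
    · rwa [update_of_ne hvu] at h2

/-- A new vertex `u = rt e` is visited along the arc `e`. -/
theorem visit (h : SearchInv N m C rt rh Y CUR VIS PAR STK tp cnt) {e : ℕ} (he : e < m)
    (hce : C e ≠ 0) (hrh : rh e < N) (huN : rt e < N) (hv : VIS (rh e) ≠ 0)
    (hu : VIS (rt e) = 0) :
    SearchInv N m C rt rh Y CUR (update VIS (rt e) (cnt + 1)) (update PAR (rt e) e)
      (update STK tp (rt e)) (tp + 1) (cnt + 1) := by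
  have mono : ∀ w, VIS w ≠ 0 → update VIS (rt e) (cnt + 1) w = VIS w := by
    intro w hw
    rw [update_of_ne]; rintro rfl; contradiction
  have mono' : ∀ w, VIS w ≠ 0 → update VIS (rt e) (cnt + 1) w ≠ 0 := by
    intro w hw; rwa [mono w hw]
  refine ⟨h.heads, ?_, ?_, ?_, ?_, ?_, ?_, by omega, ?_⟩
  · intro e' he' hce' hle
    have := h.proc e' he' hce' hle
    exact ⟨mono' _ this.1, mono' _ this.2⟩
  · intro w hw hw1 hw2
    by_cases hwu : w = rt e
    · exact ⟨tp, by omega, by simp [hwu]⟩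
    · rw [update_of_ne hwu] at hw1
      obtain ⟨j, hj, rfl⟩ := h.stk w hw hw1 hw2
      exact ⟨j, by omega, by rw [update_of_ne (by omega)]⟩
  · intro j hj
    by_cases hjt : j = tp
    · subst hjt; simpa using huN
    · rw [update_of_ne hjt]; exact h.stk_lt j (by omega)
  · intro w hw hw1; exact mono' _ (h.target w hw hw1)
  · intro w hw hw1
    by_cases hwu : w = rt e
    · right
      rw [hwu, update_self, update_self, mono _ hv]
      have := h.vis_le _ hrh
      exact ⟨he, hce, rfl, hv, by omega⟩
    · rw [update_of_ne hwu] at hw1 ⊢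
      rcases h.par w hw hw1 with h1 | ⟨h1, h2, h3, h4, h5⟩
      · exact .inl h1
      · right
        rw [update_of_ne hwu, mono _ h4]
        exact ⟨h1, h2, h3, h4, h5⟩
  · intro w hw
    by_cases hwu : w = rt e
    · rw [hwu, update_self]
    · rw [update_of_ne hwu]; have := h.vis_le w hw; omega
  · have := unvisited_lt huN hu (c := cnt + 1) (by omega)
    have := h.cnt_le
    omega

end SearchInv

/-- The main loop of the search. -/
def searchLoop : Code := .loop Reg.tp (block [
  .assign .v (.get .STK (Reg.tp - 1)),
  .assign .e (.get .CUR Reg.v),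
  .ite (.and (.get .VIS Reg.v) Reg.e)
    (block [
      .assign .e (Reg.e - 1),
      .set .CUR Reg.v (.get .NXT Reg.e),
      .assign .u (.get .RT Reg.e),
      .ite (.get .VIS Reg.u) .skip (block [
        .assign .cnt (Reg.cnt + 1),
        .set .VIS Reg.u Reg.cnt,
        .set .PAR Reg.u Reg.e,
        .set .STK Reg.tp Reg.u,
        .assign .tp (Reg.tp + 1)])])
    (.assign .tp (Reg.tp - 1))])

/-- Backward search in the residual network from the vertices marked in `YM`. -/
def search : Code := block [
  buildResidual,
  fill .VIS (Reg.n + 1) (.get .YM Reg.i) 1 0,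
  fill .STK (Reg.n + 1) 1 Reg.i 0,
  .assign .tp (Reg.n + 1),
  .assign .cnt 1,
  searchLoop]

/-- What the search has found: `VIS` marks a set that contains the targets and is closed under
taking residual tails, and following `PAR` leads back from every marked vertex to a target. -/
structure Searched (N m : ℕ) (C rt rh Y VIS PAR : ℕ → ℕ) : Prop where
  target : ∀ v < N, Y v ≠ 0 → VIS v ≠ 0
  closed : ∀ e < m, C e ≠ 0 → VIS (rh e) ≠ 0 → VIS (rt e) ≠ 0
  par : ∀ u < N, VIS u ≠ 0 → Y u ≠ 0 ∨ (PAR u < m ∧ C (PAR u) ≠ 0 ∧ rt (PAR u) = u ∧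
    VIS (rh (PAR u)) ≠ 0 ∧ VIS (rh (PAR u)) < VIS u)
  vis_le : ∀ u < N, VIS u ≤ N + 1

/-- The marked set is the least one. -/
theorem Searched.least {N m : ℕ} {C rt rh Y VIS PAR : ℕ → ℕ}
    (h : Searched N m C rt rh Y VIS PAR) (hrh : ∀ e < m, rh e < N) (Z : ℕ → Prop)
    (hY : ∀ v < N, Y v ≠ 0 → Z v) (hZ : ∀ e < m, C e ≠ 0 → Z (rh e) → Z (rt e)) :
    ∀ v < N, VIS v ≠ 0 → Z v := by
  intro v
  induction hk : VIS v using Nat.strong_induction_on generalizing v with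
  | _ k ih =>
    subst hk
    intro hv h0
    rcases h.par v hv h0 with h1 | ⟨h1, h2, h3, h4, h5⟩
    · exact hY v hv h1
    · have := ih _ h5 (rh (PAR v)) rfl (hrh _ h1) h4
      have := hZ _ h1 h2 this
      rwa [h3] at this

/-- The search takes linear time: every iteration takes an unprocessed arc or drops a vertex from the
stack, and every vertex that enters the stack during the loop is visited for the first time. -/
theorem wp_searchLoop {P : List Code} {s : Conf} {Q : ℕ → Conf → Prop} {N m : ℕ}
    {rt rh Y : ℕ → ℕ}
    (hrt : ∀ e < m, rt e < N) (hrh : ∀ e < m, rh e < N)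
    (hRT : ∀ e < m, s.mem .RT e = rt e)
    (hn : Chained m (s.mem .C) rh (s.mem .NXT))
    (hinv : SearchInv N m (s.mem .C) rt rh Y (s.mem .CUR) (s.mem .VIS) (s.mem .PAR)
      (s.mem .STK) (s.reg .tp) (s.reg .cnt))
    (hQ : ∀ t s', Frame searchLoop s s' → t ≤ 20 * m + 10 * N + 10 * s.reg .tp + 1 →
      Searched N m (s.mem .C) rt rh Y (s'.mem .VIS) (s'.mem .PAR) → Q t s') :
    WP P searchLoop s Q := by
  suffices h : WP P searchLoop s fun t s' => t ≤ 20 * m + 10 * N + 10 * s.reg .tp + 1 ∧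
      Searched N m (s.mem .C) rt rh Y (s'.mem .VIS) (s'.mem .PAR) by
    refine h.frame.mono ?_
    rintro t s' ⟨hf, h1, h2⟩
    exact hQ t s' hf h1 h2
  refine wp_loop (fun T s₁ => SearchInv N m (s.mem .C) rt rh Y (s₁.mem .CUR) (s₁.mem .VIS)
    (s₁.mem .PAR) (s₁.mem .STK) (s₁.reg .tp) (s₁.reg .cnt) ∧
    T = 20 * unprocessed m (s.mem .C) rh (s₁.mem .CUR) +
      10 * ((Finset.range N).filter fun v => s₁.mem .VIS v = 0).card + 10 * s₁.reg .tp)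
    ⟨hinv, rfl⟩ ?_ ?_
  · rintro T s₁ hf ⟨hi, rfl⟩ he
    have hN : s₁.mem .NXT = s.mem .NXT := hf.mem _ rfl
    have hRT' : s₁.mem .RT = s.mem .RT := hf.mem _ rfl
    simp only [Term.eval_reg] at he
    set v := s₁.mem .STK (s₁.reg .tp - 1) with hvdef
    have hvN : v < N := hi.stk_lt _ (by omega)
    simp only [wp_block_cons, wp_block_one, wp_assign, Term.eval_get, Term.eval_sub, Term.eval_reg,
      Term.eval_one, ← hvdef]
    refine wp_ite (fun hc => ?_) (fun hc => ?_)
    · simp only [Term.eval_and, Term.eval_get, Term.eval_reg, Conf.mem_setReg, Conf.reg_setReg,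
        reduceCtorEq, if_false, if_true, ne_eq, ite_eq_right_iff, one_ne_zero, imp_false, not_not]
        at hc
      obtain ⟨hv1, hv2⟩ := hc
      have hme : s₁.mem .CUR v - 1 < m := by have := hi.heads.le v hvN; omega
      obtain ⟨hC, hrv⟩ := hi.heads.good v hvN hv2
      have hlt := hi.unprocessed_lt hn hvN hv2
      simp only [wp_block_cons, wp_block_one, wp_assign, wp_set, Term.eval_get, Term.eval_sub,
        Term.eval_reg, Term.eval_one, Conf.mem_setReg, Conf.reg_setReg, Conf.mem_setMem,
        Conf.reg_setMem, reduceCtorEq, if_false, if_true, hN, hRT', hRT _ hme]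
      refine wp_ite (fun hc => ?_) (fun hc => ?_)
      · simp only [Term.eval_get, Term.eval_reg, Conf.mem_setReg, Conf.reg_setReg, Conf.mem_setMem,
          reduceCtorEq, if_false, if_true] at hc
        simp only [wp_skip, Conf.mem_setReg, Conf.reg_setReg, Conf.mem_setMem,
          Conf.reg_setMem, reduceCtorEq, if_false, if_true]
        refine ⟨_, ⟨hi.advance hn hvN hv1 hv2 hc, rfl⟩, ?_⟩
        omega
      · simp only [Term.eval_get, Term.eval_reg, Conf.mem_setReg, Conf.reg_setReg, Conf.mem_setMem,
          reduceCtorEq, if_false, if_true] at hc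
        simp only [wp_block_cons, wp_block_one, wp_assign, wp_set, Term.eval_add,
          Term.eval_reg, Term.eval_one, Conf.mem_setReg, Conf.reg_setReg, Conf.mem_setMem,
          Conf.reg_setMem, reduceCtorEq, if_false, if_true]
        have h1 := hi.visit hme hC (by rwa [hrv]) (hrt _ hme) (by rwa [hrv]) hc
        have h2 := h1.advance hn (v := v) hvN
          (by rw [update_apply]; split <;> [omega; exact hv1]) hv2 (by simp)
        refine ⟨_, ⟨h2, rfl⟩, ?_⟩
        have := SearchInv.unvisited_lt (VIS := s₁.mem .VIS) (hrt _ hme) hc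
          (c := s₁.reg .cnt + 1) (by omega)
        omega
    · simp only [Term.eval_and, Term.eval_get, Term.eval_reg, Conf.mem_setReg, Conf.reg_setReg,
        reduceCtorEq, if_false, if_true, ne_eq, ite_eq_right_iff, one_ne_zero, imp_false] at hc
      simp only [wp_assign, Term.eval_sub, Term.eval_reg, Term.eval_one, Conf.mem_setReg,
        Conf.reg_setReg, reduceCtorEq, if_false, if_true]
      refine ⟨_, ⟨hi.pop (by rw [← hvdef]; tauto), rfl⟩, ?_⟩
      omega
  · rintro T' s₁ t hf ⟨hi, rfl⟩ he ht
    simp only [Term.eval_reg] at he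
    refine ⟨?_, ⟨hi.target, ?_, hi.par, ?_⟩⟩
    · have h1 : unprocessed m (s.mem .C) rh (s.mem .CUR) ≤ m := by
        exact (Finset.card_filter_le _ _).trans (Finset.card_range m).le
      have h2 : ((Finset.range N).filter fun v => s.mem .VIS v = 0).card ≤ N := by
        simpa using Finset.card_filter_le (Finset.range N) _
      omega
    · intro e he' hce hv
      have : s₁.mem .CUR (rh e) = 0 := by
        by_contra h0
        obtain ⟨j, hj, -⟩ := hi.stk _ (hrh e he') hv h0
        omega
      exact (hi.proc e he' hce (by omega)).2
    · intro u hu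
      have := hi.vis_le u hu
      have := hi.cnt_le
      omega

/-- The vertices from which a target can be reached in the residual network are found in linear time.
All vertices are on the stack initially; those that are not visited are simply dropped. -/
theorem wp_search {P : List Code} {s : Conf} {Q : ℕ → Conf → Prop} {N m : ℕ}
    (hN : s.reg .n + 1 = N) (hm : s.reg .m = m)
    (hT : ∀ e < m, s.mem .TT e < N) (hH : ∀ e < m, s.mem .H0 e < N)
    (hQ : ∀ t s', Frame search s s' → t ≤ 33 * m + 32 * N + 20 →
      (∀ e < m, s'.mem .RH e = s.rh e) →
      Searched N m (s.mem .C) s.rt s.rh (s.mem .YM) (s'.mem .VIS) (s'.mem .PAR) → Q t s') :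
    WP P search s Q := by
  have hrt : ∀ e < m, s.rt e < N := by
    intro e he; unfold Conf.rt; split
    · exact hH e he
    · exact hT e he
  have hrh : ∀ e < m, s.rh e < N := by
    intro e he; unfold Conf.rh; split
    · exact hT e he
    · exact hH e he
  suffices h : WP P search s fun t s' => t ≤ 33 * m + 32 * N + 20 ∧
      (∀ e < m, s'.mem .RH e = s.rh e) ∧
      Searched N m (s.mem .C) s.rt s.rh (s.mem .YM) (s'.mem .VIS) (s'.mem .PAR) by
    refine h.frame.mono ?_
    rintro t s' ⟨hf, h1, h2, h3⟩
    exact hQ t s' hf h1 h2 h3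
  simp only [search, wp_block_cons, wp_block_one]
  refine wp_buildResidual hN hm hT hH fun t1 s1 hf1 ht1 hRT hRH hch hhd hcur => ?_
  have e1 : s1.reg .n = s.reg .n := hf1.reg _ rfl
  have e2 : s1.mem .C = s.mem .C := hf1.mem _ rfl
  have e3 : s1.mem .YM = s.mem .YM := hf1.mem _ rfl
  refine wp_fill N (fun v => if s.mem .YM v ≠ 0 then 1 else 0) (by simp [e1, hN])
    (by simp [e3]) fun t2 ht2 => ?_
  refine wp_fill N (fun v => v) (by simp [e1, hN]) (by simp) fun t3 ht3 => ?_
  simp only [wp_assign, Term.eval_add, Term.eval_reg, Term.eval_one]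
  refine wp_searchLoop (rt := s.rt) (rh := s.rh) (Y := s.mem .YM) (N := N) (m := m) hrt hrh
    ?_ ?_ ?_ ?_
  · simpa using hRT
  · simpa [e2] using hch
  · simp only [Conf.mem_setReg, Conf.mem_setMem, Conf.reg_setReg, Conf.reg_setMem, reduceCtorEq,
      if_false, if_true, e1, hN, e2]
    refine ⟨hhd, ?_, ?_, ?_, ?_, ?_, ?_, le_rfl, ?_⟩
    · intro e he hce hle
      have := hcur e he hce
      omega
    · intro v hv _ _; exact ⟨v, hv, by simp [hv]⟩
    · intro j hj; simp [hj]
    · intro v hv hy; simp [hv, hy]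
    · intro v hv hy; left; simpa [hv] using hy
    · intro v hv; simp only [hv, if_true]; split <;> omega
    · have := Finset.card_filter_le (Finset.range N)
        fun v => (if v < N then if s.mem .YM v ≠ 0 then 1 else 0 else s1.mem .VIS v) = 0
      rw [Finset.card_range] at this
      omega
  · intro t s' hf ht hs
    have e4 : s'.mem .RH = s1.mem .RH := by rw [hf.mem _ rfl]; simp
    simp only [Conf.mem_setReg, Conf.mem_setMem, Conf.reg_setReg, Conf.reg_setMem, reduceCtorEq,
      if_false, if_true, e1, hN, e2] at ht hs
    refine ⟨by omega, ?_, hs⟩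
    rw [e4]; exact hRH

/-! ### Maximum flows and furthest minimum cuts -/

/-- The number of usable arcs that leave the vertex set `A`. -/
noncomputable def capOf (m : ℕ) (C TT H0 : ℕ → ℕ) (A : Set ℕ) : ℕ := by
  classical exact ((Finset.range m).filter fun e => C e ≠ 0 ∧ TT e ∈ A ∧ H0 e ∉ A).card

/-- `A` contains all sources and no target. -/
def Separates (N : ℕ) (X Y : ℕ → ℕ) (A : Set ℕ) : Prop :=
  (∀ v < N, X v ≠ 0 → v ∈ A) ∧ ∀ v < N, Y v ≠ 0 → v ∉ A

/-- The indicator function of a set of vertices, with integer values. -/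
noncomputable def ind (A : Set ℕ) (v : ℕ) : ℤ := by classical exact if v ∈ A then 1 else 0

/-- The net flow of `FL` out of `A`. -/
noncomputable def netOut (m : ℕ) (FL TT H0 : ℕ → ℕ) (A : Set ℕ) : ℤ :=
  ∑ e ∈ Finset.range m, (FL e : ℤ) * (ind A (TT e) - ind A (H0 e))

/-- `FL` is a flow of value `val` with values `0` and `1`. Conservation is expressed by the fact
that the net flow out of each set that separates the sources from the targets is `val`. -/
structure IsFlow (N m : ℕ) (C TT H0 X Y FL : ℕ → ℕ) (val : ℕ) : Prop where
  le_one : ∀ e < m, FL e ≤ 1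
  usable : ∀ e < m, FL e ≠ 0 → C e ≠ 0
  net : ∀ A, Separates N X Y A → netOut m FL TT H0 A = val

/-- The tail of the arc `e` in the residual network of the flow `FL`, where arcs with flow are
reversed. -/
def resTail (FL TT H0 : ℕ → ℕ) (e : ℕ) : ℕ := if FL e ≠ 0 then H0 e else TT e

/-- The head of the arc `e` in the residual network of the flow `FL`. -/
def resHead (FL TT H0 : ℕ → ℕ) (e : ℕ) : ℕ := if FL e ≠ 0 then TT e else H0 e

section Cuts

variable {N m : ℕ} {C TT H0 X Y FL VIS PAR : ℕ → ℕ} {val : ℕ}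

theorem capOf_eq_sum (A : Set ℕ) : (capOf m C TT H0 A : ℤ) =
    ∑ e ∈ Finset.range m, if C e ≠ 0 then ind A (TT e) * (1 - ind A (H0 e)) else 0 := by
  classical
  rw [capOf, Finset.card_filter, Nat.cast_sum]
  refine Finset.sum_congr rfl fun e _ => ?_
  simp only [ind]
  by_cases h1 : C e = 0 <;> by_cases h2 : TT e ∈ A <;> by_cases h3 : H0 e ∈ A <;> simp [h1, h2, h3]

theorem ind_cases (A : Set ℕ) (v : ℕ) : (v ∈ A ∧ ind A v = 1) ∨ (v ∉ A ∧ ind A v = 0) := by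
  classical
  by_cases h : v ∈ A <;> simp [ind, h]

theorem IsFlow.term_le (h : IsFlow N m C TT H0 X Y FL val) (A : Set ℕ) {e : ℕ} (he : e < m) :
    (FL e : ℤ) * (ind A (TT e) - ind A (H0 e)) ≤
      if C e ≠ 0 then ind A (TT e) * (1 - ind A (H0 e)) else 0 := by
  have h1 := h.le_one e he
  have h2 := h.usable e he
  rcases Nat.le_one_iff_eq_zero_or_eq_one.mp h1 with h0 | h0 <;> rw [h0] at h2 ⊢ <;>
  rcases ind_cases A (TT e) with ⟨-, h3⟩ | ⟨-, h3⟩ <;>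
  rcases ind_cases A (H0 e) with ⟨-, h4⟩ | ⟨-, h4⟩ <;>
  rw [h3, h4] <;> by_cases hc : C e = 0 <;> simp_all

/-- Weak duality of flows and cuts. -/
theorem IsFlow.le_capOf (h : IsFlow N m C TT H0 X Y FL val) {A : Set ℕ} (hA : Separates N X Y A) :
    val ≤ capOf m C TT H0 A := by
  have : (val : ℤ) ≤ capOf m C TT H0 A := by
    rw [← h.net A hA, capOf_eq_sum]
    exact Finset.sum_le_sum fun e he => h.term_le A (Finset.mem_range.mp he)
  exact_mod_cast this

/-- The set of the vertices not found by the search (and of all numbers that are not vertices). -/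
def unvisited (N : ℕ) (VIS : ℕ → ℕ) : Set ℕ := {v | v < N → VIS v = 0}

/-- If no source is found by the search, then the vertices not found form a cut whose size is the
value of the flow: every usable arc leaving this set carries flow, and no arc entering it does. -/
theorem IsFlow.capOf_unvisited (h : IsFlow N m C TT H0 X Y FL val)
    (hs : Searched N m C (resTail FL TT H0) (resHead FL TT H0) Y VIS PAR)
    (hT : ∀ e < m, TT e < N) (hH : ∀ e < m, H0 e < N)
    (hX : ∀ v < N, X v ≠ 0 → VIS v = 0) :
    Separates N X Y (unvisited N VIS) ∧ capOf m C TT H0 (unvisited N VIS) = val := by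
  have hsep : Separates N X Y (unvisited N VIS) :=
    ⟨fun v hv hx _ => hX v hv hx, fun v hv hy hh => hs.target v hv hy (hh hv)⟩
  refine ⟨hsep, ?_⟩
  have : (capOf m C TT H0 (unvisited N VIS) : ℤ) = val := by
    rw [← h.net _ hsep, capOf_eq_sum]
    refine Finset.sum_congr rfl fun e he => ?_
    have he := Finset.mem_range.mp he
    have h1 := h.le_one e he
    have h2 := h.usable e he
    have h3 := hs.closed e he
    have h4 := hT e he
    have h5 := hH e he
    simp only [resHead, resTail] at h3
    rcases Nat.le_one_iff_eq_zero_or_eq_one.mp h1 with h0 | h0 <;> rw [h0] at h2 h3 ⊢ <;>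
    rcases ind_cases (unvisited N VIS) (TT e) with ⟨h6, h7⟩ | ⟨h6, h7⟩ <;>
    rcases ind_cases (unvisited N VIS) (H0 e) with ⟨h8, h9⟩ | ⟨h8, h9⟩ <;>
    rw [h7, h9] <;> by_cases hc : C e = 0 <;> simp_all [unvisited]
  exact_mod_cast this

/-- The vertices not found by the search form the largest minimum cut. -/
theorem IsFlow.subset_unvisited (h : IsFlow N m C TT H0 X Y FL val)
    (hs : Searched N m C (resTail FL TT H0) (resHead FL TT H0) Y VIS PAR)
    (hT : ∀ e < m, TT e < N) (hH : ∀ e < m, H0 e < N)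
    {B : Set ℕ} (hB : Separates N X Y B) (hle : capOf m C TT H0 B ≤ val) :
    B ⊆ unvisited N VIS := by
  have heq : ∀ e ∈ Finset.range m, (FL e : ℤ) * (ind B (TT e) - ind B (H0 e)) =
      if C e ≠ 0 then ind B (TT e) * (1 - ind B (H0 e)) else 0 := by
    rw [← Finset.sum_eq_sum_iff_of_le fun e he => h.term_le B (Finset.mem_range.mp he)]
    rw [← capOf_eq_sum]
    refine le_antisymm ?_ ?_
    · have := h.le_capOf hB
      have h1 := h.net B hB
      rw [netOut] at h1
      rw [h1]; exact_mod_cast this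
    · have h1 := h.net B hB
      rw [netOut] at h1
      rw [h1]; exact_mod_cast hle
  intro v hv hvN
  by_contra h0
  refine hs.least ?_ (fun v => v ∉ B) hB.2 ?_ v hvN h0 hv
  · intro e he; unfold resHead; split
    · exact hT e he
    · exact hH e he
  · intro e he hce
    have h1 := heq e (Finset.mem_range.mpr he)
    have h2 := h.le_one e he
    rw [if_pos hce] at h1
    simp only [resHead, resTail]
    rcases Nat.le_one_iff_eq_zero_or_eq_one.mp h2 with h0 | h0 <;> rw [h0] at h1 ⊢ <;>
    rcases ind_cases B (TT e) with ⟨h6, h7⟩ | ⟨h6, h7⟩ <;>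
    rcases ind_cases B (H0 e) with ⟨h8, h9⟩ | ⟨h8, h9⟩ <;>
    rw [h7, h9] at h1 <;> simp_all

/-- Changing the flow on one arc moves one unit from its residual tail to its residual head. -/
theorem netOut_update (A : Set ℕ) {e : ℕ} (he : e < m) (h1 : FL e ≤ 1) :
    netOut m (update FL e (1 - FL e)) TT H0 A =
      netOut m FL TT H0 A + ind A (resTail FL TT H0 e) - ind A (resHead FL TT H0 e) := by
  have he := Finset.mem_range.mpr he
  rw [netOut, netOut, ← Finset.add_sum_erase _ _ he, ← Finset.add_sum_erase _ _ he]
  have : ∑ x ∈ (Finset.range m).erase e,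
      (update FL e (1 - FL e) x : ℤ) * (ind A (TT x) - ind A (H0 x)) =
      ∑ x ∈ (Finset.range m).erase e, (FL x : ℤ) * (ind A (TT x) - ind A (H0 x)) := by
    refine Finset.sum_congr rfl fun x hx => ?_
    rw [update_of_ne (Finset.ne_of_mem_erase hx)]
  rw [this, update_self]
  rcases Nat.le_one_iff_eq_zero_or_eq_one.mp h1 with h0 | h0 <;> simp [h0, resTail, resHead] <;>
  ring

end Cuts

/-- Changes the flow along the path from the vertex `x - 1` to a target that the search found. -/
def augment : Code := block [
  .assign .v (Reg.x - 1),
  .loop (.not (.get .YM Reg.v)) (block [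
    .assign .e (.get .PAR Reg.v),
    .assign .v (.get .RH Reg.e),
    .set .FL Reg.e (1 - .get .FL Reg.e)])]

/-- The search numbers decrease along the path, so no arc of the path is changed twice and the loop
ends. While the path is followed, the net flow out of a set `A` has changed by `1` if the path has
left `A`, which gives conservation of the augmented flow. -/
theorem wp_augment {P : List Code} {s : Conf} {Q : ℕ → Conf → Prop} {N m val : ℕ}
    (hT : ∀ e < m, s.mem .TT e < N) (hH : ∀ e < m, s.mem .H0 e < N)
    (hRH : ∀ e < m, s.mem .RH e = resHead (s.mem .FL) (s.mem .TT) (s.mem .H0) e)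
    (hs : Searched N m (s.mem .C) (resTail (s.mem .FL) (s.mem .TT) (s.mem .H0))
      (resHead (s.mem .FL) (s.mem .TT) (s.mem .H0)) (s.mem .YM) (s.mem .VIS) (s.mem .PAR))
    (hfl : IsFlow N m (s.mem .C) (s.mem .TT) (s.mem .H0) (s.mem .XM) (s.mem .YM) (s.mem .FL) val)
    (hx : s.reg .x - 1 < N) (hX : s.mem .XM (s.reg .x - 1) ≠ 0)
    (hV : s.mem .VIS (s.reg .x - 1) ≠ 0)
    (hQ : ∀ t s', Frame augment s s' → t ≤ 4 * N + 6 →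
      IsFlow N m (s.mem .C) (s.mem .TT) (s.mem .H0) (s.mem .XM) (s.mem .YM) (s'.mem .FL) (val + 1) →
      Q t s') :
    WP P augment s Q := by
  suffices h : WP P augment s fun t s' => t ≤ 4 * N + 6 ∧
      IsFlow N m (s.mem .C) (s.mem .TT) (s.mem .H0) (s.mem .XM) (s.mem .YM) (s'.mem .FL)
        (val + 1) by
    refine h.frame.mono ?_
    rintro t s' ⟨hf, h1, h2⟩
    exact hQ t s' hf h1 h2
  have hrh : ∀ e < m, resHead (s.mem .FL) (s.mem .TT) (s.mem .H0) e < N := by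
    intro e he; unfold resHead; split
    · exact hT e he
    · exact hH e he
  set f₀ := s.mem .FL with hf₀
  set rt := resTail f₀ (s.mem .TT) (s.mem .H0) with hrtdef
  set rh := resHead f₀ (s.mem .TT) (s.mem .H0) with hrhdef
  set x₀ := s.reg .x - 1 with hx₀
  simp only [augment, wp_block_cons, wp_block_one, wp_assign, Term.eval_sub, Term.eval_reg,
    Term.eval_one, ← hx₀]
  -- The remaining time is proportional to the search number of the current vertex, and the arcs that
  -- lie ahead on the path still carry the original flow.
  refine wp_loop (T := 4 * s.mem .VIS x₀) (fun T s₁ => s₁.reg .v < N ∧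
    s.mem .VIS (s₁.reg .v) ≠ 0 ∧
    (∀ e < m, s₁.mem .FL e ≤ 1) ∧ (∀ e < m, s₁.mem .FL e ≠ 0 → s.mem .C e ≠ 0) ∧
    (∀ A, netOut m (s₁.mem .FL) (s.mem .TT) (s.mem .H0) A + ind A (s₁.reg .v) =
      netOut m f₀ (s.mem .TT) (s.mem .H0) A + ind A x₀) ∧
    (∀ u < N, s.mem .VIS u ≠ 0 → s.mem .VIS u ≤ s.mem .VIS (s₁.reg .v) → s.mem .YM u = 0 →
      s₁.mem .FL (s.mem .PAR u) = f₀ (s.mem .PAR u)) ∧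
    T = 4 * s.mem .VIS (s₁.reg .v)) ?_ ?_ ?_
  · simp only [Conf.reg_setReg, if_true, Conf.mem_setReg]
    exact ⟨hx, hV, hfl.le_one, hfl.usable, fun A => rfl, fun _ _ _ _ _ => rfl, trivial⟩
  · rintro T s₁ hf ⟨h1, h2, h3, h4, h5, h6, rfl⟩ he
    have eY : s₁.mem .YM = s.mem .YM := hf.mem _ rfl
    have eP : s₁.mem .PAR = s.mem .PAR := hf.mem _ rfl
    have eR : s₁.mem .RH = s.mem .RH := hf.mem _ rfl
    have hy : s.mem .YM (s₁.reg .v) = 0 := by simpa [eY] using he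
    obtain ⟨p1, p2, p3, p4, p5⟩ := (hs.par _ h1 h2).resolve_left (by simpa using hy)
    simp only [wp_block_cons, wp_block_one, wp_assign, wp_set, Term.eval_get, Term.eval_reg,
      Conf.reg_setReg, Conf.mem_setReg, Conf.mem_setMem, Conf.reg_setMem, reduceCtorEq, if_true,
      if_false, eP, eR, Term.eval_sub, Term.eval_one]
    set v := s₁.reg .v with hv
    set e := s.mem .PAR v with hedef
    rw [hRH e p1]
    have hfe : s₁.mem .FL e = f₀ e := h6 v h1 h2 le_rfl hy
    refine ⟨_, ⟨hrh e p1, p4, ?_, ?_, ?_, ?_, rfl⟩, by omega⟩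
    · intro e' he'
      rw [update_apply]; split
      · omega
      · exact h3 e' he'
    · intro e' he'
      rw [update_apply]; split
      · rename_i hh; subst hh; exact fun _ => p2
      · exact h4 e' he'
    · intro A
      rw [netOut_update A p1 (h3 e p1), ← h5 A]
      have e1 : resTail (s₁.mem .FL) (s.mem .TT) (s.mem .H0) e = v := by
        rw [← p3, hrtdef]; simp only [resTail, hfe]
      have e2 : resHead (s₁.mem .FL) (s.mem .TT) (s.mem .H0) e = rh e := by
        rw [hrhdef]; simp only [resHead, hfe]
      rw [e1, e2]; ring
    · intro u hu hu1 hu2 hu3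
      have hne : s.mem .PAR u ≠ e := by
        intro hh
        obtain ⟨-, -, q3, -, -⟩ := (hs.par u hu hu1).resolve_left (by simpa using hu3)
        rw [hh, p3] at q3
        rw [← q3] at hu2; omega
      rw [update_of_ne hne]
      exact h6 u hu hu1 (by omega) hu3
  · rintro T' s₁ t hf ⟨h1, h2, h3, h4, h5, h6, rfl⟩ he ht
    have eY : s₁.mem .YM = s.mem .YM := hf.mem _ rfl
    have hy : s.mem .YM (s₁.reg .v) ≠ 0 := by simpa [eY] using he
    have := hs.vis_le x₀ hx
    refine ⟨by omega, h3, h4, fun A hA => ?_⟩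
    have h7 := h5 A
    have h8 : ind A x₀ = 1 := by
      rcases ind_cases A x₀ with ⟨-, h⟩ | ⟨h, -⟩
      · exact h
      · exact absurd (hA.1 _ hx hX) h
    have h9 : ind A (s₁.reg .v) = 0 := by
      rcases ind_cases A (s₁.reg .v) with ⟨h, -⟩ | ⟨-, h⟩
      · exact absurd h (hA.2 _ h1 hy)
      · exact h
    rw [h8, h9, hfl.net A hA] at h7
    push_cast; omega

/-- One search, followed by `x := v + 1` for some visited source `v` if there is one, and `x := 0`
otherwise. -/
def searchSource : Code := block [search, find (Reg.n + 1) (.and (.get .XM Reg.i) (.get .VIS Reg.i))]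

/-- Computes a maximum flow from the sources marked in `XM` to the targets marked in `YM`, but stops
with `x ≠ 0` as soon as the value exceeds `cap`. -/
def maxFlow : Code := block [
  fill .FL Reg.m 1 0 0,
  .assign .val 0,
  searchSource,
  .loop (.and Reg.x ((Reg.cap : Term) + 1 - Reg.val)) (block [
    augment,
    .assign .val (Reg.val + 1),
    searchSource])]

theorem wp_searchSource {P : List Code} {s : Conf} {Q : ℕ → Conf → Prop} {N m : ℕ}
    (hN : s.reg .n + 1 = N) (hm : s.reg .m = m)
    (hT : ∀ e < m, s.mem .TT e < N) (hH : ∀ e < m, s.mem .H0 e < N)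
    (hQ : ∀ t s', Frame searchSource s s' → t ≤ 33 * m + 36 * N + 23 →
      (∀ e < m, s'.mem .RH e = resHead (s.mem .FL) (s.mem .TT) (s.mem .H0) e) →
      Searched N m (s.mem .C) (resTail (s.mem .FL) (s.mem .TT) (s.mem .H0))
        (resHead (s.mem .FL) (s.mem .TT) (s.mem .H0)) (s.mem .YM) (s'.mem .VIS) (s'.mem .PAR) →
      ((s'.reg .x = 0 ∧ ∀ v < N, s.mem .XM v ≠ 0 → s'.mem .VIS v = 0) ∨
        (s'.reg .x ≠ 0 ∧ s'.reg .x - 1 < N ∧ s.mem .XM (s'.reg .x - 1) ≠ 0 ∧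
          s'.mem .VIS (s'.reg .x - 1) ≠ 0)) → Q t s') :
    WP P searchSource s Q := by
  suffices h : WP P searchSource s fun t s' => t ≤ 33 * m + 36 * N + 23 ∧
      (∀ e < m, s'.mem .RH e = resHead (s.mem .FL) (s.mem .TT) (s.mem .H0) e) ∧
      Searched N m (s.mem .C) (resTail (s.mem .FL) (s.mem .TT) (s.mem .H0))
        (resHead (s.mem .FL) (s.mem .TT) (s.mem .H0)) (s.mem .YM) (s'.mem .VIS) (s'.mem .PAR) ∧
      ((s'.reg .x = 0 ∧ ∀ v < N, s.mem .XM v ≠ 0 → s'.mem .VIS v = 0) ∨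
        (s'.reg .x ≠ 0 ∧ s'.reg .x - 1 < N ∧ s.mem .XM (s'.reg .x - 1) ≠ 0 ∧
          s'.mem .VIS (s'.reg .x - 1) ≠ 0)) by
    refine h.frame.mono ?_
    rintro t s' ⟨hf, h1, h2, h3, h4⟩
    exact hQ t s' hf h1 h2 h3 h4
  simp only [searchSource, wp_block_cons, wp_block_one]
  refine wp_search hN hm hT hH fun t s' hf ht h1 h2 => ?_
  have e1 : s'.reg .n = s.reg .n := hf.reg _ rfl
  have e2 : s'.mem .XM = s.mem .XM := hf.mem _ rfl
  refine wp_find N (fun v => s.mem .XM v ≠ 0 ∧ s'.mem .VIS v ≠ 0) (by simp [e1, hN])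
    (by simp [e2]) fun t' ht' y hy => ?_
  refine ⟨by omega, ?_, h2, ?_⟩
  · exact h1
  · simp only [Conf.reg_setReg, Conf.mem_setReg, reduceCtorEq, if_true, if_false]
    rcases hy with ⟨hy, hy'⟩ | ⟨j, hj, rfl, hj1, hj2⟩
    · left; refine ⟨hy, fun v hv hx => ?_⟩
      have := hy' v hv; tauto
    · right; simp [hj, hj1, hj2]

/-- Either a flow of value greater than `cap` is found, or the vertices not found by the last search
form the largest minimum cut. Each of the at most `cap + 1` augmentations takes linear time. -/
theorem wp_maxFlow {P : List Code} {s : Conf} {Q : ℕ → Conf → Prop} {N m : ℕ}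
    (hN : s.reg .n + 1 = N) (hm : s.reg .m = m)
    (hT : ∀ e < m, s.mem .TT e < N) (hH : ∀ e < m, s.mem .H0 e < N)
    (hQ : ∀ t s', Frame maxFlow s s' → t ≤ 80 * (N + m) * (s.reg .cap + 3) →
      (∀ A, Separates N (s.mem .XM) (s.mem .YM) A →
        s'.reg .val ≤ capOf m (s.mem .C) (s.mem .TT) (s.mem .H0) A) →
      ((s'.reg .x ≠ 0 ∧ s.reg .cap < s'.reg .val) ∨ (s'.reg .x = 0 ∧
        Separates N (s.mem .XM) (s.mem .YM) (unvisited N (s'.mem .VIS)) ∧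
        capOf m (s.mem .C) (s.mem .TT) (s.mem .H0) (unvisited N (s'.mem .VIS)) = s'.reg .val ∧
        ∀ B, Separates N (s.mem .XM) (s.mem .YM) B →
          capOf m (s.mem .C) (s.mem .TT) (s.mem .H0) B ≤ s'.reg .val →
          B ⊆ unvisited N (s'.mem .VIS))) → Q t s') :
    WP P maxFlow s Q := by
  suffices h : WP P maxFlow s fun t s' => t ≤ 80 * (N + m) * (s.reg .cap + 3) ∧
      (∀ A, Separates N (s.mem .XM) (s.mem .YM) A →
        s'.reg .val ≤ capOf m (s.mem .C) (s.mem .TT) (s.mem .H0) A) ∧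
      ((s'.reg .x ≠ 0 ∧ s.reg .cap < s'.reg .val) ∨ (s'.reg .x = 0 ∧
        Separates N (s.mem .XM) (s.mem .YM) (unvisited N (s'.mem .VIS)) ∧
        capOf m (s.mem .C) (s.mem .TT) (s.mem .H0) (unvisited N (s'.mem .VIS)) = s'.reg .val ∧
        ∀ B, Separates N (s.mem .XM) (s.mem .YM) B →
          capOf m (s.mem .C) (s.mem .TT) (s.mem .H0) B ≤ s'.reg .val →
          B ⊆ unvisited N (s'.mem .VIS))) by
    refine h.frame.mono ?_
    rintro t s' ⟨hf, h1, h2, h3⟩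
    exact hQ t s' hf h1 h2 h3
  simp only [maxFlow, wp_block_cons, wp_block_one, wp_assign, Term.eval_zero]
  refine wp_fill m (fun _ => 0) (by simp [hm]) (by simp) fun t1 ht1 => ?_
  refine wp_searchSource (N := N) (m := m) (by simp [hN]) (by simp [hm]) (by simpa using hT)
    (by simpa using hH) fun t2 s2 hf2 ht2 hRH hsr hx => ?_
  have a1 : s2.reg .n = s.reg .n := by rw [hf2.reg _ rfl]; simp
  have a2 : s2.reg .m = s.reg .m := by rw [hf2.reg _ rfl]; simp
  have a3 : s2.reg .cap = s.reg .cap := by rw [hf2.reg _ rfl]; simp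
  have a4 : s2.reg .val = 0 := by rw [hf2.reg _ rfl]; simp
  have b1 : s2.mem .XM = s.mem .XM := by rw [hf2.mem _ rfl]; simp
  have b2 : s2.mem .YM = s.mem .YM := by rw [hf2.mem _ rfl]; simp
  have b3 : s2.mem .C = s.mem .C := by rw [hf2.mem _ rfl]; simp
  have b4 : s2.mem .TT = s.mem .TT := by rw [hf2.mem _ rfl]; simp
  have b5 : s2.mem .H0 = s.mem .H0 := by rw [hf2.mem _ rfl]; simp
  have b6 : s2.mem .FL = fun e => if e < m then 0 else s.mem .FL e := by
    rw [hf2.mem _ rfl]; simp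
  simp only [Conf.mem_setReg, Conf.mem_setMem, reduceCtorEq, if_true, if_false] at hRH hsr hx
  rw [← b6] at hRH hsr
  refine wp_loop (T := (33 * m + 40 * N + 40) * (s.reg .cap + 1)) (fun T s₁ =>
    s₁.reg .val ≤ s.reg .cap + 1 ∧
    T = (33 * m + 40 * N + 40) * (s.reg .cap + 1 - s₁.reg .val) ∧
    IsFlow N m (s.mem .C) (s.mem .TT) (s.mem .H0) (s.mem .XM) (s.mem .YM) (s₁.mem .FL)
      (s₁.reg .val) ∧
    (∀ e < m, s₁.mem .RH e = resHead (s₁.mem .FL) (s.mem .TT) (s.mem .H0) e) ∧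
    Searched N m (s.mem .C) (resTail (s₁.mem .FL) (s.mem .TT) (s.mem .H0))
        (resHead (s₁.mem .FL) (s.mem .TT) (s.mem .H0)) (s.mem .YM) (s₁.mem .VIS) (s₁.mem .PAR) ∧
    ((s₁.reg .x = 0 ∧ ∀ v < N, s.mem .XM v ≠ 0 → s₁.mem .VIS v = 0) ∨
        (s₁.reg .x ≠ 0 ∧ s₁.reg .x - 1 < N ∧ s.mem .XM (s₁.reg .x - 1) ≠ 0 ∧
          s₁.mem .VIS (s₁.reg .x - 1) ≠ 0))) ?_ ?_ ?_
  · rw [a4]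
    refine ⟨by omega, rfl, ⟨?_, ?_, ?_⟩, hRH, hsr, hx⟩
    · intro e he; simp [b6, he]
    · intro e he; simp [b6, he]
    · intro A hA
      rw [netOut, Finset.sum_eq_zero]; · rfl
      intro e he; simp [b6, Finset.mem_range.mp he]
  · rintro T s₁ hf ⟨h1, rfl, h2, h3, h4, h5⟩ he
    have c1 : s₁.reg .n = s.reg .n := (hf.reg _ rfl).trans a1
    have c2 : s₁.reg .m = s.reg .m := (hf.reg _ rfl).trans a2
    have c3 : s₁.reg .cap = s.reg .cap := (hf.reg _ rfl).trans a3
    have d1 : s₁.mem .XM = s.mem .XM := (hf.mem _ rfl).trans b1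
    have d2 : s₁.mem .YM = s.mem .YM := (hf.mem _ rfl).trans b2
    have d3 : s₁.mem .C = s.mem .C := (hf.mem _ rfl).trans b3
    have d4 : s₁.mem .TT = s.mem .TT := (hf.mem _ rfl).trans b4
    have d5 : s₁.mem .H0 = s.mem .H0 := (hf.mem _ rfl).trans b5
    simp only [Term.eval_and, Term.eval_reg, Term.eval_sub, Term.eval_add, Term.eval_one, c3, ne_eq,
      ite_eq_right_iff, one_ne_zero, imp_false, not_not] at he
    obtain ⟨hx1, hx2⟩ := he
    obtain ⟨-, hx3, hx4, hx5⟩ := h5.resolve_left (by tauto)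
    simp only [wp_block_cons, wp_block_one, wp_assign]
    refine wp_augment (N := N) (m := m) (val := s₁.reg .val) (by rwa [d4]) (by rwa [d5])
      (by rwa [d4, d5]) (by rw [d2, d3, d4, d5]; exact h4) (by rw [d1, d2, d3, d4, d5]; exact h2)
      hx3 (by rwa [d1]) hx5 fun t3 s3 hf3 ht3 hfl => ?_
    have e1 : s3.reg .val = s₁.reg .val := hf3.reg _ rfl
    have f1 : s3.mem .XM = s.mem .XM := (hf3.mem _ rfl).trans d1
    have f2 : s3.mem .YM = s.mem .YM := (hf3.mem _ rfl).trans d2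
    have f3 : s3.mem .C = s.mem .C := (hf3.mem _ rfl).trans d3
    have f4 : s3.mem .TT = s.mem .TT := (hf3.mem _ rfl).trans d4
    have f5 : s3.mem .H0 = s.mem .H0 := (hf3.mem _ rfl).trans d5
    refine wp_searchSource (N := N) (m := m)
      (by simp [← hN, ← c1, hf3.reg Reg.n rfl]) (by simp [← hm, ← c2, hf3.reg Reg.m rfl])
      (by simpa [f4] using hT) (by simpa [f5] using hH) fun t4 s4 hf4 ht4 hRH4 hsr4 hx4 => ?_
    have g1 : s4.reg .val = s₁.reg .val + 1 := by rw [hf4.reg _ rfl]; simp [e1]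
    have g2 : s4.mem .FL = s3.mem .FL := by rw [hf4.mem _ rfl]; simp
    simp only [Conf.mem_setReg, f1, f2, f3, f4, f5] at hRH4 hsr4 hx4
    rw [d1, d2, d3, d4, d5] at hfl
    refine ⟨_, ⟨by omega, rfl, by rw [g1, g2]; exact hfl, by rwa [g2], by rwa [g2], hx4⟩, ?_⟩
    rw [g1]
    obtain ⟨d, hd⟩ : ∃ d, s.reg .cap + 1 - s₁.reg .val = d + 1 :=
      ⟨s.reg .cap - s₁.reg .val, by omega⟩
    rw [hd, show s.reg .cap + 1 - (s₁.reg .val + 1) = d by omega, mul_add]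
    omega
  · rintro T' s₁ t hf ⟨h1, rfl, h2, h3, h4, h5⟩ he ht
    have c3 : s₁.reg .cap = s.reg .cap := (hf.reg _ rfl).trans a3
    refine ⟨?_, fun A hA => h2.le_capOf hA, ?_⟩
    · have hN1 : 1 ≤ N := by omega
      have : (33 * m + 40 * N + 40) * (s.reg .cap + 1) ≤ 80 * (N + m) * (s.reg .cap + 1) :=
        Nat.mul_le_mul_right _ (by omega)
      have h7 : 80 * (N + m) * (s.reg .cap + 3) = 80 * (N + m) * (s.reg .cap + 1) +
        160 * (N + m) := by ring
      omega
    · simp only [Term.eval_and, Term.eval_reg, Term.eval_sub, Term.eval_add, Term.eval_one, c3,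
        ne_eq, ite_eq_right_iff, one_ne_zero, imp_false] at he
      rcases h5 with ⟨h5, h6⟩ | ⟨h5, -⟩
      · right
        obtain ⟨h7, h8⟩ := h2.capOf_unvisited h4 hT hH h6
        exact ⟨h5, h7, h8, fun B hB hle => h2.subset_unvisited h4 hT hH hB hle⟩
      · left
        exact ⟨h5, by omega⟩

/-! ### Important cuts as boundaries of vertex sets -/

section Boundary

variable {V : Type*}

/-- The arcs of `E` that leave the vertex set `A`. -/
noncomputable def boundary (E : Finset (V × V)) (A : Set V) : Finset (V × V) := by
  classical exact E.filter fun e => e.1 ∈ A ∧ e.2 ∉ A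

/-- The vertices reachable from `X` by paths with arcs in `E` and all vertices in `A`. -/
def reachIn (E : Finset (V × V)) (A X : Set V) : Set V :=
  {v | ∃ x ∈ X, Relation.ReflTransGen (fun u v => (u, v) ∈ E ∧ u ∈ A ∧ v ∈ A) x v}

variable {E D : Finset (V × V)} {A B X X₀ Y M : Set V}

@[simp] theorem mem_boundary {e : V × V} : e ∈ boundary E A ↔ e ∈ E ∧ e.1 ∈ A ∧ e.2 ∉ A := by
  simp [boundary]

theorem reachIn_subset (h : X ⊆ A) : reachIn E A X ⊆ A := by
  rintro v ⟨x, hx, hp⟩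
  induction hp with
  | refl => exact h hx
  | tail _ h' _ => exact h'.2.2

theorem subset_reachIn : X ⊆ reachIn E A X := fun x hx => ⟨x, hx, .refl⟩

theorem reachIn_mono (h : A ⊆ B) : reachIn E A X ⊆ reachIn E B X := by
  rintro v ⟨x, hx, hp⟩
  exact ⟨x, hx, hp.lift id fun u v huv => ⟨huv.1, h huv.2.1, h huv.2.2⟩⟩

theorem reachIn_step {u v : V} (hu : u ∈ reachIn E A X) (h : (u, v) ∈ E) (huA : u ∈ A)
    (hvA : v ∈ A) : v ∈ reachIn E A X := by
  obtain ⟨x, hx, hp⟩ := hu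
  exact ⟨x, hx, hp.tail ⟨h, huA, hvA⟩⟩

/-- The number of leaving arcs is a submodular function of the vertex set. -/
theorem card_boundary_submodular (E : Finset (V × V)) (A B : Set V) :
    (boundary E (A ∪ B)).card + (boundary E (A ∩ B)).card ≤
      (boundary E A).card + (boundary E B).card := by
  classical
  simp only [boundary, Finset.card_filter]
  rw [← Finset.sum_add_distrib, ← Finset.sum_add_distrib]
  refine Finset.sum_le_sum fun e _ => ?_
  by_cases h1 : e.1 ∈ A <;> by_cases h2 : e.1 ∈ B <;> by_cases h3 : e.2 ∈ A <;>
    by_cases h4 : e.2 ∈ B <;> simp [h1, h2, h3, h4]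

/-- A vertex set whose boundary is an important `(X₀, Y)`-cut: no larger set that avoids `Y` has
a boundary of at most the same size, and all arcs of the boundary can be reached. -/
structure ImportantSet (E : Finset (V × V)) (X₀ Y A : Set V) : Prop where
  sub : X₀ ⊆ A
  disj : Disjoint A Y
  max : ∀ B, A ⊆ B → Disjoint B Y → (boundary E B).card ≤ (boundary E A).card → B ⊆ A
  reach : ∀ e ∈ boundary E A, e.1 ∈ reachIn E A X₀

/-- The vertices from which `Y` cannot be reached in `H - S`. -/
def noReach (H : Digraph V) (Y : Set V) (S : Finset (V × V)) : Set V :=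
  {v | ∀ y ∈ Y, ¬ Relation.ReflTransGen (deleteArcs H S).Adj v y}

section Digraph

variable {H : Digraph V} {S S' : Finset (V × V)}

theorem disjoint_noReach : Disjoint (noReach H Y S) Y :=
  Set.disjoint_left.mpr fun v hv hy => hv v hy .refl

theorem boundary_noReach_subset (hE : ∀ u v, (u, v) ∈ E → H.Adj u v) :
    boundary E (noReach H Y S) ⊆ S := by
  rintro ⟨u, v⟩ h
  rw [mem_boundary] at h
  obtain ⟨h1, h2, h3⟩ := h
  by_contra h4
  refine h3 fun y hy hp => h2 y hy (.head ⟨hE _ _ h1, h4⟩ hp)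

theorem reach_subset_of_boundary_subset (hE' : ∀ u v, H.Adj u v → (u, v) ∈ E ∨ u ∈ Y)
    (hA : Disjoint A Y) (hS : boundary E A ⊆ S) {u v : V} (hu : u ∈ A)
    (hp : Relation.ReflTransGen (deleteArcs H S).Adj u v) : v ∈ A := by
  induction hp with
  | refl => exact hu
  | tail _ h ih =>
    rename_i b c _
    by_contra hc
    rcases hE' _ _ h.1 with h1 | h1
    · exact h.2 (hS (mem_boundary.mpr ⟨h1, ih, hc⟩))
    · exact Set.disjoint_left.mp hA ih h1

theorem isCut_boundary (hE : ∀ u v, (u, v) ∈ E → H.Adj u v)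
    (hE' : ∀ u v, H.Adj u v → (u, v) ∈ E ∨ u ∈ Y) (hX : X₀ ⊆ A) (hA : Disjoint A Y) :
    IsCut H X₀ Y (boundary E A) := by
  refine ⟨fun e he => hE _ _ (mem_boundary.mp he).1, ?_⟩
  refine hA.mono_left ?_
  rintro v ⟨x, hx, hp⟩
  exact reach_subset_of_boundary_subset hE' hA subset_rfl (hX hx) hp

/-- If the vertices reachable in `H - S` form a subset of a set `A` that avoids `Y`, then they can
also be reached by paths with arcs in `E` and vertices in `A`, a description without `S`. -/
theorem reach_transfer (hE' : ∀ u v, H.Adj u v → (u, v) ∈ E ∨ u ∈ Y) (hA : Disjoint A Y)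
    (hR : reachSet (deleteArcs H S) X₀ ⊆ A) :
    reachSet (deleteArcs H S) X₀ ⊆ reachIn E A X₀ := by
  rintro v ⟨x, hx, hp⟩
  induction hp with
  | refl => exact subset_reachIn hx
  | tail hp h ih =>
    rename_i b c
    have hb : b ∈ A := hR ⟨x, hx, hp⟩
    have hc : c ∈ A := hR ⟨x, hx, hp.tail h⟩
    rcases hE' _ _ h.1 with h1 | h1
    · exact reachIn_step ih h1 hb hc
    · exact absurd h1 (Set.disjoint_left.mp hA hb)

theorem reachIn_subset_reachSet (hE : ∀ u v, (u, v) ∈ E → H.Adj u v)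
    (hS : S ⊆ boundary E A) : reachIn E A X₀ ⊆ reachSet (deleteArcs H S) X₀ := by
  rintro v ⟨x, hx, hp⟩
  refine ⟨x, hx, hp.lift id fun a b h => ⟨hE _ _ h.1, fun h' => ?_⟩⟩
  exact (mem_boundary.mp (hS h')).2.2 h.2.2

/-- The important cuts are the boundaries of the important sets. The set of an important cut `S`
consists of all vertices from which `Y` cannot be reached in `H - S`. Arcs with tail in `Y` play no
role, so `E` need not contain them. -/
theorem isImportantCut_iff (hE : ∀ u v, (u, v) ∈ E → H.Adj u v)
    (hE' : ∀ u v, H.Adj u v → (u, v) ∈ E ∨ u ∈ Y) :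
    IsImportantCut H X₀ Y S ↔ ∃ A, ImportantSet E X₀ Y A ∧ S = boundary E A := by
  constructor
  · rintro ⟨⟨hc1, hc2⟩, hmin, himp⟩
    have eq_of_subset : ∀ A, X₀ ⊆ A → Disjoint A Y → boundary E A ⊆ S → S = boundary E A := by
      intro A hX hA hS
      by_contra hne
      exact hmin _ (hS.ssubset_of_ne (Ne.symm hne)) (isCut_boundary hE hE' hX hA)
    have hRN : reachSet (deleteArcs H S) X₀ ⊆ noReach H Y S := by
      rintro v ⟨x, hx, hp⟩ y hy hq
      exact Set.disjoint_left.mp hc2 ⟨x, hx, hp.trans hq⟩ hy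
    have hXR : X₀ ⊆ reachSet (deleteArcs H S) X₀ := fun x hx => ⟨x, hx, .refl⟩
    have hXN : X₀ ⊆ noReach H Y S := hXR.trans hRN
    have hSN := eq_of_subset _ hXN disjoint_noReach (boundary_noReach_subset hE)
    have hSR := eq_of_subset (reachSet (deleteArcs H S) X₀) hXR hc2 (by
      rintro ⟨u, v⟩ h
      rw [mem_boundary] at h
      obtain ⟨h1, ⟨x, hx, hp⟩, h3⟩ := h
      by_contra h4
      exact h3 ⟨x, hx, hp.tail ⟨hE _ _ h1, h4⟩⟩)
    refine ⟨noReach H Y S, ⟨hXN, disjoint_noReach, ?_, ?_⟩, hSN⟩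
    · intro B hNB hB hcard
      rw [← hSN] at hcard
      have hcut := isCut_boundary hE hE' (hXN.trans hNB) hB
      have hle : reachSet (deleteArcs H S) X₀ ⊆ reachSet (deleteArcs H (boundary E B)) X₀ :=
        (reach_transfer hE' hB (hRN.trans hNB)).trans
          (reachIn_subset_reachSet hE subset_rfl)
      have hge : reachSet (deleteArcs H (boundary E B)) X₀ ⊆ reachSet (deleteArcs H S) X₀ := by
        by_contra hh
        exact himp _ hcut hcard ⟨hle, hh⟩
      have hSB : S = boundary E B := by
        refine Finset.eq_of_subset_of_card_le ?_ hcard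
        rintro ⟨u, v⟩ h
        by_contra h4
        have h5 := h
        rw [hSR, mem_boundary] at h5
        obtain ⟨h1, h2, h3⟩ := h5
        obtain ⟨x, hx, hp⟩ := hle h2
        exact h3 (hge ⟨x, hx, hp.tail ⟨hE _ _ h1, h4⟩⟩)
      intro v hv y hy hp
      exact Set.disjoint_left.mp hB (reach_subset_of_boundary_subset hE' hB hSB.ge hv hp) hy
    · intro e he
      rw [← hSN, hSR] at he
      exact reach_transfer hE' disjoint_noReach hRN (mem_boundary.mp he).2.1
  · rintro ⟨A, hA, rfl⟩
    refine ⟨isCut_boundary hE hE' hA.sub hA.disj, ?_, ?_⟩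
    · intro S' hS' hcut
      obtain ⟨⟨u, v⟩, he, he'⟩ := Finset.exists_of_ssubset hS'
      obtain ⟨x, hx, hp⟩ := reachIn_subset_reachSet hE hS'.subset (hA.reach _ he)
      have h1 := mem_boundary.mp he
      have hsub : noReach H Y (boundary E A) ⊆ A := by
        refine hA.max _ ?_ disjoint_noReach (Finset.card_le_card (boundary_noReach_subset hE))
        intro a ha y hy hq
        exact Set.disjoint_left.mp hA.disj
          (reach_subset_of_boundary_subset hE' hA.disj subset_rfl ha hq) hy
      have h2 : v ∉ noReach H Y (boundary E A) := fun h => h1.2.2 (hsub h)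
      simp only [noReach, Set.mem_ofPred_eq, not_forall, not_not] at h2
      obtain ⟨y, hy, hq⟩ := h2
      refine Set.disjoint_left.mp hcut.2 ⟨x, hx, (hp.tail ⟨hE _ _ h1.1, he'⟩).trans
        (hq.lift id fun a b h => ⟨h.1, fun h' => h.2 (hS'.subset h')⟩)⟩ hy
    · -- By submodularity, a cut `S'` with a larger reachable set gives a set containing `A` with a
      -- boundary of at most the same size, contrary to the maximality of `A`.
      intro S' hcut hcard hss
      have hRN : reachSet (deleteArcs H S') X₀ ⊆ noReach H Y S' := by
        rintro v ⟨x, hx, hp⟩ y hy hq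
        exact Set.disjoint_left.mp hcut.2 ⟨x, hx, hp.trans hq⟩ hy
      have h1 : boundary E A ⊆ boundary E (A ∩ noReach H Y S') := by
        intro e he
        have h2 := mem_boundary.mp he
        have h3 := reachIn_subset_reachSet hE subset_rfl (hA.reach _ he)
        exact mem_boundary.mpr ⟨h2.1, ⟨h2.2.1, hRN (hss.1 h3)⟩, fun h => h2.2.2 h.1⟩
      have h2 := card_boundary_submodular E A (noReach H Y S')
      have h3 := Finset.card_le_card h1
      have h4 := Finset.card_le_card (boundary_noReach_subset (Y := Y) (S := S') hE)
      have h5 := hA.max (A ∪ noReach H Y S') Set.subset_union_left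
        (hA.disj.union_left disjoint_noReach) (by omega)
      have h6 : noReach H Y S' ⊆ A := Set.subset_union_right.trans h5
      refine hss.2 ?_
      exact (reach_transfer hE' hA.disj (hRN.trans h6)).trans
        (reachIn_subset_reachSet hE subset_rfl)

end Digraph

/-! ### The enumeration of important cuts -/

/-- The important cuts of size at most `k` whose set contains `X` and which contain the arcs `D`:
those to be found below a node of the enumeration tree. -/
def cutsAt (E : Finset (V × V)) (X₀ Y : Set V) (k : ℕ) (X : Set V) (D : Finset (V × V)) :
    Set (Finset (V × V)) :=
  {S | ∃ A, ImportantSet E X₀ Y A ∧ S = boundary E A ∧ X ⊆ A ∧ D ⊆ S ∧ S.card ≤ k}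

/-- The invariant of the nodes `(X, D)` of the enumeration tree, where `X` is the set of the vertices
that are to stay on the source side and `D` the set of the arcs chosen for the cut. -/
structure IsNode [DecidableEq V] (E : Finset (V × V)) (X₀ Y X : Set V) (D : Finset (V × V)) :
    Prop where
  sub : X₀ ⊆ X
  disj : Disjoint X Y
  arcs : D ⊆ E
  reach : ∀ e ∈ D, e.1 ∈ reachIn E X X₀
  reach' : ∀ e ∈ boundary (E \ D) X, e.1 ∈ reachIn E X X₀

/-- `M` is the largest of the sets with the smallest boundary that contain `X` and avoid `Y`. -/
structure Furthest (E : Finset (V × V)) (X Y M : Set V) : Prop where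
  sub : X ⊆ M
  disj : Disjoint M Y
  min : ∀ A, X ⊆ A → Disjoint A Y → (boundary E M).card ≤ (boundary E A).card
  max : ∀ B, X ⊆ B → Disjoint B Y → (boundary E B).card ≤ (boundary E M).card → B ⊆ M

/-- Distinct important sets have distinct boundaries, so no cut is found twice. -/
theorem ImportantSet.eq_of_boundary_eq (hA : ImportantSet E X₀ Y A) (hB : ImportantSet E X₀ Y B)
    (h : boundary E A = boundary E B) : A = B := by
  have h1 : boundary E (A ∪ B) ⊆ boundary E A := by
    intro e he
    have h2 := mem_boundary.mp he
    simp only [Set.mem_union, not_or] at h2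
    rcases h2.2.1 with h3 | h3
    · exact mem_boundary.mpr ⟨h2.1, h3, h2.2.2.1⟩
    · rw [h]; exact mem_boundary.mpr ⟨h2.1, h3, h2.2.2.2⟩
  have h2 := Finset.card_le_card h1
  have h3 := hA.disj.union_left hB.disj
  exact (Set.subset_union_left.trans (hB.max _ Set.subset_union_right h3 (h ▸ h2))).antisymm
    (Set.subset_union_right.trans (hA.max _ Set.subset_union_left h3 h2))

theorem cutsAt_eq_empty_of_mem {k : ℕ} {v : V} (hv : v ∈ X) (hvY : v ∈ Y) :
    cutsAt E X₀ Y k X D = ∅ := by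
  rw [Set.eq_empty_iff_forall_notMem]
  rintro S ⟨A, hA, -, hX, -, -⟩
  exact Set.disjoint_left.mp hA.disj (hX hv) hvY

theorem Furthest.lt_of_mem (h : Furthest E X Y M) {v : V} (hv : v ∉ M) (hX : M ⊆ A) (hvA : v ∈ A)
    (hA : Disjoint A Y) : (boundary E M).card < (boundary E A).card := by
  by_contra hh
  exact hv (h.max A (h.sub.trans hX) hA (not_lt.mp hh) hvA)

variable [DecidableEq V] {k : ℕ}

theorem boundary_sdiff : boundary (E \ D) A = boundary E A \ D := by
  ext e; simp only [mem_boundary, Finset.mem_sdiff]; tauto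

theorem card_boundary_of_subset (h : D ⊆ boundary E A) :
    (boundary E A).card = (boundary (E \ D) A).card + D.card := by
  rw [boundary_sdiff, Finset.card_sdiff_add_card_eq_card h]

theorem card_boundary_le : (boundary E A).card ≤ (boundary (E \ D) A).card + D.card := by
  rw [boundary_sdiff]; exact Finset.card_le_card_sdiff_add_card

theorem isNode_root (h : Disjoint X₀ Y) : IsNode E X₀ Y X₀ ∅ :=
  ⟨subset_rfl, h, by simp, by simp, fun _ he => subset_reachIn (mem_boundary.mp he).2.1⟩

theorem cutsAt_eq_empty {b : ℕ} (hb : D.card + b = k)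
    (h : ∀ A, X ⊆ A → Disjoint A Y → b < (boundary (E \ D) A).card) :
    cutsAt E X₀ Y k X D = ∅ := by
  rw [Set.eq_empty_iff_forall_notMem]
  rintro S ⟨A, hA, rfl, hX, hD, hc⟩
  have := h A hX hA.disj
  rw [card_boundary_of_subset hD] at hc
  omega

/-- Every important set below a node contains the furthest minimum cut of the node, because its union
with that cut has, by submodularity, no larger boundary. -/
theorem Furthest.cutsAt_eq (h : Furthest (E \ D) X Y M) :
    cutsAt E X₀ Y k X D = cutsAt E X₀ Y k M D := by
  ext S
  constructor
  · rintro ⟨A, hA, rfl, hX, hD, hc⟩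
    refine ⟨A, hA, rfl, ?_, hD, hc⟩
    have h1 := card_boundary_submodular (E \ D) A M
    have h2 := h.min (A ∩ M) (Set.subset_inter hX h.sub) (h.disj.mono_left Set.inter_subset_right)
    have h3 := card_boundary_of_subset hD
    have h4 := card_boundary_le (E := E) (D := D) (A := A ∪ M)
    exact Set.subset_union_right.trans
      (hA.max _ Set.subset_union_left (hA.disj.union_left h.disj) (by omega))
  · rintro ⟨A, hA, rfl, hX, hD, hc⟩
    exact ⟨A, hA, rfl, h.sub.trans hX, hD, hc⟩

/-- Passing to the furthest minimum cut preserves the invariant. An arc that leaves `M` without being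
reachable would make the boundary of the reachable part of `M` smaller than that of `M`. -/
theorem IsNode.furthest (hn : IsNode E X₀ Y X D) (h : Furthest (E \ D) X Y M) :
    IsNode E X₀ Y M D := by
  have hR : reachIn E M X₀ ⊆ M := reachIn_subset (hn.sub.trans h.sub)
  refine ⟨hn.sub.trans h.sub, h.disj, hn.arcs, fun e he => reachIn_mono h.sub (hn.reach e he), ?_⟩
  intro e he
  by_contra hne
  have hAM : reachIn E M X₀ ∪ X ⊆ M := Set.union_subset hR h.sub
  have h1 := h.min (reachIn E M X₀ ∪ X) Set.subset_union_right (h.disj.mono_left hAM)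
  refine absurd (Finset.card_lt_card ?_) (not_lt.mpr h1)
  have key : ∀ f ∈ boundary (E \ D) (reachIn E M X₀ ∪ X),
      f ∈ boundary (E \ D) M ∧ f.1 ∈ reachIn E M X₀ := by
    rintro ⟨u, v⟩ hf
    rw [mem_boundary] at hf
    obtain ⟨h2, h3, h4⟩ := hf
    simp only [Set.mem_union, not_or] at h4
    have h5 : u ∈ reachIn E M X₀ := by
      rcases h3 with h3 | h3
      · exact h3
      · exact reachIn_mono h.sub (hn.reach' _ (mem_boundary.mpr ⟨h2, h3, h4.2⟩))
    refine ⟨mem_boundary.mpr ⟨h2, hAM h3, fun h6 => h4.1 ?_⟩, h5⟩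
    exact reachIn_step h5 (Finset.mem_sdiff.mp h2).1 (hAM h3) h6
  rw [Finset.ssubset_iff_of_subset fun f hf => (key f hf).1]
  exact ⟨e, he, fun hh => hne (key e hh).2⟩

/-- At a leaf of the enumeration tree, `D` is the only candidate. -/
theorem IsNode.cutsAt_subset (hn : IsNode E X₀ Y M D) (h0 : boundary (E \ D) M = ∅) {A : Set V}
    (hA : ImportantSet E X₀ Y A) (hM : M ⊆ A) (hD : D ⊆ boundary E A) : boundary E A = D := by
  refine (Finset.Subset.antisymm hD ?_).symm
  have hRM : reachIn E A X₀ ⊆ M := by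
    rintro v ⟨x, hx, hp⟩
    induction hp with
    | refl => exact hn.sub hx
    | tail _ h ih =>
      rename_i b c _
      by_contra hc
      by_cases hbc : (b, c) ∈ D
      · exact (mem_boundary.mp (hD hbc)).2.2 h.2.2
      · have : (b, c) ∈ boundary (E \ D) M :=
          mem_boundary.mpr ⟨Finset.mem_sdiff.mpr ⟨h.1, hbc⟩, ih, hc⟩
        simp [h0] at this
  intro e he
  by_contra hed
  have h1 := mem_boundary.mp he
  have : e ∈ boundary (E \ D) M := mem_boundary.mpr
    ⟨Finset.mem_sdiff.mpr ⟨h1.1, hed⟩, hRM (hA.reach e he), fun h => h1.2.2 (hM h)⟩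
  simp [h0] at this

/-- At a leaf, `D` is an important cut if it is the boundary of `M` and if `M` contains the furthest
minimum cut from `M`. -/
theorem IsNode.leaf_good (hn : IsNode E X₀ Y M D) (h0 : boundary (E \ D) M = ∅)
    (hk : D.card ≤ k) (hD : ∀ e ∈ D, e.2 ∉ M) {M' : Set V} (hM' : Furthest E M Y M')
    (hsub : M' ⊆ M) : ImportantSet E X₀ Y M ∧ boundary E M = D ∧
      cutsAt E X₀ Y k M D = {D} := by
  have hDM : boundary E M = D := by
    apply Finset.Subset.antisymm
    · rw [boundary_sdiff, Finset.sdiff_eq_empty_iff_subset] at h0; exact h0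
    · intro e he
      exact mem_boundary.mpr ⟨hn.arcs he, reachIn_subset hn.sub (hn.reach e he), hD e he⟩
  obtain rfl : M' = M := hsub.antisymm hM'.sub
  have himp : ImportantSet E X₀ Y M' :=
    ⟨hn.sub, hn.disj, fun B h1 h2 h3 => hM'.max B h1 h2 h3, fun e he => hn.reach e (hDM ▸ he)⟩
  refine ⟨himp, hDM, ?_⟩
  ext S
  constructor
  · rintro ⟨A, hA, rfl, hM, hDA, -⟩
    exact hn.cutsAt_subset h0 hA hM hDA
  · rintro rfl
    exact ⟨M', himp, hDM.symm, subset_rfl, subset_rfl, hk⟩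

/-- If there is an important cut below a leaf, then `M` is its set. -/
theorem IsNode.leaf_eq (hn : IsNode E X₀ Y M D) (hM : Furthest (E \ D) X Y M)
    (h0 : boundary (E \ D) M = ∅) {S : Finset (V × V)} (hS : S ∈ cutsAt E X₀ Y k M D) :
    ImportantSet E X₀ Y M ∧ boundary E M = D := by
  obtain ⟨A, hA, rfl, hMA, hDA, -⟩ := hS
  have h1 := hn.cutsAt_subset h0 hA hMA hDA
  have h2 : A ⊆ M := by
    refine hM.max A (hM.sub.trans hMA) hA.disj ?_
    rw [boundary_sdiff, h1]; simp
  obtain rfl : A = M := h2.antisymm hMA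
  exact ⟨hA, h1⟩

/-- A leaf is useless if some chosen arc does not leave `M`. -/
theorem IsNode.leaf_bad₁ (hn : IsNode E X₀ Y M D) (hM : Furthest (E \ D) X Y M)
    (h0 : boundary (E \ D) M = ∅) {e : V × V} (he : e ∈ D) (heM : e.2 ∈ M) :
    cutsAt E X₀ Y k M D = ∅ := by
  rw [Set.eq_empty_iff_forall_notMem]
  intro S hS
  obtain ⟨-, h1⟩ := hn.leaf_eq hM h0 hS
  rw [← h1] at he
  exact (mem_boundary.mp he).2.2 heM

/-- A leaf is useless if another set has a boundary of at most the size of that of `M` and is not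
contained in `M`. -/
theorem IsNode.leaf_bad₂ (hn : IsNode E X₀ Y M D) (hM : Furthest (E \ D) X Y M)
    (h0 : boundary (E \ D) M = ∅) {M' : Set V} (hM' : Furthest E M Y M')
    (hsub : ¬ M' ⊆ M) : cutsAt E X₀ Y k M D = ∅ := by
  rw [Set.eq_empty_iff_forall_notMem]
  intro S hS
  obtain ⟨h1, -⟩ := hn.leaf_eq hM h0 hS
  exact hsub (h1.max M' hM'.sub hM'.disj (hM'.min M subset_rfl hn.disj))

/-- Branching on an arc `e` that leaves `M`: it belongs to the cut, or its head to the set. -/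
theorem cutsAt_branch {e : V × V} (he : e ∈ boundary (E \ D) M) :
    cutsAt E X₀ Y k M D = cutsAt E X₀ Y k M (insert e D) ∪ cutsAt E X₀ Y k (insert e.2 M) D := by
  rw [mem_boundary, Finset.mem_sdiff] at he
  ext S
  constructor
  · rintro ⟨A, hA, rfl, hM, hDA, hk⟩
    by_cases h : e.2 ∈ A
    · exact .inr ⟨A, hA, rfl, Set.insert_subset h hM, hDA, hk⟩
    · refine .inl ⟨A, hA, rfl, hM, Finset.insert_subset ?_ hDA, hk⟩
      exact mem_boundary.mpr ⟨he.1.1, hM he.2.1, h⟩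
  · rintro (⟨A, hA, rfl, hM, hDA, hk⟩ | ⟨A, hA, rfl, hM, hDA, hk⟩)
    · exact ⟨A, hA, rfl, hM, (Finset.subset_insert _ _).trans hDA, hk⟩
    · exact ⟨A, hA, rfl, (Set.subset_insert _ _).trans hM, hDA, hk⟩

theorem cutsAt_branch_disjoint {e : V × V} :
    Disjoint (cutsAt E X₀ Y k M (insert e D)) (cutsAt E X₀ Y k (insert e.2 M) D) := by
  rw [Set.disjoint_left]
  rintro S ⟨A, hA, rfl, hM, hDA, -⟩ ⟨B, hB, hAB, hMB, -, -⟩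
  obtain rfl := hA.eq_of_boundary_eq hB hAB
  exact (mem_boundary.mp (hDA (Finset.mem_insert_self _ _))).2.2 (hMB (Set.mem_insert _ _))

theorem IsNode.insert_arc (hn : IsNode E X₀ Y M D) {e : V × V} (he : e ∈ boundary (E \ D) M) :
    IsNode E X₀ Y M (insert e D) := by
  have h1 := mem_boundary.mp he
  refine ⟨hn.sub, hn.disj, Finset.insert_subset (Finset.mem_sdiff.mp h1.1).1 hn.arcs, ?_, ?_⟩
  · intro f hf
    rcases Finset.mem_insert.mp hf with rfl | hf
    · exact hn.reach' _ he
    · exact hn.reach f hf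
  · intro f hf
    refine hn.reach' f ?_
    rw [boundary_sdiff, Finset.mem_sdiff] at hf ⊢
    exact ⟨hf.1, fun h => hf.2 (Finset.mem_insert_of_mem h)⟩

theorem IsNode.insert_vertex (hn : IsNode E X₀ Y M D) {e : V × V} (he : e ∈ boundary (E \ D) M)
    (hY : e.2 ∉ Y) : IsNode E X₀ Y (insert e.2 M) D := by
  have h1 := mem_boundary.mp he
  have hss : M ⊆ insert e.2 M := Set.subset_insert _ _
  refine ⟨hn.sub.trans hss, ?_, hn.arcs, fun f hf => reachIn_mono hss (hn.reach f hf), ?_⟩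
  · rw [Set.disjoint_left]
    rintro v (rfl | hv)
    · exact hY
    · exact Set.disjoint_left.mp hn.disj hv
  · intro f hf
    obtain ⟨h2, h3, h4⟩ := mem_boundary.mp hf
    rcases h3 with h3 | h3
    · rw [h3]
      exact reachIn_step (reachIn_mono hss (hn.reach' e he)) (Finset.mem_sdiff.mp h1.1).1
        (hss h1.2.1) (Set.mem_insert _ _)
    · exact reachIn_mono hss (hn.reach' f (mem_boundary.mpr ⟨h2, h3, fun h => h4 (hss h)⟩))

theorem card_boundary_insert_arc (e : V × V) (A : Set V) :
    (boundary (E \ D) A).card ≤ (boundary (E \ insert e D) A).card + 1 := by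
  have : boundary (E \ D) A ⊆ insert e (boundary (E \ insert e D) A) := by
    intro f hf
    simp only [boundary_sdiff, Finset.mem_sdiff, Finset.mem_insert, not_or] at hf ⊢
    tauto
  exact (Finset.card_le_card this).trans (Finset.card_insert_le _ _)

end Boundary

/-! ### Feedback vertex sets and cycles -/

section Cycles

variable {V : Type*}

theorem transGen_of_imp {r p : V → V → Prop} {a b : V} (h : Relation.TransGen r a b)
    (hr : ∀ x y, r x y → p x y) : Relation.TransGen p a b := by
  induction h with
  | single h => exact .single (hr _ _ h)
  | tail _ h ih => exact ih.tail (hr _ _ h)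

/-- Every path either avoids `W` or passes through a vertex of `W`. -/
theorem transGen_avoid_or (G : Digraph V) (W : Finset V) {u v : V}
    (h : Relation.TransGen G.Adj u v) :
    Relation.TransGen (fun u v => G.Adj u v ∧ u ∉ W ∧ v ∉ W) u v ∨
      ∃ w ∈ W, Relation.ReflTransGen G.Adj u w ∧ Relation.ReflTransGen G.Adj w v := by
  induction h with
  | single h =>
    rename_i b
    by_cases h1 : u ∈ W
    · exact .inr ⟨u, h1, .refl, .single h⟩
    · by_cases h2 : b ∈ W
      · exact .inr ⟨b, h2, .single h, .refl⟩
      · exact .inl (.single ⟨h, h1, h2⟩)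
  | tail h' h ih =>
    rename_i b c
    rcases ih with ih | ⟨w, hw, h1, h2⟩
    · by_cases h1 : b ∈ W
      · exact .inr ⟨b, h1, h'.to_reflTransGen, .single h⟩
      · by_cases h2 : c ∈ W
        · exact .inr ⟨c, h2, h'.to_reflTransGen.tail h, .refl⟩
        · exact .inl (ih.tail ⟨h, h1, h2⟩)
    · exact .inr ⟨w, hw, h1, h2.tail h⟩

/-- A hint remains a feedback vertex set when arcs are deleted and when vertices that lie on no
cycle are removed from it. -/
theorem IsDFVS.mono {G G' : Digraph V} {W W' : Finset V} (h : IsDFVS G W)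
    (hG : ∀ u v, G'.Adj u v → G.Adj u v) (hW : ∀ w ∈ W, w ∉ W' → ¬ OnCycle G' w) :
    IsDFVS G' W' := by
  intro v hv
  rcases transGen_avoid_or (⟨fun u v => G'.Adj u v ∧ u ∉ W' ∧ v ∉ W'⟩ : Digraph V) W hv with
    h1 | ⟨w, hw, h1, h2⟩
  · exact h v (transGen_of_imp h1 fun a b hab => ⟨hG _ _ hab.1.1, hab.2⟩)
  · have h3 : Relation.TransGen (fun u v => G'.Adj u v ∧ u ∉ W' ∧ v ∉ W') w w :=
      (Relation.TransGen.trans_right h2 hv).trans_left h1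
    refine hW w hw ?_ (transGen_of_imp h3 fun a b hab => hab.1)
    obtain ⟨b, hb, -⟩ := Relation.TransGen.head'_iff.mp h3
    exact hb.2.1

/-- A hint without a vertex on a cycle shows that the digraph is acyclic. -/
theorem IsDFVS.isAcyclic {G : Digraph V} {W : Finset V} (h : IsDFVS G W)
    (hW : ∀ w ∈ W, ¬ OnCycle G w) : IsAcyclic G := by
  have h1 : IsDFVS G (∅ : Finset V) := h.mono (fun _ _ h => h) fun w hw _ => hW w hw
  exact fun v hv => h1 v (transGen_of_imp hv fun a b hab => ⟨hab, by simp, by simp⟩)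

variable [DecidableEq V]

/-- If no arc leaves a set that contains `w⁺` but not `w⁻`, then `w` is on no cycle. -/
theorem not_onCycle_of_boundary {G : Digraph V} {w : V} {E : Finset (Option V × Option V)}
    {M : Set (Option V)} (hM : none ∈ M) (hw : some w ∉ M)
    (hG : ∀ u v, G.Adj u v → expandArc w (u, v) ∈ E ∧ expandArc w (u, v) ∉ boundary E M) :
    ¬ OnCycle G w := by
  suffices h : ∀ v, Relation.TransGen G.Adj w v → some v ∈ M from fun hc => hw (h w hc)
  intro v hv
  induction hv with
  | single h =>
    have h1 := hG _ _ h
    by_contra h2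
    refine h1.2 (mem_boundary.mpr ⟨h1.1, ?_, ?_⟩)
    · simpa [expandArc] using hM
    · simpa [expandArc] using h2
  | tail _ h ih =>
    rename_i b c _
    have h1 := hG _ _ h
    by_contra h2
    have hb : b ≠ w := fun hb => hw (hb ▸ ih)
    refine h1.2 (mem_boundary.mpr ⟨h1.1, ?_, ?_⟩)
    · simpa [expandArc, hb] using ih
    · simpa [expandArc] using h2

theorem expandArc_injective (w : V) : Function.Injective (expandArc w) := by
  rintro ⟨a, b⟩ ⟨c, d⟩ h
  simp only [expandArc, Prod.mk.injEq, Option.some.injEq] at h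
  obtain ⟨h1, h2⟩ := h
  by_cases ha : a = w <;> by_cases hc : c = w <;> simp_all

/-- The important cuts of the algorithm, in terms of the arcs that come from `G`. The additional arc
`(w⁻, w⁺)` leaves a target and can be ignored. -/
theorem importantCuts_eq {G : Digraph V} {W : Finset V} {k : ℕ} {w : V} (hw : w ∈ W)
    {E : Finset (Option V × Option V)}
    (hE : ∀ x, x ∈ E ↔ ∃ u v, G.Adj u v ∧ expandArc w (u, v) = x) :
    importantCuts G W k w = cutsAt E {none} (some '' (W : Set V)) k {none} ∅ := by
  have hY : some '' ((W.erase w : Finset V) : Set V) ∪ {some w} = some '' (W : Set V) := by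
    ext x
    simp only [Finset.coe_erase, Set.mem_union, Set.mem_image, Set.mem_sdiff, Finset.mem_coe,
      Set.mem_singleton_iff]
    constructor
    · rintro (⟨a, ⟨ha, -⟩, rfl⟩ | rfl)
      · exact ⟨a, ha, rfl⟩
      · exact ⟨w, hw, rfl⟩
    · rintro ⟨a, ha, rfl⟩
      by_cases h : a = w
      · exact .inr (by rw [h])
      · exact .inl ⟨a, ⟨ha, h⟩, rfl⟩
  ext S
  simp only [importantCuts, Set.mem_ofPred_eq, hY, cutsAt]
  rw [isImportantCut_iff (E := E)]
  · constructor
    · rintro ⟨⟨A, hA, rfl⟩, hk⟩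
      exact ⟨A, hA, rfl, hA.sub, by simp, hk⟩
    · rintro ⟨A, hA, rfl, -, -, hk⟩
      exact ⟨⟨A, hA, rfl⟩, hk⟩
  · intro x y hxy
    obtain ⟨u, v, h1, h2⟩ := (hE _).mp hxy
    exact .inr ⟨(u, v), h1, h2⟩
  · rintro x y (⟨rfl, rfl⟩ | ⟨e, h1, h2⟩)
    · exact .inr ⟨w, hw, rfl⟩
    · exact .inl ((hE _).mpr ⟨e.1, e.2, h1, h2⟩)

end Cycles

/-! ### Composing executions -/

section Executions

variable {V : Type*} [DecidableEq V] {G : Digraph V} {W : Finset V} {k : ℕ} {w : V}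

/-- The events `log` are a part of the loop over important cuts that treats the cuts in `U` and
stops if and only if `res` is not `nil`. It can be extended to an execution of the loop from every
set `U'` of untreated cuts that contains `U`. -/
def Covers (G : Digraph V) (W : Finset V) (k : ℕ) (w : V)
    (U : Set (Finset (Option V × Option V))) (log : List (Event V)) :
    Option (Finset (V × V)) → Prop
  | none => ∀ U', U ⊆ U' → ∀ log₂ r, EachCut G W k w (U' \ U) log₂ r →
      EachCut G W k w U' (log ++ log₂) r
  | some F => ∀ U', U ⊆ U' → EachCut G W k w U' log (some F)

variable {U U₁ U₂ : Set (Finset (Option V × Option V))} {log log₁ log₂ : List (Event V)}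
  {res : Option (Finset (V × V))}

theorem covers_empty : Covers G W k w ∅ [] none := by
  intro U' _ log₂ r h
  simpa using h

theorem Covers.union (h₁ : Covers G W k w U₁ log₁ none) (h₂ : Covers G W k w U₂ log₂ res)
    (hd : Disjoint U₁ U₂) : Covers G W k w (U₁ ∪ U₂) (log₁ ++ log₂) res := by
  cases res with
  | none =>
    intro U' hU log₃ r h
    rw [List.append_assoc]
    refine h₁ U' (Set.subset_union_left.trans hU) _ _ (h₂ (U' \ U₁) ?_ _ _ ?_)
    · exact Set.subset_sdiff.mpr ⟨Set.subset_union_right.trans hU, hd.symm⟩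
    · rwa [Set.sdiff_sdiff]
  | some F =>
    intro U' hU
    refine h₁ U' (Set.subset_union_left.trans hU) _ _ (h₂ (U' \ U₁) ?_)
    exact Set.subset_sdiff.mpr ⟨Set.subset_union_right.trans hU, hd.symm⟩

theorem Covers.mono_some {F : Finset (V × V)} (h : Covers G W k w U₁ log (some F))
    (hU : U₁ ⊆ U₂) : Covers G W k w U₂ log (some F) :=
  fun U' hU' => h U' (hU.trans hU')

theorem covers_singleton {S : Finset (Option V × Option V)} {a : List (V × V)}
    (ha : ListsCut G w S a)
    (hr : Run (deleteArcs G a.toFinset) (W.erase w) (k - S.card) log res) :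
    Covers G W k w {S} (.cut a :: log) (res.map (· ∪ a.toFinset)) := by
  cases res with
  | none =>
    intro U' hU log₂ r h
    exact EachCut.next (hU rfl) ha hr h
  | some F =>
    intro U' hU
    exact EachCut.found (hU rfl) ha hr

theorem Covers.eachCut (h : Covers G W k w U log res) : EachCut G W k w U log res := by
  cases res with
  | none =>
    have := h U subset_rfl [] none (by rw [Set.sdiff_self]; exact .done)
    simpa using this
  | some F => exact h U subset_rfl

/-- The while loop may discard the vertices that lie on no cycle in any order. -/
theorem prune_of_list (l : List V) (hl : l.Nodup) {W W' : Finset V} (hW : W' = W \ l.toFinset)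
    (hlW : ∀ w ∈ l, w ∈ W ∧ ¬ OnCycle G w) (hW' : ∀ w ∈ W', OnCycle G w) :
    Prune G W (l.map Event.discard) W' := by
  induction l generalizing W with
  | nil =>
    simp only [List.toFinset_nil, Finset.sdiff_empty] at hW
    subst hW; exact .done hW'
  | cons w l ih =>
    rw [List.nodup_cons] at hl
    refine .step (hlW w (by simp)).1 (hlW w (by simp)).2 (ih hl.2 ?_ ?_)
    · subst hW; ext x; simp; tauto
    · intro x hx
      refine ⟨Finset.mem_erase.mpr ⟨fun h => hl.1 (h ▸ hx), (hlW x (by simp [hx])).1⟩,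
        (hlW x (by simp [hx])).2⟩

end Executions

/-! ### Digraphs in memory -/

section Memory

variable {n m : ℕ} {ar : ℕ → Fin n × Fin n}

/-- The number of a vertex of the expanded graph: `w⁺` has the number `n`. -/
def idx : Option (Fin n) → ℕ
  | none => n
  | some v => v

theorem idx_injective : Function.Injective (idx (n := n)) := by
  intro a b h
  cases a with
  | none => cases b with
    | none => rfl
    | some b => have := b.isLt; simp only [idx] at h; omega
  | some a => cases b with
    | none => have := a.isLt; simp only [idx] at h; omega
    | some b => simp only [idx] at h; rw [Fin.ext h]

theorem idx_lt (v : Option (Fin n)) : idx v < n + 1 := by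
  cases v with
  | none => simp [idx]
  | some v => have := v.isLt; simp only [idx]; omega

theorem exists_idx {i : ℕ} (h : i < n + 1) : ∃ v : Option (Fin n), idx v = i := by
  by_cases hi : i = n
  · exact ⟨none, hi.symm⟩
  · exact ⟨some ⟨i, by omega⟩, rfl⟩

/-- The memory holds the numbers `n`, `m` and `n + m + 1` and the `m` arcs of the input. -/
structure Static (m : ℕ) (ar : ℕ → Fin n × Fin n) (s : Conf) : Prop where
  reg_n : s.reg .n = n
  reg_m : s.reg .m = m
  reg_len : s.reg .len = n + m + 1
  T0 : ∀ e < m, s.mem .T0 e = (ar e).1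
  H0 : ∀ e < m, s.mem .H0 e = (ar e).2

/-- `E` consists of the arcs of the expanded graph whose numbers satisfy `p`. -/
def HoldsArcs (m : ℕ) (ar : ℕ → Fin n × Fin n) (w : Fin n) (p : ℕ → Prop)
    (E : Finset (Option (Fin n) × Option (Fin n))) : Prop :=
  ∀ x, x ∈ E ↔ ∃ e < m, p e ∧ expandArc w (ar e) = x

/-- The vertices in `X` are those with a nonzero mark. -/
def HoldsSet (X : Set (Option (Fin n))) (M : ℕ → ℕ) : Prop := ∀ v, v ∈ X ↔ M (idx v) ≠ 0

/-- The arcs of `G` are those with a nonzero mark. -/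
def HoldsGraph (m : ℕ) (ar : ℕ → Fin n × Fin n) (G : Digraph (Fin n)) (M : ℕ → ℕ) : Prop :=
  ∀ u v, G.Adj u v ↔ ∃ e < m, M e ≠ 0 ∧ ar e = (u, v)

/-- The vertices in `W` are those with a nonzero mark, and `w⁺` is not marked. -/
def HoldsHint (W : Finset (Fin n)) (M : ℕ → ℕ) : Prop := M n = 0 ∧ ∀ v : Fin n, v ∈ W ↔ M v ≠ 0

theorem HoldsHint.holdsSet {W : Finset (Fin n)} {M : ℕ → ℕ} (h : HoldsHint W M) :
    HoldsSet (some '' (W : Set (Fin n))) M := by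
  intro v
  cases v with
  | none => simp [idx, h.1]
  | some v => simp [idx, h.2]

section Transfer

variable {w : Fin n} {C TT H0 : ℕ → ℕ} {E : Finset (Option (Fin n) × Option (Fin n))}

theorem capOf_eq (hinj : ∀ i < m, ∀ j < m, ar i = ar j → i = j)
    (hE : HoldsArcs m ar w (fun e => C e ≠ 0) E)
    (hT : ∀ e < m, TT e = idx (expandArc w (ar e)).1)
    (hH : ∀ e < m, H0 e = idx (expandArc w (ar e)).2) (A : Set ℕ) :
    capOf m C TT H0 A = (boundary E (idx ⁻¹' A)).card := by
  classical
  rw [capOf]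
  refine Finset.card_bij (fun e _ => expandArc w (ar e)) ?_ ?_ ?_
  · intro e he
    simp only [Finset.mem_filter, Finset.mem_range] at he
    rw [hT e he.1, hH e he.1] at he
    exact mem_boundary.mpr ⟨(hE _).mpr ⟨e, he.1, he.2.1, rfl⟩, he.2.2.1, he.2.2.2⟩
  · intro e he f hf h
    simp only [Finset.mem_filter, Finset.mem_range] at he hf
    exact hinj e he.1 f hf.1 (expandArc_injective w h)
  · intro x hx
    obtain ⟨h1, h2, h3⟩ := mem_boundary.mp hx
    obtain ⟨e, he, hc, rfl⟩ := (hE _).mp h1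
    refine ⟨e, ?_, rfl⟩
    simp only [Finset.mem_filter, Finset.mem_range]
    rw [hT e he, hH e he]
    exact ⟨he, hc, h2, h3⟩

theorem separates_iff {X Y : Set (Option (Fin n))} {XM YM : ℕ → ℕ} (hX : HoldsSet X XM)
    (hY : HoldsSet Y YM) (A : Set ℕ) :
    Separates (n + 1) XM YM A ↔ X ⊆ idx ⁻¹' A ∧ Disjoint (idx ⁻¹' A) Y := by
  rw [Set.disjoint_right]
  constructor
  · rintro ⟨h1, h2⟩
    exact ⟨fun v hv => h1 _ (idx_lt v) ((hX v).mp hv), fun v hv => h2 _ (idx_lt v) ((hY v).mp hv)⟩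
  · rintro ⟨h1, h2⟩
    constructor
    · intro i hi hx
      obtain ⟨v, rfl⟩ := exists_idx hi
      exact h1 ((hX v).mpr hx)
    · intro i hi hx
      obtain ⟨v, rfl⟩ := exists_idx hi
      exact h2 ((hY v).mpr hx)

end Transfer

theorem idx_expandArc (w : Fin n) (e : Fin n × Fin n) :
    idx (expandArc w e).1 = (if (e.1 : ℕ) = w then n else e.1) ∧
      idx (expandArc w e).2 = e.2 := by
  constructor
  · simp only [expandArc]
    by_cases h : e.1 = w
    · simp [h, idx]
    · have : (e.1 : ℕ) ≠ w := fun hh => h (Fin.ext hh)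
      simp [h, this, idx]
  · rfl

/-- The specification of the flow computation, in terms of the expanded graph: it finds the furthest
minimum cut, unless this cut has more than `cap` arcs. -/
theorem wp_furthest {P : List Code} {s : Conf} {Q : ℕ → Conf → Prop}
    (hinj : ∀ i < m, ∀ j < m, ar i = ar j → i = j) (hs : Static m ar s) {w : Fin n}
    (hT : ∀ e < m, s.mem .TT e = idx (expandArc w (ar e)).1)
    {E : Finset (Option (Fin n) × Option (Fin n))}
    (hE : HoldsArcs m ar w (fun e => s.mem .C e ≠ 0) E) {X Y : Set (Option (Fin n))}
    (hX : HoldsSet X (s.mem .XM)) (hY : HoldsSet Y (s.mem .YM))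
    (hQ : ∀ t s', Frame maxFlow s s' → t ≤ 80 * (n + m + 1) * (s.reg .cap + 3) →
      ((s.reg .cap < s'.reg .val ∧
        ∀ A, X ⊆ A → Disjoint A Y → s.reg .cap < (boundary E A).card) ∨
      (s'.reg .val ≤ s.reg .cap ∧ ∃ M, Furthest E X Y M ∧ (boundary E M).card = s'.reg .val ∧
        ∀ v, v ∈ M ↔ s'.mem .VIS (idx v) = 0)) → Q t s') :
    WP P maxFlow s Q := by
  have hH : ∀ e < m, s.mem .H0 e = idx (expandArc w (ar e)).2 := fun e he => by
    rw [hs.H0 e he, (idx_expandArc w (ar e)).2]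
  have hcap := capOf_eq hinj hE hT hH
  have hsep := separates_iff hX hY
  have himg : ∀ A : Set (Option (Fin n)), idx ⁻¹' (idx '' A) = A := fun A =>
    Set.preimage_image_eq A idx_injective
  refine wp_maxFlow (N := n + 1) (m := m) (by rw [hs.reg_n]) hs.reg_m
    (fun e he => by rw [hT e he]; exact idx_lt _) (fun e he => by rw [hH e he]; exact idx_lt _) ?_
  intro t s' hf ht hle hor
  refine hQ t s' hf (by rwa [show n + 1 + m = n + m + 1 by omega] at ht) ?_
  have hle' : ∀ A, X ⊆ A → Disjoint A Y → s'.reg .val ≤ (boundary E A).card := by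
    intro A hXA hAY
    have := hle (idx '' A) ((hsep _).mpr (by rw [himg]; exact ⟨hXA, hAY⟩))
    rwa [hcap, himg] at this
  by_cases hval : s.reg .cap < s'.reg .val
  · exact .inl ⟨hval, fun A h1 h2 => hval.trans_le (hle' A h1 h2)⟩
  · right
    obtain ⟨-, h1, h2, h3⟩ := hor.resolve_left fun h => hval h.2
    rw [hcap] at h2
    rw [hsep] at h1
    refine ⟨not_lt.mp hval, _, ⟨h1.1, h1.2, ?_, ?_⟩, h2, ?_⟩
    · intro A hXA hAY; rw [h2]; exact hle' A hXA hAY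
    · intro B hXB hBY hB v hv
      rw [h2] at hB
      exact h3 (idx '' B) ((hsep _).mpr (by rw [himg]; exact ⟨hXB, hBY⟩))
        (by rwa [hcap, himg]) ⟨v, hv, rfl⟩
    · intro v
      simp only [unvisited, Set.mem_preimage, Set.mem_ofPred_eq]
      exact ⟨fun h => h (idx_lt v), fun h _ => h⟩

end Memory

/-! ### Saving and restoring the local state -/

/-- The arrays that hold the saved states. -/
def Arr.isStack : Arr → Bool
  | .SST | .SHF | .SXM | .SK | .SW | .SB | .SE => true
  | _ => false

/-- `s'` agrees with `s` on the input data and on everything that was saved on the stack. -/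
structure Keeps (s s' : Conf) : Prop where
  reg_n : s'.reg .n = s.reg .n
  reg_m : s'.reg .m = s.reg .m
  reg_len : s'.reg .len = s.reg .len
  T0 : s'.mem .T0 = s.mem .T0
  H0 : s'.mem .H0 = s.mem .H0
  sp : s'.reg .sp = s.reg .sp
  stack : ∀ a : Arr, a.isStack = true → ∀ i < s.reg .sp, s'.mem a i = s.mem a i

theorem Keeps.trans {s₁ s₂ s₃ : Conf} (h : Keeps s₁ s₂) (h' : Keeps s₂ s₃) : Keeps s₁ s₃ :=
  ⟨h'.reg_n.trans h.reg_n, h'.reg_m.trans h.reg_m, h'.reg_len.trans h.reg_len, h'.T0.trans h.T0,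
    h'.H0.trans h.H0, h'.sp.trans h.sp,
    fun a ha i hi => (h'.stack a ha i (h.sp ▸ hi)).trans (h.stack a ha i hi)⟩

/-- The command writes neither the input data nor the stack. -/
def Code.quiet (c : Code) : Bool :=
  !(c.wr .n || c.wr .m || c.wr .len || c.wr .sp || c.wa .T0 || c.wa .H0 || c.wa .SST ||
    c.wa .SHF || c.wa .SXM || c.wa .SK || c.wa .SW || c.wa .SB || c.wa .SE)

theorem Frame.keeps {c : Code} {s s' : Conf} (h : Frame c s s') (hc : c.quiet = true) :
    Keeps s s' := by
  simp only [Code.quiet, Bool.not_eq_true', Bool.or_eq_false_iff] at hc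
  obtain ⟨⟨⟨⟨⟨⟨⟨⟨⟨⟨⟨⟨h1, h2⟩, h3⟩, h4⟩, h5⟩, h6⟩, h7⟩, h8⟩, h9⟩, h10⟩, h11⟩, h12⟩, h13⟩ := hc
  refine ⟨h.reg _ h1, h.reg _ h2, h.reg _ h3, h.mem _ h5, h.mem _ h6, h.reg _ h4, ?_⟩
  intro a ha i _
  cases a <;> first
    | exact absurd ha (by decide)
    | exact congrFun (h.mem _ ‹_›) i

theorem Keeps.static {n m : ℕ} {ar : ℕ → Fin n × Fin n} {s s' : Conf} (h : Keeps s s')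
    (hs : Static m ar s) : Static m ar s' :=
  ⟨h.reg_n.trans hs.reg_n, h.reg_m.trans hs.reg_m, h.reg_len.trans hs.reg_len,
    by rw [h.T0]; exact hs.T0, by rw [h.H0]; exact hs.H0⟩

/-- `s'` agrees with `s` also on the local state, whose arrays have length `L`. -/
structure Restored (L : ℕ) (s s' : Conf) : Prop extends Keeps s s' where
  k : s'.reg .k = s.reg .k
  w : s'.reg .w = s.reg .w
  b : s'.reg .b = s.reg .b
  x : s'.reg .x = s.reg .x
  ST : ∀ i < L, s'.mem .ST i = s.mem .ST i
  HF : ∀ i < L, s'.mem .HF i = s.mem .HF i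
  XM : ∀ i < L, s'.mem .XM i = s.mem .XM i

/-- Saves the local state on the stack. Each level of the stack occupies `len` cells, of which the
arrays for the registers use only the first. -/
def pushAll : Code := block [
  fillAt .SST Reg.sp Reg.len 1 (.get .ST Reg.i) 0,
  fillAt .SHF Reg.sp Reg.len 1 (.get .HF Reg.i) 0,
  fillAt .SXM Reg.sp Reg.len 1 (.get .XM Reg.i) 0,
  .set .SK Reg.sp Reg.k, .set .SW Reg.sp Reg.w, .set .SB Reg.sp Reg.b, .set .SE Reg.sp Reg.x,
  .assign .sp (Reg.sp + Reg.len)]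

/-- Restores the local state from the stack. -/
def popAll : Code := block [
  .assign .sp (Reg.sp - Reg.len),
  fill .ST Reg.len 1 (.get .SST ((Reg.sp : Term) + Reg.i)) 0,
  fill .HF Reg.len 1 (.get .SHF ((Reg.sp : Term) + Reg.i)) 0,
  fill .XM Reg.len 1 (.get .SXM ((Reg.sp : Term) + Reg.i)) 0,
  .assign .k (.get .SK Reg.sp), .assign .w (.get .SW Reg.sp), .assign .b (.get .SB Reg.sp),
  .assign .x (.get .SE Reg.sp)]

/-- Runs a command that may destroy the local state. -/
def protect (c : Code) : Code := block [pushAll, c, popAll]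

/-- After a command that keeps the stack, the local state is the original one, and the output, the
register `ret` and the array `RES` are those that the command has produced. -/
theorem wp_protect {P : List Code} {s : Conf} {Q : ℕ → Conf → Prop} {c : Code} {L : ℕ}
    (hlen : s.reg .len = L) (hL : 1 ≤ L)
    (h : ∀ s₁, (∀ r, r ≠ .i → r ≠ .sp → s₁.reg r = s.reg r) → s₁.reg .sp = s.reg .sp + L →
      (∀ a : Arr, a.isStack = false → s₁.mem a = s.mem a) → s₁.out = s.out →
      WP P c s₁ fun t s₂ => Keeps s₁ s₂ ∧ ∀ s₃ t', Restored L s s₃ → s₃.out = s₂.out →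
        s₃.reg .ret = s₂.reg .ret → s₃.mem .RES = s₂.mem .RES → t' ≤ 24 * L + 22 →
        Q (t + t') s₃) :
    WP P (protect c) s Q := by
  simp only [protect, pushAll, wp_block_cons, wp_block_one, wp_set, wp_assign]
  refine wp_fillAt L (s.reg .sp) (fun j => s.mem .ST j) (by simp [hlen]) (by simp) (by simp)
    fun t1 ht1 => ?_
  refine wp_fillAt L (s.reg .sp) (fun j => s.mem .HF j) (by simp [hlen]) (by simp) (by simp)
    fun t2 ht2 => ?_
  refine wp_fillAt L (s.reg .sp) (fun j => s.mem .XM j) (by simp [hlen]) (by simp) (by simp)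
    fun t3 ht3 => ?_
  simp only [Term.eval_reg, Term.eval_add, Conf.reg_setReg, Conf.reg_setMem, reduceCtorEq, if_false]
  set s₁ : Conf := Conf.setReg _ .sp _ with hs₁
  have e1 : ∀ r, r ≠ .i → r ≠ .sp → s₁.reg r = s.reg r := by
    intro r h1 h2; simp [hs₁, h1, h2]
  have e2 : s₁.reg .sp = s.reg .sp + L := by simp [hs₁, hlen]
  have e3 : ∀ a : Arr, a.isStack = false → s₁.mem a = s.mem a := by
    intro a ha
    cases a <;> first | exact absurd ha (by decide) | simp [hs₁]
  have e4 : s₁.out = s.out := by simp [hs₁]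
  have f1 : ∀ j < L, s₁.mem .SST (s.reg .sp + j) = s.mem .ST j := by
    intro j hj; simp [hs₁, hj]
  have f2 : ∀ j < L, s₁.mem .SHF (s.reg .sp + j) = s.mem .HF j := by
    intro j hj; simp [hs₁, hj]
  have f3 : ∀ j < L, s₁.mem .SXM (s.reg .sp + j) = s.mem .XM j := by
    intro j hj; simp [hs₁, hj]
  have f4 : s₁.mem .SK (s.reg .sp) = s.reg .k := by simp [hs₁]
  have f5 : s₁.mem .SW (s.reg .sp) = s.reg .w := by simp [hs₁]
  have f6 : s₁.mem .SB (s.reg .sp) = s.reg .b := by simp [hs₁]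
  have f7 : s₁.mem .SE (s.reg .sp) = s.reg .x := by simp [hs₁]
  have f8 : ∀ a : Arr, a.isStack = true → ∀ i < s.reg .sp, s₁.mem a i = s.mem a i := by
    intro a ha i hi
    cases a <;> first
      | exact absurd ha (by decide)
      | simp [hs₁, hi.ne, not_le.mpr hi, update_of_ne]
  clear_value s₁
  refine (h s₁ e1 e2 e3 e4).mono ?_
  rintro t4 s₂ ⟨hk, hQ⟩
  have g0 : s₂.reg .len = L := by rw [hk.reg_len, e1 _ (by decide) (by decide), hlen]
  have g1 : s₂.reg .sp - L = s.reg .sp := by rw [hk.sp, e2]; omega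
  have g2 : ∀ a : Arr, a.isStack = true → ∀ j < L,
      s₂.mem a (s.reg .sp + j) = s₁.mem a (s.reg .sp + j) :=
    fun a ha j hj => hk.stack a ha _ (by omega)
  have g3 : ∀ a : Arr, a.isStack = true → s₂.mem a (s.reg .sp) = s₁.mem a (s.reg .sp) :=
    fun a ha => by simpa using g2 a ha 0 hL
  simp only [popAll, wp_block_cons, wp_block_one, wp_assign, Term.eval_sub, Term.eval_reg, g0, g1]
  refine wp_fill L (s.mem .ST) (by simp [g0]) ?_ fun t5 ht5 => ?_
  · intro j hj M _; simp [g2 .SST rfl j hj, f1 j hj]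
  refine wp_fill L (s.mem .HF) (by simp [g0]) ?_ fun t6 ht6 => ?_
  · intro j hj M _; simp [g2 .SHF rfl j hj, f2 j hj]
  refine wp_fill L (s.mem .XM) (by simp [g0]) ?_ fun t7 ht7 => ?_
  · intro j hj M _; simp [g2 .SXM rfl j hj, f3 j hj]
  simp only [Term.eval_get, Term.eval_reg, Conf.reg_setReg, Conf.reg_setMem, Conf.mem_setReg,
    Conf.mem_setMem, reduceCtorEq, if_false, if_true, g3 .SK rfl, g3 .SW rfl, g3 .SB rfl, g3 .SE rfl,
    f4, f5, f6, f7]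
  have key := hQ (((((((((((s₂.setReg .sp (s.reg .sp)).setReg .i L).setMem .ST
      fun x => if x < L then s.mem .ST x else s₂.mem .ST x).setReg .i L).setMem .HF
      fun x => if x < L then s.mem .HF x else s₂.mem .HF x).setReg .i L).setMem .XM
      fun x => if x < L then s.mem .XM x else s₂.mem .XM x).setReg .k (s.reg .k)).setReg .w
      (s.reg .w)).setReg .b (s.reg .b)).setReg .x (s.reg .x))
    (t1 + t2 + t3 + t5 + t6 + t7 + 10) ?_ (by simp) (by simp) (by simp) (by omega)
  · convert key using 1; omega
  · refine ⟨⟨?_, ?_, ?_, ?_, ?_, ?_, ?_⟩, ?_, ?_, ?_, ?_, ?_, ?_, ?_⟩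
    · simp [hk.reg_n, e1]
    · simp [hk.reg_m, e1]
    · simp [hk.reg_len, e1]
    · simp [hk.T0, e3 .T0 rfl]
    · simp [hk.H0, e3 .H0 rfl]
    · simp
    · intro a ha i hi
      rw [← f8 a ha i hi, ← hk.stack a ha i (by omega)]
      cases a <;> first | exact absurd ha (by decide) | simp
    · simp
    · simp
    · simp
    · simp
    · intro i hi; simp [hi]
    · intro i hi; simp [hi]
    · intro i hi; simp [hi]

section Enumeration

variable {n m : ℕ} {ar : ℕ → Fin n × Fin n} {P : List Code}

/-! ### Lists of arcs -/

/-- The arcs whose numbers satisfy `p`, as a list. -/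
def arcList (m : ℕ) (ar : ℕ → Fin n × Fin n) (p : ℕ → Prop) [DecidablePred p] :
    List (Fin n × Fin n) :=
  ((List.range m).filter fun e => p e).map ar

theorem mem_arcList {p : ℕ → Prop} [DecidablePred p] {x : Fin n × Fin n} :
    x ∈ arcList m ar p ↔ ∃ e < m, p e ∧ ar e = x := by
  simp [arcList, and_assoc]

theorem nodup_arcList (hinj : ∀ i < m, ∀ j < m, ar i = ar j → i = j) (p : ℕ → Prop)
    [DecidablePred p] : (arcList m ar p).Nodup := by
  refine List.Nodup.map_on ?_ (List.nodup_range.filter _)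
  intro i hi j hj h
  simp only [List.mem_filter, List.mem_range] at hi hj
  exact hinj i hi.1 j hj.1 h

theorem encodeArcs_arcList (p : ℕ → Prop) [DecidablePred p] : encodeArcs (arcList m ar p) =
    ((List.range m).filter fun e => p e).flatMap fun e => [((ar e).1 : ℕ), ((ar e).2 : ℕ)] := by
  simp [encodeArcs, arcList, List.flatMap_map]

theorem listsCut_arcList (hinj : ∀ i < m, ∀ j < m, ar i = ar j → i = j) {G : Digraph (Fin n)}
    {ST : ℕ → ℕ} (hG : HoldsGraph m ar G ST) {w : Fin n}
    {D : Finset (Option (Fin n) × Option (Fin n))}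
    (hD : HoldsArcs m ar w (fun e => ST e = 2) D) :
    ListsCut G w D (arcList m ar fun e => ST e = 2) := by
  refine ⟨nodup_arcList hinj _, fun x => ?_⟩
  rw [mem_arcList, hD, hG]
  constructor
  · rintro ⟨e, he, h1, rfl⟩
    exact ⟨⟨e, he, by omega, rfl⟩, e, he, h1, rfl⟩
  · rintro ⟨-, e, he, h1, h2⟩
    exact ⟨e, he, h1, expandArc_injective w h2⟩

/-- Writes the number of the arcs that satisfy a condition, followed by these arcs. -/
def emitArcs (c : Term) : Code :=
  block [count Reg.m c, .emit Reg.cnt, emitPairs Reg.m c (.get .T0 Reg.i) (.get .H0 Reg.i)]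

theorem wp_emitArcs {s : Conf} {Q : ℕ → Conf → Prop} {c : Term} (hs : Static m ar s)
    (p : ℕ → Prop) [DecidablePred p]
    (hc : ∀ j < m, ∀ s₁ : Conf, s₁.mem = s.mem → s₁.reg .i = j → (c.eval s₁ ≠ 0 ↔ p j))
    (hQ : ∀ t s', Frame (emitArcs c) s s' → t ≤ 9 * m + 6 →
      s'.out = s.out ++ (arcList m ar p).length :: encodeArcs (arcList m ar p) → Q t s') :
    WP P (emitArcs c) s Q := by
  suffices h : WP P (emitArcs c) s fun t s' => t ≤ 9 * m + 6 ∧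
      s'.out = s.out ++ (arcList m ar p).length :: encodeArcs (arcList m ar p) by
    refine h.frame.mono ?_
    rintro t s' ⟨hf, h1, h2⟩
    exact hQ t s' hf h1 h2
  simp only [emitArcs, wp_block_cons, wp_block_one, wp_emit]
  refine wp_count m p (by simp [hs.reg_m]) ?_ fun t1 ht1 => ?_
  · intro j hj y; exact hc j hj _ rfl (by simp)
  refine wp_emitPairs m p (fun e => (ar e).1) (fun e => (ar e).2) (by simp [hs.reg_m])
    ?_ ?_ ?_ fun t2 ht2 => ?_
  · intro j hj y; exact hc j hj _ rfl (by simp)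
  · intro j hj y; simp [hs.T0 j hj]
  · intro j hj y; simp [hs.H0 j hj]
  · refine ⟨by omega, ?_⟩
    rw [encodeArcs_arcList]
    simp [arcList]

/-! ### Nodes of the enumeration tree in memory -/

/-- The registers and arrays hold a node `(X, D)` of the enumeration tree for `w`: `ST e` is `0` for
deleted arcs, `2` for the arcs in `D` and `1` for the other arcs of the current digraph. -/
structure NodeMem (m : ℕ) (ar : ℕ → Fin n × Fin n) (G : Digraph (Fin n)) (W : Finset (Fin n))
    (k : ℕ) (w : Fin n) (E : Finset (Option (Fin n) × Option (Fin n))) (s : Conf)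
    (X : Set (Option (Fin n))) (D : Finset (Option (Fin n) × Option (Fin n))) (b : ℕ) : Prop where
  static : Static m ar s
  st_le : ∀ e < m, s.mem .ST e ≤ 2
  arcs : HoldsArcs m ar w (fun e => s.mem .ST e ≠ 0) E
  chosen : HoldsArcs m ar w (fun e => s.mem .ST e = 2) D
  graph : HoldsGraph m ar G (s.mem .ST)
  hint : HoldsHint W (s.mem .HF)
  src : HoldsSet X (s.mem .XM)
  reg_k : s.reg .k = k
  reg_w : s.reg .w = w
  reg_b : s.reg .b = b

/-- The result register and the result flags represent the value returned by a call. -/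
def ResultOk (m : ℕ) (ar : ℕ → Fin n × Fin n) (s : Conf) : Option (Finset (Fin n × Fin n)) → Prop
  | none => s.reg .ret = 0
  | some F => s.reg .ret ≠ 0 ∧ ∀ x, x ∈ F ↔ ∃ e < m, s.mem .RES e ≠ 0 ∧ ar e = x

/-- The outcome of an enumeration that starts in `s`, treats the cuts in `U` and takes time at most
`τ`. -/
def Enumerates (m : ℕ) (ar : ℕ → Fin n × Fin n) (G : Digraph (Fin n)) (W : Finset (Fin n)) (k : ℕ)
    (w : Fin n) (s : Conf) (U : Set (Finset (Option (Fin n) × Option (Fin n)))) (τ : ℝ) (t : ℕ)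
    (s' : Conf) : Prop :=
  ∃ log res, Keeps s s' ∧ s'.out = s.out ++ log.flatMap Event.encode ∧ Covers G W k w U log res ∧
    ResultOk m ar s' res ∧ (t : ℝ) ≤ τ

theorem HoldsArcs.congr {w : Fin n} {p q : ℕ → Prop}
    {E : Finset (Option (Fin n) × Option (Fin n))}
    (h : HoldsArcs m ar w p E) (hpq : ∀ e < m, p e ↔ q e) : HoldsArcs m ar w q E := by
  intro x
  rw [h]
  exact exists_congr fun e => and_congr_right fun he => and_congr_left fun _ => hpq e he

theorem HoldsGraph.congr {G : Digraph (Fin n)} {M M' : ℕ → ℕ} (h : HoldsGraph m ar G M)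
    (hM : ∀ e < m, M' e ≠ 0 ↔ M e ≠ 0) : HoldsGraph m ar G M' := by
  intro u v
  rw [h]
  exact exists_congr fun e => and_congr_right fun he => and_congr_left fun _ => (hM e he).symm

theorem HoldsHint.congr {W : Finset (Fin n)} {M M' : ℕ → ℕ} (h : HoldsHint W M)
    (hM : ∀ i < n + 1, M' i = M i) : HoldsHint W M' :=
  ⟨(hM n (by omega)).trans h.1, fun v => by
    have := v.isLt
    rw [h.2, hM v (by omega)]⟩

theorem HoldsSet.congr {X : Set (Option (Fin n))} {M M' : ℕ → ℕ} (h : HoldsSet X M)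
    (hM : ∀ i < n + 1, M' i = M i) : HoldsSet X M' := by
  intro v; rw [h, hM _ (idx_lt v)]

namespace NodeMem

variable {G : Digraph (Fin n)} {W : Finset (Fin n)} {k : ℕ} {w : Fin n}
  {E D : Finset (Option (Fin n) × Option (Fin n))} {s s' : Conf} {X : Set (Option (Fin n))} {b : ℕ}

theorem congr (h : NodeMem m ar G W k w E s X D b) (hk : Keeps s s')
    (h1 : s'.reg .k = s.reg .k) (h2 : s'.reg .w = s.reg .w) (h3 : s'.reg .b = s.reg .b)
    (h4 : ∀ i < n + m + 1, s'.mem .ST i = s.mem .ST i)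
    (h5 : ∀ i < n + m + 1, s'.mem .HF i = s.mem .HF i)
    (h6 : ∀ i < n + m + 1, s'.mem .XM i = s.mem .XM i) : NodeMem m ar G W k w E s' X D b where
  static := hk.static h.static
  st_le e he := by rw [h4 e (by omega)]; exact h.st_le e he
  arcs := h.arcs.congr fun e he => by rw [h4 e (by omega)]
  chosen := h.chosen.congr fun e he => by rw [h4 e (by omega)]
  graph := h.graph.congr fun e he => by rw [h4 e (by omega)]
  hint := h.hint.congr fun i hi => h5 i (by omega)
  src := h.src.congr fun i hi => h6 i (by omega)
  reg_k := h1.trans h.reg_k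
  reg_w := h2.trans h.reg_w
  reg_b := h3.trans h.reg_b

theorem restored (h : NodeMem m ar G W k w E s X D b) (hr : Restored (n + m + 1) s s') :
    NodeMem m ar G W k w E s' X D b :=
  h.congr hr.toKeeps hr.k hr.w hr.b hr.ST hr.HF hr.XM

theorem frame (h : NodeMem m ar G W k w E s X D b) {c : Code} (hf : Frame c s s')
    (hc : (c.quiet && !(c.wr .k || c.wr .w || c.wr .b || c.wa .ST || c.wa .HF || c.wa .XM)) = true) :
    NodeMem m ar G W k w E s' X D b := by
  simp only [Bool.and_eq_true, Bool.not_eq_true', Bool.or_eq_false_iff] at hc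
  obtain ⟨h0, ⟨⟨⟨⟨h1, h2⟩, h3⟩, h4⟩, h5⟩, h6⟩ := hc
  exact h.congr (hf.keeps h0) (hf.reg _ h1) (hf.reg _ h2) (hf.reg _ h3)
    (fun i _ => congrFun (hf.mem _ h4) i) (fun i _ => congrFun (hf.mem _ h5) i)
    (fun i _ => congrFun (hf.mem _ h6) i)

/-- The local state is still in place after it has been saved. -/
theorem saved (h : NodeMem m ar G W k w E s X D b)
    (h1 : ∀ r, r ≠ .i → r ≠ .sp → s'.reg r = s.reg r)
    (h2 : ∀ a : Arr, a.isStack = false → s'.mem a = s.mem a) : NodeMem m ar G W k w E s' X D b where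
  static := ⟨(h1 _ (by decide) (by decide)).trans h.static.reg_n,
    (h1 _ (by decide) (by decide)).trans h.static.reg_m,
    (h1 _ (by decide) (by decide)).trans h.static.reg_len,
    by rw [h2 _ rfl]; exact h.static.T0, by rw [h2 _ rfl]; exact h.static.H0⟩
  st_le := by rw [h2 _ rfl]; exact h.st_le
  arcs := by rw [h2 _ rfl]; exact h.arcs
  chosen := by rw [h2 _ rfl]; exact h.chosen
  graph := by rw [h2 _ rfl]; exact h.graph
  hint := by rw [h2 _ rfl]; exact h.hint
  src := by rw [h2 _ rfl]; exact h.src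
  reg_k := (h1 _ (by decide) (by decide)).trans h.reg_k
  reg_w := (h1 _ (by decide) (by decide)).trans h.reg_w
  reg_b := (h1 _ (by decide) (by decide)).trans h.reg_b

/-- The arcs that are neither deleted nor chosen. -/
theorem alive (h : NodeMem m ar G W k w E s X D b)
    (hinj : ∀ i < m, ∀ j < m, ar i = ar j → i = j) :
    HoldsArcs m ar w (fun e => s.mem .ST e = 1) (E \ D) := by
  intro x
  rw [Finset.mem_sdiff, h.arcs, h.chosen]
  constructor
  · rintro ⟨⟨e, he, h1, rfl⟩, h2⟩
    have := h.st_le e he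
    have h3 : s.mem .ST e ≠ 2 := fun h3 => h2 ⟨e, he, h3, rfl⟩
    exact ⟨e, he, by omega, rfl⟩
  · rintro ⟨e, he, h1, rfl⟩
    refine ⟨⟨e, he, by omega, rfl⟩, ?_⟩
    rintro ⟨e', he', h2, h3⟩
    have := hinj e' he' e he (expandArc_injective w h3)
    subst this; omega

end NodeMem

/-! ### The program for the enumeration -/

/-- Prepares the flow computation at a node of the enumeration tree. -/
def nodeSetup : Code := block [
  fill .TT Reg.m (.eq (.get .T0 Reg.i) Reg.w) Reg.n (.get .T0 Reg.i),
  fill .C Reg.m (.eq (.get .ST Reg.i) 1) 1 0,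
  fill .YM (Reg.n + 1) (.get .HF Reg.i) 1 0,
  .assign .cap Reg.b]

/-- Reports the chosen arcs as a cut. -/
def emitCut : Code := .seq (.emit 2) (emitArcs (.eq (.get .ST Reg.i) 2))

/-- Deletes the chosen arcs and the vertex `w` from the current instance. -/
def descend : Code := block [
  fill .ST Reg.m (.eq (.get .ST Reg.i) 1) 1 0,
  .set .HF Reg.w 0,
  .assign .k Reg.b]

/-- Reports the chosen arcs as a cut, calls the algorithm recursively, and adds the chosen arcs to
the result if there is one. -/
def reportCut : Code := block [
  emitCut,
  protect (.seq descend (.call 0)),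
  .ite Reg.ret (fill .RES Reg.m (.eq (.get .ST Reg.i) 2) 1 (.get .RES Reg.i)) .skip]

/-- At a leaf, checks whether the chosen arcs form an important cut: their heads must not be in `XM`,
and `XM` must contain its furthest minimum cut in the digraph with the chosen arcs. -/
def enumLeaf : Code := block [
  find Reg.m (.and (.eq (.get .ST Reg.i) 2) (.get .XM (.get .H0 Reg.i))),
  .ite Reg.x (.assign .ret 0) (block [
    fill .C Reg.m (.get .ST Reg.i) 1 0,
    .assign .cap ((Reg.k : Term) - Reg.b),
    maxFlow,
    find (Reg.n + 1) (.and (.not (.get .VIS Reg.i)) (.not (.get .XM Reg.i))),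
    .ite Reg.x (.assign .ret 0) reportCut])]

/-- At an inner node, branches on an arc that leaves the furthest minimum cut: first it is chosen
for the cut, then its head is added to the sources. -/
def enumBranch : Code := block [
  find Reg.m (.and (.eq (.get .ST Reg.i) 1)
    (.and (.get .XM (.get .TT Reg.i)) (.not (.get .XM (.get .H0 Reg.i))))),
  protect (.seq (block [.set .ST (Reg.x - 1) 2, .assign .b (Reg.b - 1)]) (.call 1)),
  .ite Reg.ret .skip (block [
    .assign .v (.get .H0 (Reg.x - 1)),
    .ite (.get .HF Reg.v) .skip (block [.set .XM Reg.v 1, .call 1])])]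

/-- The procedure for the enumeration of the important cuts below a node. The furthest minimum cut
replaces the set of sources; if it is empty, the node is a leaf. -/
def enumBody : Code := block [
  nodeSetup,
  maxFlow,
  .ite ((Reg.val : Term) - Reg.cap) (.assign .ret 0) (block [
    fill .XM (Reg.n + 1) (.get .VIS Reg.i) 0 1,
    .ite Reg.val enumBranch enumLeaf])]

/-- The registers and arrays hold the instance `(G, W, k)`. -/
structure InstanceMem (m : ℕ) (ar : ℕ → Fin n × Fin n) (G : Digraph (Fin n)) (W : Finset (Fin n))
    (k : ℕ) (s : Conf) : Prop where
  static : Static m ar s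
  st_le : ∀ e < m, s.mem .ST e ≤ 1
  graph : HoldsGraph m ar G (s.mem .ST)
  hint : HoldsHint W (s.mem .HF)
  reg_k : s.reg .k = k

/-- The specification of the recursive algorithm, for hints with at most `q` vertices: a call
executes the algorithm, keeps the data of the caller and takes time at most `T k`. -/
def DfasSpec (P : List Code) (m : ℕ) (ar : ℕ → Fin n × Fin n) (q : ℕ) (T : ℕ → ℝ) : Prop :=
  ∀ (s : Conf) (G : Digraph (Fin n)) (W : Finset (Fin n)) (k : ℕ), InstanceMem m ar G W k s →
    IsDFVS G W → W.card ≤ q → k + 1 ≤ q →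
    WP P (.call 0) s fun t s' => ∃ log res, Keeps s s' ∧
      s'.out = s.out ++ log.flatMap Event.encode ∧ Run G W k log res ∧ ResultOk m ar s' res ∧
      (t : ℝ) ≤ T k

section Spec

variable {G : Digraph (Fin n)} {W : Finset (Fin n)} {k : ℕ} {w : Fin n}
  {E D : Finset (Option (Fin n) × Option (Fin n))} {s : Conf} {X M : Set (Option (Fin n))} {b q : ℕ}
  {T : ℕ → ℝ}

/-- The flow computation is set up for the expanded graph without the deleted and the chosen arcs; the
targets are the hint vertices, where `w` stands for `w⁻`. -/
theorem wp_nodeSetup {Q : ℕ → Conf → Prop} (hinj : ∀ i < m, ∀ j < m, ar i = ar j → i = j)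
    (h : NodeMem m ar G W k w E s X D b)
    (hQ : ∀ t s', Frame nodeSetup s s' → t ≤ 8 * m + 4 * n + 11 → s'.reg .cap = b →
      (∀ e < m, s'.mem .TT e = idx (expandArc w (ar e)).1) →
      HoldsArcs m ar w (fun e => s'.mem .C e ≠ 0) (E \ D) →
      HoldsSet (some '' (W : Set (Fin n))) (s'.mem .YM) → Q t s') :
    WP P nodeSetup s Q := by
  suffices h : WP P nodeSetup s fun t s' => t ≤ 8 * m + 4 * n + 11 ∧ s'.reg .cap = b ∧
      (∀ e < m, s'.mem .TT e = idx (expandArc w (ar e)).1) ∧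
      HoldsArcs m ar w (fun e => s'.mem .C e ≠ 0) (E \ D) ∧
      HoldsSet (some '' (W : Set (Fin n))) (s'.mem .YM) by
    refine h.frame.mono ?_
    rintro t s' ⟨hf, h1, h2, h3, h4, h5⟩
    exact hQ t s' hf h1 h2 h3 h4 h5
  simp only [nodeSetup, wp_block_cons, wp_block_one, wp_assign]
  have hst := h.static
  refine wp_fill m (fun e => idx (expandArc w (ar e)).1) (by simp [hst.reg_m]) ?_ fun t1 ht1 => ?_
  · intro j hj M' _
    simp [hst.T0 j hj, h.reg_w, hst.reg_n, (idx_expandArc w (ar j)).1]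
  refine wp_fill m (fun e => if s.mem .ST e = 1 then 1 else 0) (by simp [hst.reg_m]) (by simp)
    fun t2 ht2 => ?_
  refine wp_fill (n + 1) (fun v => if s.mem .HF v ≠ 0 then 1 else 0) (by simp [hst.reg_n]) (by simp)
    fun t3 ht3 => ?_
  refine ⟨by omega, by simp [h.reg_b], ?_, ?_, ?_⟩
  · intro e he; simp [he]
  · refine (h.alive hinj).congr fun e he => ?_
    simp [he]
  · intro v
    rw [h.hint.holdsSet v]
    have := idx_lt v
    simp [show idx v ≤ n by omega]

theorem wp_emitCut {Q : ℕ → Conf → Prop} (h : NodeMem m ar G W k w E s X D b)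
    (hQ : ∀ t s', Frame emitCut s s' → t ≤ 9 * m + 7 →
      s'.out = s.out ++ (Event.cut (arcList m ar fun e => s.mem .ST e = 2)).encode → Q t s') :
    WP P emitCut s Q := by
  suffices h : WP P emitCut s fun t s' => t ≤ 9 * m + 7 ∧
      s'.out = s.out ++ (Event.cut (arcList m ar fun e => s.mem .ST e = 2)).encode by
    refine h.frame.mono ?_
    rintro t s' ⟨hf, h1, h2⟩
    exact hQ t s' hf h1 h2
  simp only [emitCut, wp_seq, wp_emit]
  refine wp_emitArcs (m := m) (ar := ar) ?_ (fun e => s.mem .ST e = 2) ?_ ?_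
  · exact ⟨h.static.1, h.static.2, h.static.3, h.static.4, h.static.5⟩
  · intro j hj s₁ hs₁ hi
    simp [hs₁, hi]
  · intro t s' hf ht hout
    refine ⟨by omega, ?_⟩
    rw [hout]
    simp [Event.encode]

theorem wp_descend {Q : ℕ → Conf → Prop} (hs : Static m ar s)
    (hQ : ∀ t s', Frame descend s s' → t ≤ 4 * m + 4 →
      (∀ e < m, s'.mem .ST e = if s.mem .ST e = 1 then 1 else 0) →
      s'.mem .HF = update (s.mem .HF) (s.reg .w) 0 → s'.reg .k = s.reg .b → Q t s') :
    WP P descend s Q := by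
  suffices h : WP P descend s fun t s' => t ≤ 4 * m + 4 ∧
      (∀ e < m, s'.mem .ST e = if s.mem .ST e = 1 then 1 else 0) ∧
      s'.mem .HF = update (s.mem .HF) (s.reg .w) 0 ∧ s'.reg .k = s.reg .b by
    refine h.frame.mono ?_
    rintro t s' ⟨hf, h1, h2, h3, h4⟩
    exact hQ t s' hf h1 h2 h3 h4
  simp only [descend, wp_block_cons, wp_block_one, wp_assign, wp_set]
  refine wp_fill m (fun e => if s.mem .ST e = 1 then 1 else 0) (by simp [hs.reg_m]) ?_
    fun t1 ht1 => ?_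
  · intro j hj M hM; simp [hM]
  refine ⟨by omega, ?_, by simp, by simp⟩
  intro e he; simp [he]

/-- Reporting the cut `D` and calling the algorithm recursively treats exactly the cut `D`. The vertex
`w` may be dropped from the hint because `D` cuts all cycles through `w`. -/
theorem wp_reportCut (hinj : ∀ i < m, ∀ j < m, ar i = ar j → i = j)
    (hS : DfasSpec P m ar q T) (hw : w ∈ W) (hdf : IsDFVS G W) (hWq : W.card ≤ q + 1)
    (hkq : k ≤ q) (h : NodeMem m ar G W k w E s X D b) (hb : D.card + b = k) (hD1 : 1 ≤ D.card)
    (himp : ImportantSet E {none} (some '' (W : Set (Fin n))) M) (hDM : boundary E M = D) :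
    WP P reportCut s
      (Enumerates m ar G W k w s {D} (60 * ((n + m + 1 : ℕ) : ℝ) + T b)) := by
  have hcut : ListsCut G w D (arcList m ar fun e => s.mem .ST e = 2) :=
    listsCut_arcList hinj h.graph h.chosen
  rw [reportCut, wp_block_cons]
  refine wp_emitCut h fun t1 s₁ hf1 ht1 hout1 => ?_
  have h1 : NodeMem m ar G W k w E s₁ X D b := h.frame hf1 rfl
  have hST1 : s₁.mem .ST = s.mem .ST := hf1.mem _ rfl
  set a := arcList m ar fun e => s.mem .ST e = 2 with ha
  rw [wp_block_cons]
  refine wp_protect h1.static.reg_len (by omega) fun s₂ g1 g2 g3 g4 => ?_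
  rw [wp_seq]
  have hst2 : Static m ar s₂ := (h1.saved g1 g3).static
  refine wp_descend hst2 fun t2 s₃ hf2 ht2 hST3 hHF3 hk3 => ?_
  have hk23 : Keeps s₂ s₃ := hf2.keeps rfl
  have hST3' : ∀ e < m, s₃.mem .ST e = if s₁.mem .ST e = 1 then 1 else 0 := by
    intro e he; rw [hST3 e he, g3 _ rfl]
  have hG' : HoldsGraph m ar (deleteArcs G a.toFinset) (s₃.mem .ST) := by
    intro u v
    simp only [deleteArcs, List.mem_toFinset, ha, mem_arcList, h1.graph u v]
    constructor
    · rintro ⟨⟨e, he, h2, h3⟩, h4⟩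
      have h5 := h1.st_le e he
      have h6 : s₁.mem .ST e ≠ 2 := fun h6 => h4 ⟨e, he, by rwa [hST1] at h6, h3⟩
      exact ⟨e, he, by rw [hST3' e he, if_pos (by omega)]; decide, h3⟩
    · rintro ⟨e, he, h2, h3⟩
      have h5 : s₁.mem .ST e = 1 := by
        by_contra h5; rw [hST3' e he, if_neg h5] at h2; exact h2 rfl
      refine ⟨⟨e, he, by omega, h3⟩, ?_⟩
      rintro ⟨e', he', h6, h7⟩
      have := hinj e' he' e he (h7.trans h3.symm)
      subst this
      rw [← hST1] at h6; omega
  have hW' : HoldsHint (W.erase w) (s₃.mem .HF) := by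
    rw [hHF3, g3 _ rfl, g1 _ (by decide) (by decide), h1.reg_w]
    refine ⟨?_, fun v => ?_⟩
    · rw [update_of_ne (by have := w.isLt; omega)]; exact h1.hint.1
    · rw [Finset.mem_erase, h1.hint.2 v]
      by_cases hv : v = w
      · subst hv; simp
      · rw [update_of_ne (fun hh => hv (Fin.ext hh))]; simp [hv]
  have hdf' : IsDFVS (deleteArcs G a.toFinset) (W.erase w) := by
    refine hdf.mono (fun u v huv => huv.1) fun x hx hx' => ?_
    have hxw : x = w := by by_contra hne; exact hx' (Finset.mem_erase.mpr ⟨hne, hx⟩)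
    subst hxw
    refine not_onCycle_of_boundary (E := E) (M := M) ?_ ?_ ?_
    · exact himp.sub rfl
    · exact fun hM => Set.disjoint_left.mp himp.disj hM ⟨x, hx, rfl⟩
    · intro u v huv
      have h3 : expandArc x (u, v) ∈ E := by
        obtain ⟨e, he, h4, h5⟩ := (h1.graph u v).mp huv.1
        exact (h1.arcs _).mpr ⟨e, he, h4, by rw [h5]⟩
      refine ⟨h3, fun h4 => huv.2 ?_⟩
      rw [hDM] at h4
      exact List.mem_toFinset.mpr ((hcut.2 (u, v)).mpr ⟨huv.1, h4⟩)
  have hcard : (W.erase w).card + 1 = W.card := Finset.card_erase_add_one hw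
  refine (hS s₃ _ _ b ⟨hk23.static hst2, ?_, hG', hW', ?_⟩ hdf' (by omega) (by omega)).mono ?_
  · intro e he; rw [hST3' e he]; split <;> omega
  · rw [hk3, g1 _ (by decide) (by decide), h1.reg_b]
  rintro t3 s₄ ⟨log, res, hk34, hout4, hrun, hres, ht3⟩
  refine ⟨hk23.trans hk34, fun s₅ t4 hr hout5 hret5 hRES5 ht4 => ?_⟩
  have hk5 : Keeps s s₅ := (hf1.keeps rfl).trans hr.toKeeps
  have hout : s₅.out = s.out ++ (Event.cut a :: log).flatMap Event.encode := by
    rw [hout5, hout4, hf2.out rfl, g4, hout1]; simp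
  have hcov := covers_singleton (w := w) (W := W) (k := k) (log := log) (res := res) hcut
    (by rwa [show k - D.card = b by omega])
  have hb1 : ((t1 : ℝ) + (t2 + t4 + 4 * m + 3)) ≤ 60 * ((n + m + 1 : ℕ) : ℝ) := by
    have : t1 + (t2 + t4 + 4 * m + 3) ≤ 60 * (n + m + 1) := by omega
    exact_mod_cast this
  have hres5 : ResultOk m ar s₅ res := by
    cases res with
    | none => exact hret5.trans hres
    | some F => exact ⟨by rw [hret5]; exact hres.1, by rw [hRES5]; exact hres.2⟩
  rw [wp_block_one]
  refine wp_ite (fun hret => ?_) (fun hret => ?_)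
  · rw [Term.eval_reg] at hret
    cases res with
    | none => exact absurd hres5 hret
    | some F =>
      have hST5 : ∀ e < m, s₅.mem .ST e = s.mem .ST e := fun e he => by
        rw [hr.ST e (by omega), hST1]
      have key : WP P (fill .RES Reg.m (.eq (.get .ST Reg.i) 2) 1 (.get .RES Reg.i)) s₅
          fun t s₆ => t ≤ 4 * m + 2 ∧ ResultOk m ar s₆ (some (F ∪ a.toFinset)) := by
        refine wp_fill m (fun e => if s.mem .ST e = 2 then 1 else s₅.mem .RES e)
          (by simp [(hk5.static h.static).reg_m]) ?_ fun t5 ht5 => ?_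
        · intro j hj M' hM; simp [hM, hST5 j hj]
        · refine ⟨ht5, by simpa using hret, fun x => ?_⟩
          rw [Finset.mem_union, List.mem_toFinset, hres5.2, ha, mem_arcList]
          constructor
          · rintro (⟨e, he, h3, h4⟩ | ⟨e, he, h3, h4⟩)
            · refine ⟨e, he, ?_, h4⟩
              simp only [Conf.mem_setMem, if_true, he]
              split <;> simp [h3]
            · exact ⟨e, he, by simp [he, h3], h4⟩
          · rintro ⟨e, he, h3, h4⟩
            simp only [Conf.mem_setMem, if_true, he] at h3
            by_cases h5 : s.mem .ST e = 2
            · exact .inr ⟨e, he, h5, h4⟩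
            · rw [if_neg h5] at h3; exact .inl ⟨e, he, h3, h4⟩
      refine key.frame.mono ?_
      rintro t5 s₆ ⟨hf6, ht5, hres6⟩
      refine ⟨_, _, hk5.trans (hf6.keeps rfl), (hf6.out rfl).trans hout, hcov, hres6, ?_⟩
      have : (t5 : ℝ) ≤ 4 * m + 2 := by exact_mod_cast ht5
      push_cast at hb1 ⊢; linarith
  · rw [Term.eval_reg] at hret
    rw [wp_skip]
    cases res with
    | none =>
      refine ⟨_, _, hk5, hout, hcov, hret, ?_⟩
      push_cast at hb1 ⊢
      have : (0 : ℝ) ≤ m := by positivity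
      linarith
    | some F => exact absurd hret hres5.1

end Spec

end Enumeration

/-! ### The correctness and the running time of the enumeration -/

section EnumSpec

variable {n m : ℕ} {ar : ℕ → Fin n × Fin n} {P : List Code} {G : Digraph (Fin n)}
  {W : Finset (Fin n)} {k : ℕ} {w : Fin n} {E D : Finset (Option (Fin n) × Option (Fin n))}
  {s s₀ : Conf} {X M : Set (Option (Fin n))} {b q : ℕ} {T : ℕ → ℝ} {Λ κ z : ℝ}

theorem Enumerates.mono {U U' : Set (Finset (Option (Fin n) × Option (Fin n)))} {τ τ' : ℝ}
    {t t' : ℕ} {s₁ s' : Conf} (h : Enumerates m ar G W k w s₁ U τ t s') (hk : Keeps s s₁)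
    (hout : s₁.out = s.out) (hU : U = U') (ht : (t' : ℝ) ≤ τ' - τ + t) :
    Enumerates m ar G W k w s U' τ' t' s' := by
  obtain ⟨log, res, h1, h2, h3, h4, h5⟩ := h
  exact ⟨log, res, hk.trans h1, by rw [h2, hout], hU ▸ h3, h4, by linarith⟩

theorem enumerates_empty {τ : ℝ} {t : ℕ} {s' : Conf} (hk : Keeps s s') (hout : s'.out = s.out)
    (hret : s'.reg .ret = 0) (ht : (t : ℝ) ≤ τ) : Enumerates m ar G W k w s ∅ τ t s' :=
  ⟨[], none, hk, by simp [hout], covers_empty, hret, ht⟩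

/-- A leaf treats the cut `D` if it is important, which costs the recursive call, and nothing
otherwise. By the assumption `hpos`, no important cut is empty. -/
theorem wp_enumLeaf (hinj : ∀ i < m, ∀ j < m, ar i = ar j → i = j)
    (hS : DfasSpec P m ar q T) (hw : w ∈ W) (hdf : IsDFVS G W) (hWq : W.card ≤ q + 1)
    (hkq : k ≤ q) (hpos : ∀ A, none ∈ A → Disjoint A (some '' (W : Set (Fin n))) →
      1 ≤ (boundary E A).card)
    (h : NodeMem m ar G W k w E s M D b) (hb : D.card + b = k)
    (hTT : ∀ e < m, s.mem .TT e = idx (expandArc w (ar e)).1)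
    (hYM : HoldsSet (some '' (W : Set (Fin n))) (s.mem .YM))
    (hn : IsNode E {none} (some '' (W : Set (Fin n))) X D)
    (hM : Furthest (E \ D) X (some '' (W : Set (Fin n))) M) (h0 : boundary (E \ D) M = ∅)
    {τ : ℝ} (hτ0 : 0 ≤ τ) (hτ : 1 ≤ D.card → T b ≤ τ) :
    WP P enumLeaf s (Enumerates m ar G W k w s
      (cutsAt E {none} (some '' (W : Set (Fin n))) k M D)
      (((80 * (n + m + 1) * (k + 3) + 75 * (n + m + 1) : ℕ) : ℝ) + τ)) := by
  have hnM := hn.furthest hM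
  rw [enumLeaf, wp_block_cons]
  refine wp_find m (fun e => s.mem .ST e = 2 ∧ some (ar e).2 ∈ M) (by simp [h.static.reg_m]) ?_
    fun t1 ht1 y hy => ?_
  · intro j hj y
    simp [h.static.H0 j hj, h.src _, idx]
  rw [wp_block_one]
  have hlin : 8 * m + 4 * n + 15 ≤ 15 * (n + m + 1) := by omega
  refine wp_ite (fun hx => ?_) (fun hx => ?_)
  · rw [wp_assign]
    obtain ⟨e, he, rfl, h1, h2⟩ : ∃ j < m, y = j + 1 ∧ s.mem .ST j = 2 ∧ some (ar j).2 ∈ M := by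
      rcases hy with ⟨rfl, -⟩ | hy
      · simp at hx
      · exact hy
    rw [hnM.leaf_bad₁ hM h0 (e := expandArc w (ar e)) ((h.chosen _).mpr ⟨e, he, h1, rfl⟩) h2]
    refine enumerates_empty ⟨by simp, by simp, by simp, by simp, by simp, by simp, by simp⟩
      (by simp) (by simp) ?_
    have : t1 + (1 + 1) ≤ 80 * (n + m + 1) * (k + 3) + 75 * (n + m + 1) := by
      have := Nat.zero_le (80 * (n + m + 1) * (k + 3)); omega
    have := (Nat.cast_le (α := ℝ)).mpr this
    linarith
  have hy0 : y = 0 := by simpa using hx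
  subst hy0
  replace hy : ∀ j < m, ¬ (s.mem .ST j = 2 ∧ some (ar j).2 ∈ M) := by
    rcases hy with ⟨-, hy⟩ | ⟨j, -, hj, -⟩
    · exact hy
    · omega
  have hDM : ∀ e ∈ D, e.2 ∉ M := by
    intro x hx
    obtain ⟨e, he, h1, rfl⟩ := (h.chosen _).mp hx
    exact fun h2 => hy e he ⟨h1, h2⟩
  set s₁ := (s.setReg .x 0).setReg .i m with hs₁
  have hk1 : Keeps s s₁ := ⟨by simp [hs₁], by simp [hs₁], by simp [hs₁], by simp [hs₁],
    by simp [hs₁], by simp [hs₁], by simp [hs₁]⟩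
  have h1 : NodeMem m ar G W k w E s₁ M D b := h.congr hk1 (by simp [hs₁]) (by simp [hs₁])
    (by simp [hs₁]) (by simp [hs₁]) (by simp [hs₁]) (by simp [hs₁])
  have hm1 : s₁.mem = s.mem := by simp [hs₁]
  have ho1 : s₁.out = s.out := by simp [hs₁]
  clear_value s₁
  rw [wp_block_cons]
  have hfill : WP P (fill .C Reg.m (.get .ST Reg.i) 1 0) s₁ fun t s₂ => t ≤ 4 * m + 2 ∧
      HoldsArcs m ar w (fun e => s₂.mem .C e ≠ 0) E := by
    refine wp_fill m (fun e => if s₁.mem .ST e ≠ 0 then 1 else 0) (by simp [h1.static.reg_m])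
      (by simp) fun t ht => ⟨ht, h1.arcs.congr fun e he => by simp [he]⟩
  refine hfill.frame.mono ?_
  rintro t2 s₂ ⟨hf2, ht2, hC2⟩
  have h2 : NodeMem m ar G W k w E s₂ M D b := h1.frame hf2 rfl
  rw [wp_block_cons, wp_assign, wp_block_cons]
  set s₃ := s₂.setReg .cap _ with hs₃
  have hk3 : Keeps s₂ s₃ := ⟨by simp [hs₃], by simp [hs₃], by simp [hs₃], by simp [hs₃],
    by simp [hs₃], by simp [hs₃], by simp [hs₃]⟩
  have h3 : NodeMem m ar G W k w E s₃ M D b := h2.congr hk3 (by simp [hs₃]) (by simp [hs₃])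
    (by simp [hs₃]) (by simp [hs₃]) (by simp [hs₃]) (by simp [hs₃])
  have hm3 : s₃.mem = s₂.mem := by simp [hs₃]
  have ho3 : s₃.out = s₂.out := by simp [hs₃]
  have hc3 : s₃.reg .cap = D.card := by
    simp [hs₃, h2.reg_k, h2.reg_b]; omega
  clear_value s₃
  refine wp_furthest hinj h3.static (w := w) ?_ (E := E) (by rw [hm3]; exact hC2) h3.src
    (Y := some '' (W : Set (Fin n))) ?_ fun t4 s₄ hf4 ht4 hor => ?_
  · rw [hm3, hf2.mem _ rfl, hm1]; exact hTT
  · rw [hm3, hf2.mem _ rfl, hm1]; exact hYM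
  have hDb : boundary E M = D := by
    apply Finset.Subset.antisymm
    · rw [boundary_sdiff, Finset.sdiff_eq_empty_iff_subset] at h0; exact h0
    · intro e he
      exact mem_boundary.mpr ⟨hnM.arcs he, reachIn_subset hnM.sub (hnM.reach e he), hDM e he⟩
  obtain ⟨M', hM', hcM', hV⟩ : ∃ M', Furthest E M (some '' (W : Set (Fin n))) M' ∧
      (boundary E M').card = s₄.reg .val ∧ ∀ v, v ∈ M' ↔ s₄.mem .VIS (idx v) = 0 := by
    rcases hor with ⟨-, hor⟩ | ⟨-, hor⟩
    · have := hor M subset_rfl hM.disj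
      rw [hDb, hc3] at this; omega
    · exact hor
  rw [hc3] at ht4
  have ht4' : t4 ≤ 80 * (n + m + 1) * (k + 3) :=
    ht4.trans (Nat.mul_le_mul_left _ (by omega))
  have h4 : NodeMem m ar G W k w E s₄ M D b := h3.frame hf4 rfl
  have hk4 : Keeps s s₄ := ((hk1.trans (hf2.keeps rfl)).trans hk3).trans (hf4.keeps rfl)
  have ho4 : s₄.out = s.out := by rw [hf4.out rfl, ho3, hf2.out rfl, ho1]
  rw [wp_block_cons]
  refine wp_find (n + 1) (fun i => s₄.mem .VIS i = 0 ∧ s₄.mem .XM i = 0)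
    (by simp [h4.static.reg_n]) (by simp) fun t5 ht5 y hy' => ?_
  set s₅ := (s₄.setReg .x y).setReg .i (n + 1) with hs₅
  have hk5 : Keeps s₄ s₅ := ⟨by simp [hs₅], by simp [hs₅], by simp [hs₅], by simp [hs₅],
    by simp [hs₅], by simp [hs₅], by simp [hs₅]⟩
  have h5 : NodeMem m ar G W k w E s₅ M D b := h4.congr hk5 (by simp [hs₅]) (by simp [hs₅])
    (by simp [hs₅]) (by simp [hs₅]) (by simp [hs₅]) (by simp [hs₅])
  have ho5 : s₅.out = s₄.out := by simp [hs₅]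
  have hx5 : s₅.reg .x = y := by simp [hs₅]
  clear_value s₅
  rw [wp_block_one]
  refine wp_ite (fun hx => ?_) (fun hx => ?_) <;> rw [Term.eval_reg, hx5] at hx
  · rw [wp_assign]
    have hsub : ¬ M' ⊆ M := by
      obtain ⟨i, hi, -, h6, h7⟩ := hy'.resolve_left (fun h => hx h.1)
      obtain ⟨v, rfl⟩ := exists_idx hi
      exact fun hs => (h4.src v).mp (hs ((hV v).mpr h6)) h7
    rw [hnM.leaf_bad₂ hM h0 hM' hsub]
    refine enumerates_empty ((hk4.trans hk5).trans
      ⟨by simp, by simp, by simp, by simp, by simp, by simp, by simp⟩)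
      (by simp [ho5, ho4]) (by simp) ?_
    have : t1 + (1 + (t2 + (1 + (t4 + (t5 + (1 + 1)))))) ≤
      80 * (n + m + 1) * (k + 3) + 75 * (n + m + 1) := by omega
    have := (Nat.cast_le (α := ℝ)).mpr this
    linarith
  · have hsub : M' ⊆ M := by
      rcases hy' with ⟨-, hy'⟩ | ⟨j, -, hj, -⟩
      · intro v hv
        by_contra hvM
        exact hy' _ (idx_lt v) ⟨(hV v).mp hv, by
          by_contra h7; exact hvM ((h4.src v).mpr h7)⟩
      · omega
    obtain ⟨himp, hDM', hcuts⟩ := hnM.leaf_good h0 (by omega : D.card ≤ k) hDM hM' hsub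
    have hD1 : 1 ≤ D.card := by
      rw [← hDM']; exact hpos M (himp.sub rfl) himp.disj
    rw [hcuts]
    refine (wp_reportCut hinj hS hw hdf hWq hkq h5 hb hD1 himp hDM').mono fun t6 s₆ h6 => ?_
    refine h6.mono (hk4.trans hk5) (ho5.trans ho4) rfl ?_
    have : t1 + (1 + (t2 + (1 + (t4 + (t5 + (1 + t6)))))) + 60 * (n + m + 1) ≤
      80 * (n + m + 1) * (k + 3) + 75 * (n + m + 1) + t6 := by omega
    have := (Nat.cast_le (α := ℝ)).mpr this
    have := hτ hD1
    push_cast at *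
    linarith

/-- The specification of the enumeration below the nodes of potential at most `N`. In the time bound,
`κ` is the cost of a node, and `Λ (z - z²)^d` bounds the cost of a recursive call of the algorithm
with a cut of size `d`. -/
def EnumSpec (P : List Code) (m : ℕ) (ar : ℕ → Fin n × Fin n) (G : Digraph (Fin n))
    (W : Finset (Fin n)) (k : ℕ) (w : Fin n) (E : Finset (Option (Fin n) × Option (Fin n)))
    (Λ κ z : ℝ) (N : ℕ) : Prop :=
  ∀ (s : Conf) (X : Set (Option (Fin n))) (D : Finset (Option (Fin n) × Option (Fin n)))
    (b l : ℕ), NodeMem m ar G W k w E s X D b →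
    IsNode E {none} (some '' (W : Set (Fin n))) X D → D.card + b = k → l ≤ b + 1 →
    (∀ A, X ⊆ A → Disjoint A (some '' (W : Set (Fin n))) → l ≤ (boundary (E \ D) A).card) →
    2 * b + 2 - l ≤ N →
    WP P (.call 1) s (Enumerates m ar G W k w s
      (cutsAt E {none} (some '' (W : Set (Fin n))) k X D)
      (κ * (2 ^ (2 * b + 2 - l) - 1) + Λ * (z - z ^ 2) ^ D.card * z ^ l))

/-- An inner node with minimum cut size `v`. The first branch lowers `b` and the lower bound on the cut
size by one, the second raises the lower bound by one, so both lower the potential `2 b + 2 - v`.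
The cost of the recursive calls is split by the identity `z ^ v = (z - z ^ 2) * z ^ (v - 1) +
z ^ (v + 1)`. -/
theorem wp_enumBranch {N : ℕ} (hinj : ∀ i < m, ∀ j < m, ar i = ar j → i = j)
    (ih : EnumSpec P m ar G W k w E Λ κ z N) (hκ : 0 ≤ κ) (hΛ : 0 ≤ Λ) (hz : 0 < z) (hz1 : z ≤ 1)
    (h : NodeMem m ar G W k w E s M D b) (hb : D.card + b = k)
    (hTT : ∀ e < m, s.mem .TT e = idx (expandArc w (ar e)).1)
    (hn : IsNode E {none} (some '' (W : Set (Fin n))) M D)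
    (hM : Furthest (E \ D) X (some '' (W : Set (Fin n))) M) {v : ℕ}
    (hv : (boundary (E \ D) M).card = v) (hv0 : v ≠ 0) (hvb : v ≤ b)
    (hN : 2 * b + 1 - v ≤ N) :
    WP P enumBranch s (Enumerates m ar G W k w s
      (cutsAt E {none} (some '' (W : Set (Fin n))) k M D)
      (60 * ((n + m + 1 : ℕ) : ℝ) + 2 * (κ * (2 ^ (2 * b + 1 - v) - 1)) +
        Λ * (z - z ^ 2) ^ D.card * z ^ v)) := by
  have hy : 0 ≤ z - z ^ 2 := by nlinarith
  rw [enumBranch, wp_block_cons]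
  refine wp_find m (fun e => s.mem .ST e = 1 ∧ (expandArc w (ar e)).1 ∈ M ∧
    (expandArc w (ar e)).2 ∉ M) (by simp [h.static.reg_m]) ?_ fun t1 ht1 y hy => ?_
  · intro j hj y
    have : idx (expandArc w (ar j)).2 = (ar j).2 := rfl
    simp [h.static.H0 j hj, hTT j hj, h.src _, this]
  have hal := h.alive hinj
  obtain ⟨e, he, rfl, he1, he2, he3⟩ : ∃ j < m, y = j + 1 ∧ s.mem .ST j = 1 ∧
      (expandArc w (ar j)).1 ∈ M ∧ (expandArc w (ar j)).2 ∉ M := by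
    rcases hy with ⟨-, hy⟩ | hy
    · obtain ⟨x, hx⟩ := Finset.card_pos.mp (by omega : 0 < (boundary (E \ D) M).card)
      obtain ⟨h1, h2, h3⟩ := mem_boundary.mp hx
      obtain ⟨e, he, h4, rfl⟩ := (hal _).mp h1
      exact absurd ⟨h4, h2, h3⟩ (hy e he)
    · exact hy
  clear hy
  have hmem : expandArc w (ar e) ∈ boundary (E \ D) M :=
    mem_boundary.mpr ⟨(hal _).mpr ⟨e, he, he1, rfl⟩, he2, he3⟩
  have hnD : expandArc w (ar e) ∉ D := (Finset.mem_sdiff.mp (mem_boundary.mp hmem).1).2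
  rw [cutsAt_branch hmem]
  set s₁ := (s.setReg .x (e + 1)).setReg .i m with hs₁
  have hk1 : Keeps s s₁ := ⟨by simp [hs₁], by simp [hs₁], by simp [hs₁], by simp [hs₁],
    by simp [hs₁], by simp [hs₁], by simp [hs₁]⟩
  have h1 : NodeMem m ar G W k w E s₁ M D b := h.congr hk1 (by simp [hs₁]) (by simp [hs₁])
    (by simp [hs₁]) (by simp [hs₁]) (by simp [hs₁]) (by simp [hs₁])
  have hx1 : s₁.reg .x = e + 1 := by simp [hs₁]
  have hm1 : s₁.mem = s.mem := by simp [hs₁]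
  have ho1 : s₁.out = s.out := by simp [hs₁]
  clear_value s₁
  rw [wp_block_cons]
  refine wp_protect h1.static.reg_len (by omega) fun s₂ g1 g2 g3 g4 => ?_
  have h2 := h1.saved g1 g3
  have hx2 : s₂.reg .x = e + 1 := by rw [g1 _ (by decide) (by decide), hx1]
  rw [wp_seq]
  simp only [wp_block_cons, wp_block_one, wp_set, wp_assign]
  set s₃ := Conf.setReg _ .b _ with hs₃
  have hST3 : s₃.mem .ST = update (s₂.mem .ST) e 2 := by simp [hs₃, hx2]
  have hk3 : Keeps s₂ s₃ := by
    refine ⟨by simp [hs₃], by simp [hs₃], by simp [hs₃], by simp [hs₃], by simp [hs₃],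
      by simp [hs₃], ?_⟩
    intro a ha i hi
    cases a <;> first | exact absurd ha (by decide) | simp [hs₃]
  have hST2 : s₂.mem .ST e = 1 := by rw [g3 _ rfl, hm1, he1]
  have hup : ∀ f, s₃.mem .ST f = if f = e then 2 else s₂.mem .ST f := by
    intro f; rw [hST3, update_apply]
  have h3 : NodeMem m ar G W k w E s₃ M (insert (expandArc w (ar e)) D) (b - 1) := by
    refine ⟨hk3.static h2.static, ?_, ?_, ?_, ?_, ?_, ?_, ?_, ?_, ?_⟩
    · intro f hf; rw [hup]; split
      · exact le_rfl
      · exact h2.st_le f hf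
    · refine h2.arcs.congr fun f hf => ?_
      rw [hup]; split
      · next h => subst h; simp [hST2]
      · rfl
    · intro x
      rw [Finset.mem_insert, h2.chosen]
      constructor
      · rintro (rfl | ⟨f, hf, h4, rfl⟩)
        · exact ⟨e, he, (hup e).trans (if_pos rfl), rfl⟩
        · refine ⟨f, hf, ?_, rfl⟩
          change s₃.mem .ST f = 2
          rw [hup]; split
          · rfl
          · exact h4
      · rintro ⟨f, hf, h4, rfl⟩
        by_cases hfe : f = e
        · subst hfe; exact .inl rfl
        · rw [hup, if_neg hfe] at h4; exact .inr ⟨f, hf, h4, rfl⟩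
    · refine h2.graph.congr fun f hf => ?_
      rw [hup]; split
      · next h => subst h; simp [hST2]
      · rfl
    · have : s₃.mem .HF = s₂.mem .HF := by simp [hs₃]
      rw [this]; exact h2.hint
    · have : s₃.mem .XM = s₂.mem .XM := by simp [hs₃]
      rw [this]; exact h2.src
    · simp [hs₃, h2.reg_k]
    · simp [hs₃, h2.reg_w]
    · simp [hs₃, h2.reg_b]
  have ho3 : s₃.out = s.out := by simp [hs₃, g4, ho1]
  clear_value s₃
  have hcard : (insert (expandArc w (ar e)) D).card = D.card + 1 := Finset.card_insert_of_notMem hnD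
  refine (ih s₃ M _ (b - 1) (v - 1) h3 (hn.insert_arc hmem) (by omega) (by omega) ?_
    (by omega)).mono ?_
  · intro A hA hAY
    have := card_boundary_insert_arc (E := E) (D := D) (expandArc w (ar e)) A
    have := hM.min A (hM.sub.trans hA) hAY
    omega
  rintro t4 s₄ ⟨log₁, res₁, hk4, ho4, hc4, hr4, ht4⟩
  refine ⟨hk3.trans hk4, fun s₅ t5 hr5 ho5 hret5 hRES5 ht5 => ?_⟩
  rw [show 2 * (b - 1) + 2 - (v - 1) = 2 * b + 1 - v by omega, hcard] at ht4
  have hk5 : Keeps s s₅ := hk1.trans hr5.toKeeps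
  have h5 : NodeMem m ar G W k w E s₅ M D b := h1.restored hr5
  have hx5 : s₅.reg .x = e + 1 := hr5.x.trans hx1
  have hout5 : s₅.out = s.out ++ log₁.flatMap Event.encode := by rw [ho5, ho4, ho3]
  have hres5 : ResultOk m ar s₅ res₁ := by
    cases res₁ with
    | none => exact hret5.trans hr4
    | some F => exact ⟨by rw [hret5]; exact hr4.1, by rw [hRES5]; exact hr4.2⟩
  have hpow : (1 : ℝ) ≤ 2 ^ (2 * b + 1 - v) := one_le_pow₀ (by norm_num)
  have hκ' : 0 ≤ κ * (2 ^ (2 * b + 1 - v) - 1) := mul_nonneg hκ (by linarith)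
  have hsplit : Λ * (z - z ^ 2) ^ D.card * z ^ v = Λ * (z - z ^ 2) ^ (D.card + 1) * z ^ (v - 1) +
      Λ * (z - z ^ 2) ^ D.card * z ^ (v + 1) := by
    obtain ⟨u, rfl⟩ : ∃ u, v = u + 1 := ⟨v - 1, by omega⟩
    rw [Nat.add_sub_cancel]; ring
  have hnn : ∀ i j, 0 ≤ Λ * (z - z ^ 2) ^ i * z ^ j := fun i j => by positivity
  have hlin : ((t1 + (1 + 1 + t5 + 4) : ℕ) : ℝ) ≤ 60 * ((n + m + 1 : ℕ) : ℝ) := by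
    have : t1 + (1 + 1 + t5 + 4) ≤ 60 * (n + m + 1) := by omega
    exact_mod_cast this
  refine wp_ite (fun hret => ?_) (fun hret => ?_) <;> rw [Term.eval_reg] at hret
  · rw [wp_skip]
    cases res₁ with
    | none => exact absurd hres5 hret
    | some F =>
      refine ⟨_, _, hk5, hout5, hc4.mono_some Set.subset_union_left, hres5, ?_⟩
      have := hnn D.card (v + 1)
      push_cast at hlin ⊢
      linarith
  cases res₁ with
  | some F => exact absurd hret hres5.1
  | none =>
  have hH5 : s₅.mem .H0 e = (ar e).2 := h5.static.H0 e he
  rw [wp_block_cons, wp_assign, wp_block_one]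
  set s₆ := s₅.setReg .v _ with hs₆
  have hk6 : Keeps s₅ s₆ := ⟨by simp [hs₆], by simp [hs₆], by simp [hs₆], by simp [hs₆],
    by simp [hs₆], by simp [hs₆], by simp [hs₆]⟩
  have h6 : NodeMem m ar G W k w E s₆ M D b := h5.congr hk6 (by simp [hs₆]) (by simp [hs₆])
    (by simp [hs₆]) (by simp [hs₆]) (by simp [hs₆]) (by simp [hs₆])
  have hv6 : s₆.reg .v = (ar e).2 := by simp [hs₆, hx5, hH5]
  have ho6 : s₆.out = s₅.out := by simp [hs₆]
  have hr6 : s₆.reg .ret = s₅.reg .ret := by simp [hs₆]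
  clear_value s₆
  refine wp_ite (fun hY => ?_) (fun hY => ?_) <;>
    rw [Term.eval_get, Term.eval_reg, hv6] at hY
  · -- The head of the arc is a target, so no cut remains.
    rw [wp_skip]
    have hempty : cutsAt E {none} (some '' (W : Set (Fin n))) k
        (insert (expandArc w (ar e)).2 M) D = ∅ :=
      cutsAt_eq_empty_of_mem (Set.mem_insert _ _) ⟨(ar e).2, (h6.hint.2 _).mpr hY, rfl⟩
    rw [hempty, Set.union_empty]
    refine ⟨_, _, hk5.trans hk6, ho6.trans hout5, hc4, hr6.trans hres5, ?_⟩
    have := hnn D.card (v + 1)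
    push_cast at hlin ⊢
    linarith
  · simp only [wp_block_cons, wp_block_one, wp_set, Term.eval_reg, Term.eval_one, hv6]
    set s₇ := s₆.setMem .XM _ with hs₇
    have hk7 : Keeps s₆ s₇ := by
      refine ⟨by simp [hs₇], by simp [hs₇], by simp [hs₇], by simp [hs₇], by simp [hs₇],
        by simp [hs₇], ?_⟩
      intro a ha i hi
      cases a <;> first | exact absurd ha (by decide) | simp [hs₇]
    have hST7 : s₇.mem .ST = s₆.mem .ST := by simp [hs₇]
    have h7 : NodeMem m ar G W k w E s₇ (insert (expandArc w (ar e)).2 M) D b := by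
      refine ⟨hk7.static h6.static, by rw [hST7]; exact h6.st_le, by rw [hST7]; exact h6.arcs,
        by rw [hST7]; exact h6.chosen, by rw [hST7]; exact h6.graph, ?_, ?_, ?_, ?_, ?_⟩
      · have : s₇.mem .HF = s₆.mem .HF := by simp [hs₇]
        rw [this]; exact h6.hint
      · have : s₇.mem .XM = update (s₆.mem .XM) (idx (expandArc w (ar e)).2) 1 := by
          simp [hs₇]; rfl
        intro u
        rw [this, Set.mem_insert_iff, h6.src u]
        by_cases hu : u = (expandArc w (ar e)).2
        · subst hu; simp
        · rw [update_of_ne (fun hh => hu (idx_injective hh))]; simp [hu]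
      · simp [hs₇, h6.reg_k]
      · simp [hs₇, h6.reg_w]
      · simp [hs₇, h6.reg_b]
    have ho7 : s₇.out = s₆.out := by simp [hs₇]
    clear_value s₇
    refine (ih s₇ _ D b (v + 1) h7 (hn.insert_vertex hmem ?_) hb (by omega) ?_ (by omega)).mono ?_
    · rintro ⟨u, hu, h8⟩
      obtain rfl : u = (ar e).2 := by simpa [expandArc] using h8
      exact (h6.hint.2 _).mp hu hY
    · intro A hA hAY
      rw [← hv]
      exact hM.lt_of_mem he3 ((Set.subset_insert _ _).trans hA) (hA (Set.mem_insert _ _)) hAY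
    rintro t8 s₈ ⟨log₂, res₂, hk8, ho8, hc8, hr8, ht8⟩
    refine ⟨log₁ ++ log₂, res₂, ((hk5.trans hk6).trans hk7).trans hk8, ?_,
      hc4.union hc8 cutsAt_branch_disjoint, hr8, ?_⟩
    · rw [ho8, ho7, ho6, hout5]; simp
    · rw [show 2 * b + 2 - (v + 1) = 2 * b + 1 - v by omega] at ht8
      push_cast at hlin ⊢
      linarith

/-- The enumeration below a node with lower bound `l` on the size of the cuts takes time
`Λ (z - z²)^d z^l` in recursive calls, and `κ` for each of the fewer than `2 ^ (2 b + 2 - l)` nodes.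
The furthest minimum cut may be larger than `l`, which only improves the bound as `z ≤ 1`. -/
theorem enumSpec (hinj : ∀ i < m, ∀ j < m, ar i = ar j → i = j) (hP : P[1]? = some enumBody)
    (hS : DfasSpec P m ar q T) (hw : w ∈ W) (hdf : IsDFVS G W) (hWq : W.card ≤ q + 1)
    (hkq : k ≤ q) (hpos : ∀ A, none ∈ A → Disjoint A (some '' (W : Set (Fin n))) →
      1 ≤ (boundary E A).card) (hΛ : 0 ≤ Λ) (hz : 0 < z) (hz1 : z ≤ 1)
    (hκ : κ = 200 * ((n + m + 1 : ℕ) : ℝ) * (k + 4))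
    (hT : ∀ d b, d + b = k → 1 ≤ d → T b ≤ Λ * (z - z ^ 2) ^ d) (N : ℕ) :
    EnumSpec P m ar G W k w E Λ κ z N := by
  have hκ0 : 0 ≤ κ := by rw [hκ]; positivity
  have hy : 0 ≤ z - z ^ 2 := by nlinarith
  induction N with
  | zero =>
    intro s X D b l _ _ _ hl _ hN
    omega
  | succ N ih =>
    intro s X D b l h hn hb hl hlow hN
    have hpow : (2 : ℝ) ≤ 2 ^ (2 * b + 2 - l) := by
      calc (2 : ℝ) = 2 ^ 1 := by norm_num
        _ ≤ _ := pow_le_pow_right₀ (by norm_num) (by omega)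
    have hnn : ∀ i j, 0 ≤ Λ * (z - z ^ 2) ^ i * z ^ j := fun i j => by positivity
    have hκ1 : κ ≤ κ * (2 ^ (2 * b + 2 - l) - 1) := le_mul_of_one_le_right hκ0 (by linarith)
    have hlin : ∀ t1 t2 t3 : ℕ, t1 ≤ 8 * m + 4 * n + 11 → t2 ≤ 80 * (n + m + 1) * (k + 3) →
        t3 ≤ 4 * n + 6 → ((t1 + (t2 + (1 + (t3 + 1))) + 1 : ℕ) : ℝ) +
        ((80 * (n + m + 1) * (k + 3) + 75 * (n + m + 1) : ℕ) : ℝ) ≤ κ := by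
      intro t1 t2 t3 h1 h2 h3
      have : t1 + (t2 + (1 + (t3 + 1))) + 1 + (80 * (n + m + 1) * (k + 3) + 75 * (n + m + 1)) ≤
          200 * (n + m + 1) * (k + 4) := by
        have e1 : 80 * (n + m + 1) * (k + 3) = 80 * ((n + m + 1) * k) + 240 * (n + m + 1) := by
          ring
        have e2 : 200 * (n + m + 1) * (k + 4) = 200 * ((n + m + 1) * k) + 800 * (n + m + 1) := by
          ring
        omega
      rw [hκ]
      exact_mod_cast this
    refine wp_call hP ?_
    rw [enumBody, wp_block_cons]
    refine wp_nodeSetup hinj h fun t1 s₁ hf1 ht1 hcap hTT hC hYM => ?_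
    have h1 : NodeMem m ar G W k w E s₁ X D b := h.frame hf1 rfl
    rw [wp_block_cons]
    refine wp_furthest hinj h1.static hTT hC h1.src hYM fun t2 s₂ hf2 ht2 hor => ?_
    rw [hcap] at ht2
    replace ht2 : t2 ≤ 80 * (n + m + 1) * (k + 3) := ht2.trans (Nat.mul_le_mul_left _ (by omega))
    have hcap2 : s₂.reg .cap = b := (hf2.reg _ rfl).trans hcap
    have h2 : NodeMem m ar G W k w E s₂ X D b := h1.frame hf2 rfl
    have hk2 : Keeps s s₂ := (hf1.keeps rfl).trans (hf2.keeps rfl)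
    have ho2 : s₂.out = s.out := (hf2.out rfl).trans (hf1.out rfl)
    rw [wp_block_one]
    refine wp_ite (fun hx => ?_) (fun hx => ?_) <;>
      rw [Term.eval_sub, Term.eval_reg, Term.eval_reg, hcap2] at hx
    · rw [wp_assign]
      obtain ⟨-, hlt⟩ := hor.resolve_right (fun hh => by rw [hcap] at hh; omega)
      rw [hcap] at hlt
      rw [cutsAt_eq_empty hb hlt]
      refine enumerates_empty (hk2.trans
        ⟨by simp, by simp, by simp, by simp, by simp, by simp, by simp⟩) (by simp [ho2])
        (by simp) ?_
      have := hlin t1 t2 0 ht1 ht2 (by omega)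
      have := hnn D.card l
      push_cast at *
      have : (0 : ℝ) ≤ 80 * (n + m + 1) * (k + 3) := by positivity
      linarith
    obtain ⟨-, M, hM, hv, hVM⟩ := hor.resolve_left (fun hh => by rw [hcap] at hh; omega)
    clear hor
    rw [wp_block_cons]
    have hfill : WP P (fill .XM (Reg.n + 1) (.get .VIS Reg.i) 0 1) s₂ fun t s₃ =>
        t ≤ 4 * n + 6 ∧ HoldsSet M (s₃.mem .XM) := by
      refine wp_fill (n + 1) (fun i => if s₂.mem .VIS i ≠ 0 then 0 else 1)
        (by simp [h2.static.reg_n]) (by simp) fun t ht => ⟨by omega, fun v => ?_⟩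
      rw [hVM v]
      have := idx_lt v
      simp [show idx v ≤ n by omega]
    refine hfill.frame.mono ?_
    rintro t3 s₃ ⟨hf3, ht3, hXM3⟩
    have hk3 : Keeps s₂ s₃ := hf3.keeps rfl
    have hST3 : s₃.mem .ST = s₂.mem .ST := hf3.mem _ rfl
    have hHF3 : s₃.mem .HF = s₂.mem .HF := hf3.mem _ rfl
    have h3 : NodeMem m ar G W k w E s₃ M D b :=
      ⟨hk3.static h2.static, by rw [hST3]; exact h2.st_le, by rw [hST3]; exact h2.arcs,
        by rw [hST3]; exact h2.chosen, by rw [hST3]; exact h2.graph, by rw [hHF3]; exact h2.hint,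
        hXM3, (hf3.reg _ rfl).trans h2.reg_k, (hf3.reg _ rfl).trans h2.reg_w,
        (hf3.reg _ rfl).trans h2.reg_b⟩
    have hval3 : s₃.reg .val = s₂.reg .val := hf3.reg _ rfl
    have hTT3 : ∀ e < m, s₃.mem .TT e = idx (expandArc w (ar e)).1 := by
      rw [hf3.mem _ rfl, hf2.mem _ rfl]; exact hTT
    have hYM3 : HoldsSet (some '' (W : Set (Fin n))) (s₃.mem .YM) := by
      rw [hf3.mem _ rfl, hf2.mem _ rfl]; exact hYM
    have hlv : l ≤ s₂.reg .val := hv ▸ hlow M hM.sub hM.disj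
    have ho3 : s₃.out = s.out := (hf3.out rfl).trans ho2
    have hL := hlin t1 t2 t3 ht1 ht2 ht3
    rw [wp_block_one, hM.cutsAt_eq]
    refine wp_ite (fun hx0 => ?_) (fun hx0 => ?_) <;> rw [Term.eval_reg, hval3] at hx0
    · refine (wp_enumBranch hinj ih hκ0 hΛ hz hz1 h3 hb hTT3 (hn.furthest hM) hM hv hx0 (by omega)
        (by omega)).mono fun t4 s₄ h4 => h4.mono (hk2.trans hk3) ho3 rfl ?_
      have e1 : Λ * (z - z ^ 2) ^ D.card * z ^ s₂.reg .val ≤ Λ * (z - z ^ 2) ^ D.card * z ^ l :=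
        mul_le_mul_of_nonneg_left (pow_le_pow_of_le_one hz.le hz1 hlv) (by positivity)
      have e2 : (2 : ℝ) * 2 ^ (2 * b + 1 - s₂.reg .val) ≤ 2 ^ (2 * b + 2 - l) := by
        rw [← pow_succ']
        exact pow_le_pow_right₀ (by norm_num) (by omega)
      have e3 := mul_le_mul_of_nonneg_left e2 hκ0
      have : (0 : ℝ) ≤ 80 * (n + m + 1) * (k + 3) := by positivity
      push_cast at *
      linarith
    · obtain rfl : l = 0 := by omega
      refine (wp_enumLeaf hinj hS hw hdf hWq hkq hpos h3 hb hTT3 hYM3 hn hM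
        (Finset.card_eq_zero.mp (hv.trans hx0)) (τ := Λ * (z - z ^ 2) ^ D.card) (by positivity)
        (hT _ _ hb)).mono fun t4 s₄ h4 => h4.mono (hk2.trans hk3) ho3 rfl ?_
      rw [pow_zero, mul_one]
      push_cast at *
      linarith

end EnumSpec

/-! ### The program for the algorithm -/

/-- Searches for a cycle through the vertex `w`, as a path from `w⁺` to `w⁻`. The residual network of
the zero flow is the expanded graph itself. -/
def cycleSearch : Code := block [
  fill .TT Reg.m (.eq (.get .T0 Reg.i) Reg.w) Reg.n (.get .T0 Reg.i),
  fill .C Reg.m (.get .ST Reg.i) 1 0,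
  fill .FL Reg.m 0 0 0,
  fill .YM (Reg.n + 1) (.eq Reg.i Reg.w) 1 0,
  search]

/-- Marks the hint vertices that lie on a cycle. -/
def markCycles : Code := block [
  .assign .w 0,
  .loop (Reg.n - Reg.w) (block [
    .ite (.get .HF Reg.w) (.seq cycleSearch (.set .OC Reg.w (.get .VIS Reg.n)))
      (.set .OC Reg.w 0),
    .assign .w (Reg.w + 1)])]

/-- Enumerates the important cuts for the hint vertex `w`. -/
def visit : Code := block [
  .emit 1,
  .emit Reg.w,
  protect (.seq (.seq (fill .XM (Reg.n + 1) (.eq Reg.i Reg.n) 1 0) (.assign .b Reg.k)) (.call 1))]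

/-- The loop over the hint vertices. -/
def visitAll : Code := block [
  .assign .w 0,
  .loop (.and (Reg.n - Reg.w) (.not Reg.ret)) (block [
    .ite (.get .HF Reg.w) visit .skip,
    .assign .w (Reg.w + 1)])]

/-- Discards and reports the hint vertices that lie on no cycle. -/
def pruneHint : Code := block [
  emitPairs Reg.n (.and (.get .HF Reg.i) (.not (.get .OC Reg.i))) 0 Reg.i,
  fill .HF Reg.n (.get .OC Reg.i) 1 0,
  .assign .ret 0]

/-- The procedure for the recursive algorithm. The digraph is acyclic if no hint vertex lies on a
cycle, as the hint is a feedback vertex set. -/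
def dfasBody : Code := block [
  markCycles,
  find Reg.n (.get .OC Reg.i),
  .ite Reg.x
    (.ite Reg.k
      (block [
        pruneHint,
        visitAll,
        .ite Reg.ret (.seq (.emit 4) (emitArcs (.get .RES Reg.i))) (.emit 3)])
      (.seq (.emit 3) (.assign .ret 0)))
    (block [.emit 4, .emit 0, fill .RES Reg.m 0 0 0, .assign .ret 1])]

/-! ### Cycles through hint vertices, and the loop over important cuts -/

section Spec

variable {n m : ℕ} {ar : ℕ → Fin n × Fin n} {P : List Code} {G : Digraph (Fin n)}
  {W : Finset (Fin n)} {k : ℕ} {w : Fin n} {s s' : Conf} {q : ℕ} {T : ℕ → ℝ} {Λ κ z : ℝ}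

namespace InstanceMem

theorem congr (h : InstanceMem m ar G W k s) (hk : Keeps s s') (h1 : s'.reg .k = s.reg .k)
    (h4 : ∀ i < n + m + 1, s'.mem .ST i = s.mem .ST i)
    (h5 : ∀ i < n + m + 1, s'.mem .HF i = s.mem .HF i) : InstanceMem m ar G W k s' where
  static := hk.static h.static
  st_le e he := by rw [h4 e (by omega)]; exact h.st_le e he
  graph := h.graph.congr fun e he => by rw [h4 e (by omega)]
  hint := h.hint.congr fun i hi => h5 i (by omega)
  reg_k := h1.trans h.reg_k

theorem frame (h : InstanceMem m ar G W k s) {c : Code} (hf : Frame c s s')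
    (hc : (c.quiet && !(c.wr .k || c.wa .ST || c.wa .HF)) = true) : InstanceMem m ar G W k s' := by
  simp only [Bool.and_eq_true, Bool.not_eq_true', Bool.or_eq_false_iff] at hc
  obtain ⟨h0, ⟨h1, h4⟩, h5⟩ := hc
  exact h.congr (hf.keeps h0) (hf.reg _ h1)
    (fun i _ => congrFun (hf.mem _ h4) i) (fun i _ => congrFun (hf.mem _ h5) i)

theorem saved (h : InstanceMem m ar G W k s) (h1 : ∀ r, r ≠ .i → r ≠ .sp → s'.reg r = s.reg r)
    (h2 : ∀ a : Arr, a.isStack = false → s'.mem a = s.mem a) : InstanceMem m ar G W k s' where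
  static := ⟨(h1 _ (by decide) (by decide)).trans h.static.reg_n,
    (h1 _ (by decide) (by decide)).trans h.static.reg_m,
    (h1 _ (by decide) (by decide)).trans h.static.reg_len,
    by rw [h2 _ rfl]; exact h.static.T0, by rw [h2 _ rfl]; exact h.static.H0⟩
  st_le := by rw [h2 _ rfl]; exact h.st_le
  graph := by rw [h2 _ rfl]; exact h.graph
  hint := by rw [h2 _ rfl]; exact h.hint
  reg_k := (h1 _ (by decide) (by decide)).trans h.reg_k

/-- The arcs of the expanded graph that come from the current digraph. -/
theorem exists_arcs (h : InstanceMem m ar G W k s) (w : Fin n) :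
    ∃ E, HoldsArcs m ar w (fun e => s.mem .ST e ≠ 0) E ∧
      ∀ x, x ∈ E ↔ ∃ u v, G.Adj u v ∧ expandArc w (u, v) = x := by
  refine ⟨((Finset.range m).filter fun e => s.mem .ST e ≠ 0).image fun e => expandArc w (ar e),
    fun x => by simp [and_assoc], fun x => ?_⟩
  simp only [Finset.mem_image, Finset.mem_filter, Finset.mem_range, h.graph _ _]
  constructor
  · rintro ⟨e, ⟨he, h1⟩, rfl⟩
    exact ⟨_, _, ⟨e, he, h1, rfl⟩, rfl⟩
  · rintro ⟨u, v, ⟨e, he, h1, h2⟩, rfl⟩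
    exact ⟨e, ⟨he, h1⟩, by rw [h2]⟩

/-- The root of the enumeration tree. -/
theorem root (h : InstanceMem m ar G W k s) {E : Finset (Option (Fin n) × Option (Fin n))}
    (hE : HoldsArcs m ar w (fun e => s.mem .ST e ≠ 0) E) (hw : s.reg .w = w) (hb : s.reg .b = k)
    (hX : HoldsSet ({none} : Set (Option (Fin n))) (s.mem .XM)) :
    NodeMem m ar G W k w E s {none} ∅ k where
  static := h.static
  st_le e he := (h.st_le e he).trans (by decide)
  arcs := hE
  chosen x := by
    simp only [Finset.notMem_empty, false_iff, not_exists, not_and]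
    intro e he h1
    have := h.st_le e he
    omega
  graph := h.graph
  hint := h.hint
  src := hX
  reg_k := h.reg_k
  reg_w := hw
  reg_b := hb

end InstanceMem

theorem wp_cycleSearch {Q : ℕ → Conf → Prop} (h : InstanceMem m ar G W k s) (hw : s.reg .w = w)
    (hQ : ∀ t s', Frame cycleSearch s s' → t ≤ 64 * (n + m + 1) →
      (s'.mem .VIS n ≠ 0 ↔ OnCycle G w) → Q t s') :
    WP P cycleSearch s Q := by
  suffices h : WP P cycleSearch s fun t s' => t ≤ 64 * (n + m + 1) ∧
      (s'.mem .VIS n ≠ 0 ↔ OnCycle G w) by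
    refine h.frame.mono ?_
    rintro t s' ⟨hf, h1, h2⟩
    exact hQ t s' hf h1 h2
  have hst := h.static
  have hwn := w.isLt
  simp only [cycleSearch, wp_block_cons, wp_block_one]
  refine wp_fill m (fun e => idx (expandArc w (ar e)).1) (by simp [hst.reg_m]) ?_ fun t1 ht1 => ?_
  · intro j hj M' _
    simp [hst.T0 j hj, hw, hst.reg_n, (idx_expandArc w (ar j)).1]
  refine wp_fill m (fun e => if s.mem .ST e ≠ 0 then 1 else 0) (by simp [hst.reg_m]) (by simp)
    fun t2 ht2 => ?_
  refine wp_fill m (fun e => 0) (by simp [hst.reg_m]) (by simp) fun t3 ht3 => ?_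
  refine wp_fill (n + 1) (fun v => if v = w then 1 else 0) (by simp [hst.reg_n]) (by simp [hw])
    fun t4 ht4 => ?_
  set s₁ := Conf.setMem _ .YM _ with hs₁
  have hC : ∀ e < m, (s₁.mem .C e ≠ 0 ↔ s.mem .ST e ≠ 0) := by
    intro e he; simp [hs₁, he]
  have hrt : ∀ e < m, s₁.rt e = idx (expandArc w (ar e)).1 := by
    intro e he; simp [hs₁, he, Conf.rt]
  have hrh : ∀ e < m, s₁.rh e = (ar e).2 := by
    intro e he; simp [hs₁, he, Conf.rh, hst.H0 e he]
  have hY : ∀ v < n + 1, (s₁.mem .YM v ≠ 0 ↔ v = w) := by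
    intro v hv; simp [hs₁, show v ≤ n by omega]
  have hTT : ∀ e < m, s₁.mem .TT e < n + 1 := by
    intro e he
    have : s₁.mem .TT e = idx (expandArc w (ar e)).1 := by simp [hs₁, he]
    rw [this]; exact idx_lt _
  have hHH : ∀ e < m, s₁.mem .H0 e < n + 1 := by
    intro e he
    have : s₁.mem .H0 e = (ar e).2 := by simp [hs₁, hst.H0 e he]
    rw [this]; have := (ar e).2.isLt; omega
  have hn1 : s₁.reg .n + 1 = n + 1 := by simp [hs₁, hst.reg_n]
  have hm1 : s₁.reg .m = m := by simp [hs₁, hst.reg_m]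
  clear_value s₁
  refine wp_search hn1 hm1 hTT hHH fun t5 s₂ hf2 ht5 _ hs2 => ⟨by omega, ?_⟩
  constructor
  · intro hv
    refine (hs2.least (fun e he => by rw [hrh e he]; have := (ar e).2.isLt; omega)
      (fun i => (i = n → OnCycle G w) ∧ ∀ u : Fin n, i = u → Relation.ReflTransGen G.Adj u w)
      ?_ ?_ n (by omega) hv).1 rfl
    · intro v hvn hv
      rw [hY v hvn] at hv
      refine ⟨fun hvn' => by omega, fun u hu => ?_⟩
      obtain rfl : u = w := Fin.ext (hu.symm.trans hv)
      exact .refl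
    · intro e he hce hz
      have hadj : G.Adj (ar e).1 (ar e).2 := (h.graph _ _).mpr ⟨e, he, (hC e he).mp hce, rfl⟩
      have h1 := hz.2 (ar e).2 (hrh e he)
      rw [hrt e he, (idx_expandArc w (ar e)).1]
      have h2 := (ar e).1.isLt
      split
      · next heq =>
        have heq' : (ar e).1 = w := Fin.ext heq
        rw [heq'] at hadj
        exact ⟨fun _ => Relation.TransGen.head' hadj h1, fun u hu => by have := u.isLt; omega⟩
      · refine ⟨fun hh => by omega, fun u hu => ?_⟩
        obtain rfl : (ar e).1 = u := Fin.ext hu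
        exact .head hadj h1
  · intro hc
    have hpath : ∀ u, Relation.ReflTransGen G.Adj u w → s₂.mem .VIS u ≠ 0 := by
      intro u hu
      induction hu using Relation.ReflTransGen.head_induction_on with
      | refl => exact hs2.target w (by omega) ((hY w (by omega)).mpr rfl)
      | @head a c h1 _ ih =>
        by_cases ha : a = w
        · subst ha; exact hs2.target a (by omega) ((hY a (by omega)).mpr rfl)
        · obtain ⟨e, he, h2, h3⟩ := (h.graph _ _).mp h1
          have h4 := hs2.closed e he ((hC e he).mpr h2)
          rw [hrh e he, hrt e he, h3, (idx_expandArc w (a, c)).1,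
            if_neg (fun hh => ha (Fin.ext hh))] at h4
          exact h4 ih
    obtain ⟨b, h1, h2⟩ := Relation.TransGen.head'_iff.mp hc
    obtain ⟨e, he, h3, h4⟩ := (h.graph _ _).mp h1
    have h5 := hs2.closed e he ((hC e he).mpr h3)
    rw [hrh e he, hrt e he, h4, (idx_expandArc w (w, b)).1, if_pos rfl] at h5
    exact h5 (hpath b h2)

/-- The number of hint vertices that the loops have not yet treated. -/
def remaining (W : Finset (Fin n)) (j : ℕ) : ℕ := (W.filter fun v : Fin n => j ≤ (v : ℕ)).card

theorem remaining_zero (W : Finset (Fin n)) : remaining W 0 = W.card := by simp [remaining]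

theorem filter_le_eq_erase (W : Finset (Fin n)) (v : Fin n) :
    (W.filter fun u : Fin n => (v : ℕ) + 1 ≤ (u : ℕ)) =
      (W.filter fun u : Fin n => (v : ℕ) ≤ (u : ℕ)).erase v := by
  ext u
  simp only [Finset.mem_filter, Finset.mem_erase, ne_eq, Fin.ext_iff]
  constructor
  · rintro ⟨h1, h2⟩; exact ⟨by omega, h1, by omega⟩
  · rintro ⟨h1, h2, h3⟩; exact ⟨h2, by omega⟩

theorem remaining_of_mem {v : Fin n} (hv : v ∈ W) : remaining W v = remaining W (v + 1) + 1 := by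
  rw [remaining, remaining, filter_le_eq_erase, Finset.card_erase_add_one]
  simp [hv]

theorem filter_le_of_notMem {v : Fin n} (hv : v ∉ W) :
    (W.filter fun u : Fin n => (v : ℕ) + 1 ≤ (u : ℕ)) =
      W.filter fun u : Fin n => (v : ℕ) ≤ (u : ℕ) := by
  rw [filter_le_eq_erase, Finset.erase_eq_of_notMem (by simp [hv])]

theorem wp_markCycles {Q : ℕ → Conf → Prop} (h : InstanceMem m ar G W k s)
    (hQ : ∀ t s', Frame markCycles s s' → t ≤ 66 * (n + m + 1) * W.card + 5 * n + 2 →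
      (∀ v : Fin n, s'.mem .OC v ≠ 0 ↔ v ∈ W ∧ OnCycle G v) → Q t s') :
    WP P markCycles s Q := by
  suffices h : WP P markCycles s fun t s' => t ≤ 66 * (n + m + 1) * W.card + 5 * n + 2 ∧
      ∀ v : Fin n, s'.mem .OC v ≠ 0 ↔ v ∈ W ∧ OnCycle G v by
    refine h.frame.mono ?_
    rintro t s' ⟨hf, h1, h2⟩
    exact hQ t s' hf h1 h2
  rw [markCycles, wp_block_cons, wp_assign, wp_block_one]
  have h0 : InstanceMem m ar G W k (s.setReg .w 0) := h.congr
    ⟨by simp, by simp, by simp, by simp, by simp, by simp, by simp⟩ (by simp) (by simp) (by simp)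
  refine wp_loop (T := 66 * (n + m + 1) * W.card + 5 * n) (fun T s₁ => ∃ j ≤ n, s₁.reg .w = j ∧
    T = 66 * (n + m + 1) * remaining W j + 5 * (n - j) ∧
    ∀ v : Fin n, (v : ℕ) < j → (s₁.mem .OC v ≠ 0 ↔ v ∈ W ∧ OnCycle G v)) ?_ ?_ ?_
  · exact ⟨0, by omega, by simp, by simp [remaining_zero], by simp⟩
  · rintro T s₁ hf ⟨j, hj, hw, rfl, hoc⟩ he
    have h1 : InstanceMem m ar G W k s₁ := h0.frame hf rfl
    have hjn : j < n := by simp [h1.static.reg_n, hw] at he; omega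
    rw [wp_block_cons]
    have hvals : ∀ (s₂ s₃ : Conf) (y : ℕ), s₂.mem .OC = s₁.mem .OC → s₂.reg .w = j →
        (y ≠ 0 ↔ (⟨j, hjn⟩ : Fin n) ∈ W ∧ OnCycle G ⟨j, hjn⟩) →
        s₃.mem .OC = update (s₂.mem .OC) j y →
        ∀ v : Fin n, (v : ℕ) < j + 1 → (s₃.mem .OC v ≠ 0 ↔ v ∈ W ∧ OnCycle G v) := by
      intro s₂ s₃ y h2 _ hy h3 v hv
      rw [h3, h2]
      by_cases hvj : (v : ℕ) = j
      · obtain rfl : v = ⟨j, hjn⟩ := Fin.ext hvj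
        simpa using hy
      · rw [update_of_ne hvj]; exact hoc v (by omega)
    refine wp_ite (fun hH => ?_) (fun hH => ?_) <;>
      rw [Term.eval_get, Term.eval_reg, hw] at hH
    · have hmem : (⟨j, hjn⟩ : Fin n) ∈ W := (h1.hint.2 _).mpr hH
      rw [wp_seq]
      refine wp_cycleSearch (w := ⟨j, hjn⟩) h1 hw fun t s₂ hf2 ht hvis => ?_
      have hw2 : s₂.reg .w = j := (hf2.reg _ rfl).trans hw
      have hn2 : s₂.reg .n = n := (hf2.reg _ rfl).trans h1.static.reg_n
      simp only [wp_set, wp_block_one, wp_assign, Term.eval_reg, Term.eval_get, hw2, hn2]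
      refine ⟨_, ⟨j + 1, hjn, by simp [hw2], rfl, ?_⟩, ?_⟩
      · refine hvals s₂ _ _ (hf2.mem _ rfl) hw2 ?_ (by simp; rfl)
        rw [hvis]; simp [hmem]
      · have hrem : remaining W j = remaining W (j + 1) + 1 := remaining_of_mem hmem
        rw [hrem, Nat.mul_succ (66 * (n + m + 1))]; omega
    · have hmem : (⟨j, hjn⟩ : Fin n) ∉ W := fun hh => (h1.hint.2 _).mp hh hH
      simp only [wp_set, wp_block_one, wp_assign, Term.eval_reg, hw, Term.eval_zero]
      refine ⟨_, ⟨j + 1, hjn, by simp [hw], rfl, ?_⟩, ?_⟩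
      · exact hvals s₁ _ 0 rfl hw (by simp [hmem]) (by simp)
      · have : remaining W (j + 1) = remaining W j := by
          rw [remaining, filter_le_of_notMem hmem]; rfl
        rw [this]; omega
  · rintro T' s₁ t hf ⟨j, hj, hw, rfl, hoc⟩ he ht
    have h1 : InstanceMem m ar G W k s₁ := h0.frame hf rfl
    obtain rfl : j = n := by simp [h1.static.reg_n, hw] at he; omega
    exact ⟨by omega, fun v => hoc v v.isLt⟩

/-- Discarding the hint vertices on no cycle in the order of their numbers is an execution of the
while loop; afterwards the hint consists of the hint vertices on cycles. -/
theorem wp_pruneHint {Q : ℕ → Conf → Prop} (h : InstanceMem m ar G W k s)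
    (hoc : ∀ v : Fin n, s.mem .OC v ≠ 0 ↔ v ∈ W ∧ OnCycle G v)
    (hQ : ∀ t s' (log : List (Event (Fin n))) (W' : Finset (Fin n)), Keeps s s' → t ≤ 9 * n + 5 →
      s'.reg .ret = 0 → s'.out = s.out ++ log.flatMap Event.encode → Prune G W log W' →
      W' ⊆ W → (∀ v, v ∈ W' ↔ v ∈ W ∧ OnCycle G v) → InstanceMem m ar G W' k s' → Q t s') :
    WP P pruneHint s Q := by
  classical
  suffices hh : WP P pruneHint s fun t s' => t ≤ 9 * n + 5 ∧ s'.reg .ret = 0 ∧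
      s'.out = s.out ++ (((List.finRange n).filter fun v => v ∈ W ∧ ¬ OnCycle G v).map
        Event.discard).flatMap Event.encode ∧
      HoldsHint (W.filter fun v => OnCycle G v) (s'.mem .HF) by
    refine hh.frame.mono ?_
    rintro t s' ⟨hf, h1, h2, h3, h4⟩
    refine hQ t s' _ (W.filter fun v => OnCycle G v) (hf.keeps rfl) h1 h2 h3
      (prune_of_list _ ((List.nodup_finRange n).filter _) ?_ ?_ ?_) (Finset.filter_subset _ _)
      (by simp) ?_
    · ext v; simp; tauto
    · intro v hv; simpa using hv
    · intro v hv; exact (Finset.mem_filter.mp hv).2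
    · have hST : s'.mem .ST = s.mem .ST := hf.mem _ rfl
      exact ⟨(hf.keeps rfl).static h.static, by rw [hST]; exact h.st_le,
        by rw [hST]; exact h.graph, h4, (hf.reg _ rfl).trans h.reg_k⟩
  have hst := h.static
  simp only [pruneHint, wp_block_cons, wp_block_one, wp_assign]
  refine wp_emitPairs n (fun j => s.mem .HF j ≠ 0 ∧ s.mem .OC j = 0) (fun _ => 0) (fun j => j)
    (by simp [hst.reg_n]) (by simp) (by simp) (by simp) fun t1 ht1 => ?_
  refine wp_fill n (fun j => if s.mem .OC j ≠ 0 then 1 else 0) (by simp [hst.reg_n]) (by simp)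
    fun t2 ht2 => ?_
  refine ⟨by omega, by simp, ?_, ?_, fun v => ?_⟩
  · simp only [Conf.out_setReg, Conf.out_setMem, Conf.out_write]
    congr 1
    rw [List.flatMap_map, ← List.map_coe_finRange_eq_range, List.filter_map, List.flatMap_map]
    congr 1
    refine List.filter_congr fun v _ => ?_
    simp only [comp_apply, decide_eq_decide]
    rw [← h.hint.2 v]
    have := hoc v
    constructor
    · rintro ⟨h1, h2⟩; exact ⟨h1, fun h3 => this.mpr ⟨h1, h3⟩ h2⟩
    · rintro ⟨h1, h2⟩; exact ⟨h1, by by_contra h3; exact h2 (this.mp h3).2⟩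
  · simpa using h.hint.1
  · have := hoc v
    simp [this]

/-- The loop over the important cuts for `w` is the enumeration from the root. As `w` lies on a cycle,
every cut has at least one arc, so the lower bound `1` is available at the root. -/
theorem wp_visit (hinj : ∀ i < m, ∀ j < m, ar i = ar j → i = j) (hP : P[1]? = some enumBody)
    (hS : DfasSpec P m ar q T) (h : InstanceMem m ar G W k s) (hw : s.reg .w = w) (hwW : w ∈ W)
    (hc : OnCycle G w) (hdf : IsDFVS G W) (hWq : W.card ≤ q + 1) (hkq : k ≤ q)
    (hΛ : 0 ≤ Λ) (hz : 0 < z) (hz1 : z ≤ 1)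
    (hT : ∀ d b, d + b = k → 1 ≤ d → T b ≤ Λ * (z - z ^ 2) ^ d) :
    WP P visit s fun t s' => ∃ log res, Keeps s s' ∧ InstanceMem m ar G W k s' ∧
      s'.reg .w = w ∧ s'.out = s.out ++ (Event.vertex w :: log).flatMap Event.encode ∧
      EachCut G W k w (importantCuts G W k w) log res ∧ ResultOk m ar s' res ∧
      (t : ℝ) ≤ 60 * ((n + m + 1 : ℕ) : ℝ) +
        200 * ((n + m + 1 : ℕ) : ℝ) * (k + 4) * (2 ^ (2 * k + 1) - 1) + Λ * z := by
  simp only [visit, wp_block_cons, wp_block_one, wp_emit, Conf.write_write, Term.eval_reg,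
    Conf.reg_write, Term.eval_one, hw]
  set s₁ := s.write _ with hs₁
  have hk1 : Keeps s s₁ := ⟨rfl, rfl, rfl, rfl, rfl, rfl, fun _ _ _ _ => rfl⟩
  have h1 : InstanceMem m ar G W k s₁ := h.congr hk1 rfl (fun _ _ => rfl) (fun _ _ => rfl)
  have hw1 : s₁.reg .w = w := hw
  have ho1 : s₁.out = s.out ++ [1, (w : ℕ)] := rfl
  clear_value s₁
  obtain ⟨E, hE, hE'⟩ := h1.exists_arcs w
  refine wp_protect h1.static.reg_len (by omega) fun s₂ g1 g2 g3 g4 => ?_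
  have h2 := h1.saved g1 g3
  rw [wp_seq]
  have hprep : WP P (.seq (fill .XM (Reg.n + 1) (.eq Reg.i Reg.n) 1 0) (.assign .b Reg.k)) s₂
      fun t s₃ => t ≤ 4 * n + 7 ∧ HoldsSet ({none} : Set (Option (Fin n))) (s₃.mem .XM) ∧
      s₃.reg .b = k := by
    rw [wp_seq]
    refine wp_fill (n + 1) (fun i => if i = n then 1 else 0) (by simp [h2.static.reg_n])
      (by simp [h2.static.reg_n]) fun t ht => ?_
    rw [wp_assign]
    refine ⟨by omega, fun v => ?_, by simp [h2.reg_k]⟩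
    have := idx_lt v
    cases v with
    | none => simp [idx]
    | some v => have := v.isLt; simp [idx]; omega
  refine hprep.frame.mono ?_
  rintro t3 s₃ ⟨hf3, ht3, hX3, hb3⟩
  have h3 : InstanceMem m ar G W k s₃ := h2.frame hf3 rfl
  have hw3 : s₃.reg .w = w := by
    rw [hf3.reg _ rfl, g1 _ (by decide) (by decide), hw1]
  have hE3 : HoldsArcs m ar w (fun e => s₃.mem .ST e ≠ 0) E := by
    rw [hf3.mem .ST rfl, g3 _ rfl]; exact hE
  have ho3 : s₃.out = s₁.out := (hf3.out rfl).trans g4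
  have hpos : ∀ A, none ∈ A → Disjoint A (some '' (W : Set (Fin n))) →
      1 ≤ (boundary E A).card := by
    intro A hA hAW
    by_contra hlt
    have hemp : boundary E A = ∅ := Finset.card_eq_zero.mp (by omega)
    refine not_onCycle_of_boundary (E := E) (w := w) hA
      (fun hh => Set.disjoint_left.mp hAW hh ⟨w, hwW, rfl⟩) ?_ hc
    intro u v huv
    exact ⟨(hE' _).mpr ⟨u, v, huv, rfl⟩, by rw [hemp]; simp⟩
  have hnode : IsNode E {none} (some '' (W : Set (Fin n))) {none} ∅ :=
    isNode_root (by simp)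
  refine (enumSpec hinj hP hS hwW hdf hWq hkq hpos hΛ hz hz1 rfl hT _ s₃ {none} ∅ k 1
    (h3.root hE3 hw3 hb3 hX3) hnode (by simp) (by omega) ?_ le_rfl).mono ?_
  · intro A hA hAW
    rw [Finset.sdiff_empty]
    exact hpos A (hA rfl) hAW
  rintro t4 s₄ ⟨log, res, hk4, ho4, hc4, hr4, ht4⟩
  refine ⟨(hf3.keeps rfl).trans hk4, fun s₅ t5 hr5 ho5 hret5 hRES5 ht5 => ?_⟩
  refine ⟨log, res, hk1.trans hr5.toKeeps,
    h1.congr hr5.toKeeps hr5.k hr5.ST hr5.HF, hr5.w.trans hw1, ?_, ?_, ?_, ?_⟩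
  · rw [ho5, ho4, ho3, ho1]; simp [Event.encode]
  · rw [importantCuts_eq hwW hE']; exact hc4.eachCut
  · cases res with
    | none => exact hret5.trans hr4
    | some F => exact ⟨by rw [hret5]; exact hr4.1, by rw [hRES5]; exact hr4.2⟩
  · have : ((1 + (1 + (t3 + t5)) : ℕ) : ℝ) ≤ 60 * ((n + m + 1 : ℕ) : ℝ) := by
      have : 1 + (1 + (t3 + t5)) ≤ 60 * (n + m + 1) := by omega
      exact_mod_cast this
    rw [show 2 * k + 2 - 1 = 2 * k + 1 by omega, Finset.card_empty, pow_zero, pow_one,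
      mul_one] at ht4
    push_cast at *
    linarith

end Spec

/-! ### The loop over hint vertices, and one level of the recursion -/

section Spec

variable {n m : ℕ} {ar : ℕ → Fin n × Fin n} {P : List Code} {G : Digraph (Fin n)}
  {W : Finset (Fin n)} {k : ℕ} {s s' : Conf} {q : ℕ} {T : ℕ → ℝ} {z : ℝ}

/-- The loop over hint vertices follows the order of their numbers and stops when a set is found. -/
theorem wp_visitAll {τ : ℕ} (h : InstanceMem m ar G W k s) (hret : s.reg .ret = 0)
    (hvisit : ∀ s₁ w, InstanceMem m ar G W k s₁ → s₁.reg .w = (w : Fin n) → w ∈ W →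
      WP P visit s₁ fun t s' => ∃ log res, Keeps s₁ s' ∧ InstanceMem m ar G W k s' ∧
        s'.reg .w = w ∧ s'.out = s₁.out ++ (Event.vertex w :: log).flatMap Event.encode ∧
        EachCut G W k w (importantCuts G W k w) log res ∧ ResultOk m ar s' res ∧ t ≤ τ) :
    WP P visitAll s fun t s' => ∃ log res, Keeps s s' ∧
      s'.out = s.out ++ log.flatMap Event.encode ∧ EachVertex G W k W log res ∧
      ResultOk m ar s' res ∧ t ≤ τ * W.card + 5 * n + 2 := by
  rw [visitAll, wp_block_cons, wp_assign, wp_block_one]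
  have hk0 : Keeps s (s.setReg .w 0) :=
    ⟨by simp, by simp, by simp, by simp, by simp, by simp, by simp⟩
  have h0 : InstanceMem m ar G W k (s.setReg .w 0) := h.congr hk0 (by simp) (by simp) (by simp)
  refine wp_loop (T := τ * W.card + 5 * n) (fun B s₁ => ∃ j ≤ n, s₁.reg .w = j ∧
    InstanceMem m ar G W k s₁ ∧ Keeps s s₁ ∧ ∃ log : List (Event (Fin n)),
      s₁.out = s.out ++ log.flatMap Event.encode ∧
      ((s₁.reg .ret = 0 ∧ B = τ * remaining W j + 5 * (n - j) ∧
        ∀ log₂ r, EachVertex G W k (W.filter fun v : Fin n => j ≤ (v : ℕ)) log₂ r →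
          EachVertex G W k W (log ++ log₂) r) ∨
      ∃ F, ResultOk m ar s₁ (some F) ∧ EachVertex G W k W log (some F))) ?_ ?_ ?_
  · exact ⟨0, by omega, by simp, h0, hk0, [], by simp, .inl ⟨by simp [hret],
      by simp [remaining_zero], by simp⟩⟩
  · rintro B s₁ - ⟨j, hj, hw, h1, hk1, log, ho1, hor⟩ he
    simp only [Term.eval_and, Term.eval_sub, Term.eval_reg, Term.eval_not, h1.static.reg_n, hw,
      ne_eq, ite_eq_right_iff, one_ne_zero, imp_false, not_not] at he
    have hret1 : s₁.reg .ret = 0 := by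
      by_contra hne; exact he.2 (if_neg hne)
    have hjn : j < n := by omega
    obtain ⟨-, rfl, hcomp⟩ := hor.resolve_right fun ⟨F, hF, _⟩ => hF.1 hret1
    clear hor
    set v : Fin n := ⟨j, hjn⟩ with hv
    rw [wp_block_cons]
    refine wp_ite (fun hH => ?_) (fun hH => ?_) <;>
      rw [Term.eval_get, Term.eval_reg, hw] at hH
    · have hmem : v ∈ W := (h1.hint.2 _).mpr hH
      refine (hvisit s₁ v h1 hw hmem).mono ?_
      rintro t s₂ ⟨log₁, res, hk2, h2, hw2, ho2, hc2, hr2, ht⟩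
      simp only [wp_block_one, wp_assign, Term.eval_reg, Term.eval_add, Term.eval_one, hw2]
      set s₃ := s₂.setReg .w _ with hs₃
      have hk3 : Keeps s₂ s₃ := ⟨by simp [hs₃], by simp [hs₃], by simp [hs₃], by simp [hs₃],
        by simp [hs₃], by simp [hs₃], by simp [hs₃]⟩
      have h3 : InstanceMem m ar G W k s₃ :=
        h2.congr hk3 (by simp [hs₃]) (by simp [hs₃]) (by simp [hs₃])
      have ho3 : s₃.out = s.out ++ (log ++ Event.vertex v :: log₁).flatMap Event.encode := by
        simp only [hs₃, Conf.out_setReg, ho2, ho1]; simp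
      have hvU : v ∈ W.filter fun u : Fin n => j ≤ (u : ℕ) :=
        Finset.mem_filter.mpr ⟨hmem, le_rfl⟩
      have hrem : remaining W j = remaining W (j + 1) + 1 := remaining_of_mem hmem
      cases res with
      | none =>
        refine ⟨_, ⟨j + 1, hjn, by simp [hs₃, hv], h3, (hk1.trans hk2).trans hk3, _, ho3,
          .inl ⟨by simpa [hs₃] using (show s₂.reg .ret = 0 from hr2), rfl, fun log₂ r hr => ?_⟩⟩, ?_⟩
        · have := filter_le_eq_erase W v
          rw [this] at hr
          have := hcomp _ _ (EachVertex.next hvU hc2 hr)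
          simpa using this
        · rw [hrem, Nat.mul_succ]; omega
      | some F =>
        refine ⟨0, ⟨j + 1, hjn, by simp [hs₃, hv], h3, (hk1.trans hk2).trans hk3, _, ho3,
          .inr ⟨F, by simpa [hs₃, ResultOk] using hr2, hcomp _ _ (EachVertex.found hvU hc2)⟩⟩, ?_⟩
        rw [hrem, Nat.mul_succ]; omega
    · have hmem : v ∉ W := fun hh => (h1.hint.2 _).mp hh hH
      simp only [wp_skip, wp_block_one, wp_assign, Term.eval_reg, Term.eval_add, Term.eval_one, hw]
      have hk3 : Keeps s₁ (s₁.setReg .w (j + 1)) :=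
        ⟨by simp, by simp, by simp, by simp, by simp, by simp, by simp⟩
      have hfil := filter_le_of_notMem hmem
      refine ⟨_, ⟨j + 1, hjn, by simp, h1.congr hk3 (by simp) (by simp) (by simp), hk1.trans hk3,
        log, by simpa using ho1, .inl ⟨by simpa using hret1, rfl, fun log₂ r hr => ?_⟩⟩, ?_⟩
      · rw [hfil] at hr; exact hcomp _ _ hr
      · have : remaining W (j + 1) = remaining W j := by
          rw [remaining, hfil]; rfl
        rw [this]; omega
  · rintro B s₁ t - ⟨j, hj, hw, h1, hk1, log, ho1, hor⟩ he ht
    rcases hor with ⟨hret1, -, hcomp⟩ | ⟨F, hF, hE⟩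
    · refine ⟨log, none, hk1, ho1, ?_, hret1, by omega⟩
      obtain rfl : j = n := by simp [h1.static.reg_n, hw, hret1] at he; omega
      have : (W.filter fun v : Fin j => j ≤ (v : ℕ)) = ∅ := by
        ext v; have := v.isLt; simp
      have := hcomp [] none (by rw [this]; exact .done)
      simpa using this
    · exact ⟨log, some F, hk1, ho1, hE, hF, by omega⟩

/-- One level of the recursion: if `Λ (z - z²)^d` bounds the time of the calls that follow the
choice of a cut of size `d`, then a call for a hint of size `q + 1` consists of at most `q + 1`
enumerations, whose recursive calls take time at most `Λ z` each. -/
theorem dfasSpec_succ (hinj : ∀ i < m, ∀ j < m, ar i = ar j → i = j)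
    (hP₀ : P[0]? = some dfasBody) (hP₁ : P[1]? = some enumBody) (hS : DfasSpec P m ar q T)
    (hz : 0 < z) (hz1 : z ≤ 1) {T' : ℕ → ℝ}
    (hT : ∀ k ≤ q, ∃ Λ, 0 ≤ Λ ∧ (∀ d b, d + b = k → 1 ≤ d → T b ≤ Λ * (z - z ^ 2) ^ d) ∧
      (q + 1) * (200 * ((n + m + 1 : ℕ) : ℝ) * (k + 4) * 2 ^ (2 * k + 1) + Λ * z) ≤ T' k) :
    DfasSpec P m ar (q + 1) T' := by
  intro s G W k h hdf hWq hkq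
  obtain ⟨Λ, hΛ, hTΛ, hT'⟩ := hT k (by omega)
  set L : ℝ := ((n + m + 1 : ℕ) : ℝ) with hL
  have hL0 : 0 ≤ L := Nat.cast_nonneg _
  set B : ℝ := 60 * L + 200 * L * (k + 4) * (2 ^ (2 * k + 1) - 1) + Λ * z with hB
  have hpow : (1 : ℝ) ≤ 2 ^ (2 * k + 1) := one_le_pow₀ (by norm_num)
  have hB0 : 0 ≤ B := by
    have : 0 ≤ 200 * L * (k + 4) * (2 ^ (2 * k + 1) - 1) := mul_nonneg (by positivity) (by linarith)
    positivity
  -- The searches for cycles and the loops over all vertices and arcs are linear per hint vertex.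
  have htime : ∀ t : ℕ, t ≤ 66 * (n + m + 1) * W.card + 25 * (n + m + 1) + ⌊B⌋₊ * W.card →
      (t : ℝ) ≤ T' k := by
    intro t ht
    have h1 : (W.card : ℝ) ≤ q + 1 := by exact_mod_cast hWq
    have h2 : (t : ℝ) ≤ 66 * L * W.card + 25 * L + B * W.card := by
      have h3 : (t : ℝ) ≤ 66 * L * W.card + 25 * L + ⌊B⌋₊ * W.card := by
        rw [hL]; exact_mod_cast ht
      have := mul_le_mul_of_nonneg_right (Nat.floor_le hB0) (Nat.cast_nonneg (α := ℝ) W.card)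
      linarith
    have h4 : (66 * L + B) * W.card ≤ (66 * L + B) * (q + 1) :=
      mul_le_mul_of_nonneg_left h1 (by positivity)
    have h5 : 25 * L ≤ 25 * L * (q + 1) :=
      le_mul_of_one_le_right (by positivity) (by linarith [Nat.cast_nonneg (α := ℝ) q])
    have h6 : (q + 1) * (91 * L + B) ≤
        (q + 1) * (200 * L * (k + 4) * 2 ^ (2 * k + 1) + Λ * z) := by
      refine mul_le_mul_of_nonneg_left ?_ (by positivity)
      have : 0 ≤ L * k := by positivity
      rw [hB]; linarith
    linarith
  refine wp_call hP₀ ?_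
  rw [dfasBody, wp_block_cons]
  refine wp_markCycles h fun t1 s₁ hf1 ht1 hoc => ?_
  have h1 : InstanceMem m ar G W k s₁ := h.frame hf1 rfl
  have hk1 : Keeps s s₁ := hf1.keeps rfl
  have ho1 : s₁.out = s.out := hf1.out rfl
  rw [wp_block_cons]
  refine wp_find n (fun j => s₁.mem .OC j ≠ 0) (by simp [h1.static.reg_n]) (by simp)
    fun t2 ht2 y hy => ?_
  set s₂ := (s₁.setReg .x y).setReg .i n with hs₂
  have hk2 : Keeps s₁ s₂ := ⟨by simp [hs₂], by simp [hs₂], by simp [hs₂], by simp [hs₂],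
    by simp [hs₂], by simp [hs₂], by simp [hs₂]⟩
  have h2 : InstanceMem m ar G W k s₂ :=
    h1.congr hk2 (by simp [hs₂]) (by simp [hs₂]) (by simp [hs₂])
  have ho2 : s₂.out = s.out := by simp [hs₂, ho1]
  have hx2 : s₂.reg .x = y := by simp [hs₂]
  have hOC2 : s₂.mem .OC = s₁.mem .OC := by simp [hs₂]
  clear_value s₂
  rw [wp_block_one]
  refine wp_ite (fun hx => ?_) (fun hx => ?_) <;> rw [Term.eval_reg, hx2] at hx
  · obtain ⟨j, hj, -, hjc⟩ := hy.resolve_left fun hh => hx hh.1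
    clear hy
    have hcyc : ¬ IsAcyclic G := fun ha => ha ⟨j, hj⟩ ((hoc ⟨j, hj⟩).mp hjc).2
    refine wp_ite (fun hk => ?_) (fun hk => ?_) <;> rw [Term.eval_reg, h2.reg_k] at hk
    · rw [wp_block_cons]
      refine wp_pruneHint h2 (by rw [hOC2]; exact hoc)
        fun t3 s₃ log₁ W' hk3 ht3 hret3 ho3 hprune hsub hW' h3 => ?_
      have hcard : W'.card ≤ W.card := Finset.card_le_card hsub
      have hdf' : IsDFVS G W' :=
        hdf.mono (fun _ _ h => h) fun w hw hw' hc => hw' ((hW' w).mpr ⟨hw, hc⟩)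
      rw [wp_block_cons]
      refine (wp_visitAll (τ := ⌊B⌋₊) h3 hret3 fun s₄ w h4 hw4 hwW => ?_).mono ?_
      · refine (wp_visit hinj hP₁ hS h4 hw4 hwW ((hW' w).mp hwW).2 hdf' (by omega) (by omega) hΛ
          hz hz1 hTΛ).mono ?_
        rintro t s₅ ⟨log, res, e1, e2, e3, e4, e5, e6, e7⟩
        exact ⟨log, res, e1, e2, e3, e4, e5, e6, Nat.le_floor e7⟩
      rintro t4 s₄ ⟨log₂, res, hk4, ho4, hE4, hr4, ht4⟩
      have ht4' : t4 ≤ ⌊B⌋₊ * W.card + 5 * n + 2 :=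
        ht4.trans (by have := Nat.mul_le_mul_left ⌊B⌋₊ hcard; omega)
      have hkk : Keeps s s₄ := ((hk1.trans hk2).trans hk3).trans hk4
      have ho : s₄.out = s.out ++ (log₁ ++ log₂).flatMap Event.encode := by
        rw [ho4, ho3, ho2]; simp
      rw [wp_block_one]
      refine wp_ite (fun hret => ?_) (fun hret => ?_) <;> rw [Term.eval_reg] at hret
      · cases res with
        | none => exact absurd hr4 hret
        | some F =>
          have hst4 := hkk.static h.static
          have hemit : WP P (.seq (.emit 4) (emitArcs (.get .RES Reg.i))) s₄ fun t s₅ =>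
              t ≤ 9 * m + 7 ∧ s₅.out = s₄.out ++ (Event.ret (some
                (arcList m ar fun e => s₄.mem .RES e ≠ 0))).encode := by
            rw [wp_seq, wp_emit]
            refine wp_emitArcs (m := m) (ar := ar) ⟨hst4.1, hst4.2, hst4.3, hst4.4, hst4.5⟩
              (fun e => s₄.mem .RES e ≠ 0) ?_ ?_
            · intro j _ s₅ h5 h6; simp [h5, h6]
            · intro t s₅ _ ht h5
              exact ⟨by omega, by rw [h5]; simp [Event.encode]⟩
          refine hemit.frame.mono ?_
          rintro t5 s₅ ⟨hf5, ht5, ho5⟩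
          refine ⟨_, some F, hkk.trans (hf5.keeps rfl), ?_, Run.branch hcyc hk hprune hE4
            (r := some (arcList m ar fun e => s₄.mem .RES e ≠ 0)) ?_, ?_, htime _ ?_⟩
          · rw [ho5, ho]; simp
          · refine ⟨nodup_arcList hinj _, ?_⟩
            ext x
            rw [List.mem_toFinset, mem_arcList, hr4.2]
          · refine ⟨by rw [hf5.reg _ rfl]; exact hret, ?_⟩
            rw [hf5.mem _ rfl]; exact hr4.2
          · omega
      · cases res with
        | some F => exact absurd hret hr4.1
        | none =>
          rw [wp_emit]
          refine ⟨_, none, hkk.trans ⟨rfl, rfl, rfl, rfl, rfl, rfl, fun _ _ _ _ => rfl⟩, ?_,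
            Run.branch hcyc hk hprune hE4 (r := none) trivial, hret,
            htime _ ?_⟩
          · simp [ho, Event.encode]
          · omega
    · obtain rfl : k = 0 := hk
      simp only [wp_seq, wp_emit, wp_assign]
      refine ⟨_, none, (hk1.trans hk2).trans
        ⟨by simp, by simp, by simp, by simp, by simp, by simp, by simp⟩, ?_, .exhausted hcyc,
        by simp [ResultOk], htime _ ?_⟩
      · simp [ho2, Event.encode]
      · omega
  · have hacyc : IsAcyclic G := by
      refine hdf.isAcyclic fun w hw hc => ?_
      rcases hy with ⟨-, hy⟩ | ⟨j, _, hj, _⟩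
      · exact hy w w.isLt ((hoc w).mpr ⟨hw, hc⟩)
      · omega
    simp only [wp_block_cons, wp_block_one, wp_emit, wp_assign, Conf.write_write]
    refine wp_fill m (fun _ => 0) (by simp [h2.static.reg_m]) (by simp) fun t3 ht3 => ?_
    refine ⟨_, some ∅, (hk1.trans hk2).trans ⟨by simp, by simp, by simp, by simp, by simp,
      by simp, ?_⟩, ?_, .acyclic hacyc, ⟨by simp, fun x => ?_⟩, htime _ ?_⟩
    · intro a ha i hi
      cases a <;> first | exact absurd ha (by decide) | simp
    · simp [ho2, Event.encode, encodeArcs]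
    · simp only [Finset.notMem_empty, false_iff, not_exists, not_and]
      intro e he h5
      simp [he] at h5
    · omega

end Spec

/-! ### The recurrence for the running time -/

section Numerics

/-- The time bound for hints with at most `q` vertices, apart from the size of the digraph. If
`q` decreases by `1` and `k` by `d`, then the exponent of `z - z²` increases by `d - 1`, so calls
that follow the choice of larger cuts are cheaper, as the analysis of the enumeration requires. -/
noncomputable def timeBound (z : ℝ) (q k : ℕ) : ℝ :=
  1600 * Real.exp 16 * Real.exp (1 / (z - z ^ 2)) / z * q.factorial * ((1 + z) / (1 - z)) ^ q *
    (z - z ^ 2) ^ (q - 1 - k)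

variable {z : ℝ}

theorem four_add_mul_two_pow_le (k : ℕ) : ((k : ℝ) + 4) * 2 ^ (2 * k + 1) ≤ 8 * 16 ^ k := by
  have h1 : ((k : ℝ) + 1) ≤ 4 ^ k := by
    have : k + 1 ≤ 4 ^ k := Nat.lt_pow_self (by norm_num)
    exact_mod_cast this
  have h2 : (2 : ℝ) ^ (2 * k + 1) = 2 * 4 ^ k := by
    rw [pow_succ, pow_mul]; norm_num; ring
  have h3 : (16 : ℝ) ^ k = 4 ^ k * 4 ^ k := by
    rw [← mul_pow]; norm_num
  rw [h2, h3]
  have h4 : (1 : ℝ) ≤ 4 ^ k := one_le_pow₀ (by norm_num)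
  nlinarith

theorem pow_sixteen_le (k : ℕ) : (16 : ℝ) ^ k ≤ Real.exp 16 * k.factorial := by
  have := Real.pow_div_factorial_le_exp (x := 16) (by norm_num) k
  rwa [div_le_iff₀ (by positivity)] at this

/-- The cost of the nodes of an enumeration tree is at most a fraction `z` of the time bound. -/
theorem node_cost_le (hz : 0 < z) (hz1 : z ≤ 1 / 2) {q k : ℕ} (hk : k ≤ q) :
    200 * ((k : ℝ) + 4) * 2 ^ (2 * k + 1) ≤
      1600 * Real.exp 16 * Real.exp (1 / (z - z ^ 2)) * q.factorial * ((1 + z) / (1 - z)) ^ q *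
        (z - z ^ 2) ^ (q - k) := by
  have hy : 0 < z - z ^ 2 := by nlinarith
  obtain ⟨d, rfl⟩ := Nat.exists_eq_add_of_le hk
  rw [Nat.add_sub_cancel_left]
  have h1 : (1 : ℝ) ≤ ((1 + z) / (1 - z)) ^ (k + d) := by
    refine one_le_pow₀ ?_
    rw [le_div_iff₀ (by linarith)]; linarith
  have h2 : (k.factorial : ℝ) * d.factorial ≤ (k + d).factorial := by
    exact_mod_cast Nat.le_of_dvd (Nat.factorial_pos _) (Nat.factorial_mul_factorial_dvd_factorial_add k d)
  have h3 : (1 : ℝ) ≤ Real.exp (1 / (z - z ^ 2)) * (d.factorial * (z - z ^ 2) ^ d) := by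
    have := Real.pow_div_factorial_le_exp (x := 1 / (z - z ^ 2)) (by positivity) d
    rw [div_le_iff₀ (by positivity), one_div, inv_pow, inv_le_iff_one_le_mul₀ (by positivity)] at this
    rw [one_div]; linarith
  have h4 := four_add_mul_two_pow_le k
  have h5 := pow_sixteen_le k
  calc 200 * ((k : ℝ) + 4) * 2 ^ (2 * k + 1) ≤ 1600 * (Real.exp 16 * k.factorial) * 1 * 1 := by
        linarith
    _ ≤ 1600 * (Real.exp 16 * k.factorial) *
          (Real.exp (1 / (z - z ^ 2)) * (d.factorial * (z - z ^ 2) ^ d)) *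
          ((1 + z) / (1 - z)) ^ (k + d) := by
        gcongr
    _ = 1600 * Real.exp 16 * Real.exp (1 / (z - z ^ 2)) * (k.factorial * d.factorial) *
          ((1 + z) / (1 - z)) ^ (k + d) * (z - z ^ 2) ^ d := by ring
    _ ≤ _ := by
        have : (0 : ℝ) ≤ ((1 + z) / (1 - z)) ^ (k + d) := by linarith
        gcongr

/-- The time bound satisfies the recurrence: each level of the recursion contributes a factor
`q + 1` for the choice of a hint vertex and a factor `(1 + z) / (1 - z)` for the choice of a cut,
of which `1 / (1 - z)` accounts for the recursive calls and `z / (1 - z)` for the nodes of the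
enumeration tree. -/
theorem dfasSpec {n m : ℕ} {ar : ℕ → Fin n × Fin n} {P : List Code}
    (hinj : ∀ i < m, ∀ j < m, ar i = ar j → i = j) (hP₀ : P[0]? = some dfasBody)
    (hP₁ : P[1]? = some enumBody) (hz : 0 < z) (hz1 : z ≤ 1 / 2) (q : ℕ) :
    DfasSpec P m ar q fun k => ((n + m + 1 : ℕ) : ℝ) * timeBound z q k := by
  induction q with
  | zero => intro s G W k _ _ _ hk; omega
  | succ q ih =>
    refine dfasSpec_succ hinj hP₀ hP₁ ih hz (by linarith) fun k hk => ?_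
    have hy : 0 < z - z ^ 2 := by nlinarith
    have hz' : 0 < 1 - z := by linarith
    have hβ : 0 < (1 + z) / (1 - z) := by positivity
    set L : ℝ := ((n + m + 1 : ℕ) : ℝ) with hL
    have hL0 : 0 ≤ L := Nat.cast_nonneg _
    set Z : ℝ := 1600 * Real.exp 16 * Real.exp (1 / (z - z ^ 2)) * q.factorial *
      ((1 + z) / (1 - z)) ^ q * (z - z ^ 2) ^ (q - k) with hZ
    have hZ0 : 0 ≤ Z := by positivity
    refine ⟨L * Z / z / (z - z ^ 2), by positivity, ?_, ?_⟩
    · rintro d b hdb hd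
      obtain ⟨d, rfl⟩ : ∃ d', d = d' + 1 := ⟨d - 1, by omega⟩
      apply le_of_eq
      have hpow : (z - z ^ 2) ^ (d + 1) = (z - z ^ 2) ^ d * (z - z ^ 2) := pow_succ _ _
      have h1 : L * Z / z / (z - z ^ 2) * ((z - z ^ 2) ^ d * (z - z ^ 2)) =
          L * (Z / z) * (z - z ^ 2) ^ d * ((z - z ^ 2) / (z - z ^ 2)) := by ring
      rw [hpow, h1, div_self hy.ne', timeBound, hZ, show q - 1 - b = q - k + d by omega, pow_add]
      ring
    · have h1 := node_cost_le hz hz1 hk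
      rw [← hZ] at h1
      have h2 : timeBound z (q + 1) k = (q + 1) * (Z / z * ((1 + z) / (1 - z))) := by
        rw [timeBound, hZ, Nat.factorial_succ, Nat.add_sub_cancel, pow_succ]
        push_cast; ring
      have h3 : Z / z * ((1 + z) / (1 - z)) = Z / (1 - z) + Z / (z * (1 - z)) := by
        field_simp
        ring
      have h4 : L * Z / z / (z - z ^ 2) * z = L * (Z / (z * (1 - z))) := by
        have : z - z ^ 2 = z * (1 - z) := by ring
        rw [this]; field_simp
      have h5 : Z ≤ Z / (1 - z) := by
        rw [le_div_iff₀ hz']; nlinarith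
      rw [h2, h3, h4]
      have h6 : 200 * L * (k + 4) * 2 ^ (2 * k + 1) ≤ L * (Z / (1 - z)) := by
        have := mul_le_mul_of_nonneg_left (h1.trans h5) hL0
        linarith
      have h7 := mul_le_mul_of_nonneg_left h6 (by positivity : (0 : ℝ) ≤ (q : ℝ) + 1)
      linarith

/-- The time bound for `q = k + 1`. The choice of `z` balances `exp (1 / (z - z²))` against
`((1 + z) / (1 - z))^(k + 1)`; both become `2 ^ O(√k)`. -/
theorem timeBound_le (k : ℕ) : timeBound (1 / (2 * √((k : ℝ) + 1))) (k + 1) k ≤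
    1600 * Real.exp 16 * k.factorial * 2 ^ (20 * √((k : ℝ) + 1)) := by
  set r : ℝ := √((k : ℝ) + 1) with hr
  have hr2 : r ^ 2 = k + 1 := Real.sq_sqrt (by positivity)
  have hr1 : 1 ≤ r := by
    rw [hr, Real.one_le_sqrt]; linarith [Nat.cast_nonneg (α := ℝ) k]
  have hr0 : 0 < r := by linarith
  set z : ℝ := 1 / (2 * r) with hz
  have hz0 : 0 < z := by positivity
  have hzr : z * r = 1 / 2 := by rw [hz]; field_simp
  have hz1 : z ≤ 1 / 2 := by
    have := mul_le_mul_of_nonneg_left hr1 hz0.le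
    linarith
  have hy : 0 < z - z ^ 2 := by nlinarith
  have h1 : 1 / (z - z ^ 2) ≤ 4 * r := by
    rw [div_le_iff₀ hy]
    have : z ^ 2 * r = z * (1 / 2) := by rw [← hzr]; ring
    nlinarith
  have h2 : ((1 + z) / (1 - z)) ^ (k + 1) ≤ Real.exp (2 * r) := by
    have h3 : (1 + z) / (1 - z) ≤ Real.exp (4 * z) := by
      refine le_trans ?_ (Real.add_one_le_exp _)
      rw [div_le_iff₀ (by linarith)]; nlinarith
    calc ((1 + z) / (1 - z)) ^ (k + 1) ≤ Real.exp (4 * z) ^ (k + 1) := by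
          refine pow_le_pow_left₀ ?_ h3 _
          exact div_nonneg (by linarith) (by linarith)
      _ = Real.exp (2 * r) := by
          rw [← Real.exp_nat_mul]
          congr 1
          push_cast
          rw [← hr2]
          linear_combination 4 * r * hzr
  have h4 : 2 * r * (k + 1) ≤ Real.exp (4 * r) := by
    have h5 : r ≤ Real.exp r := by linarith [Real.add_one_le_exp r]
    have h6 : 2 ≤ Real.exp r := by linarith [Real.add_one_le_exp r]
    have h7 : Real.exp (4 * r) = Real.exp r * (Real.exp r * Real.exp r * Real.exp r) := by
      rw [← Real.exp_add, ← Real.exp_add, ← Real.exp_add]; ring_nf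
    rw [h7, ← hr2]
    calc 2 * r * r ^ 2 = 2 * (r * r * r) := by ring
      _ ≤ _ := by gcongr
  have h8 : Real.exp (10 * r) ≤ 2 ^ (20 * r) := by
    rw [Real.rpow_def_of_pos (by norm_num), Real.exp_le_exp]
    have := Real.log_two_gt_d9
    nlinarith
  have h9 : timeBound z (k + 1) k = 1600 * Real.exp 16 * k.factorial *
      (Real.exp (1 / (z - z ^ 2)) * ((1 + z) / (1 - z)) ^ (k + 1) * (2 * r * (k + 1))) := by
    rw [timeBound, Nat.factorial_succ, show k + 1 - 1 - k = 0 by omega, pow_zero]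
    have : (1 : ℝ) / z = 2 * r := by rw [hz]; field_simp
    rw [← this]
    push_cast; ring
  rw [h9]
  refine mul_le_mul_of_nonneg_left ?_ (by positivity)
  have hβ : 0 ≤ (1 + z) / (1 - z) := div_nonneg (by linarith) (by linarith)
  calc Real.exp (1 / (z - z ^ 2)) * ((1 + z) / (1 - z)) ^ (k + 1) * (2 * r * (k + 1))
      ≤ Real.exp (4 * r) * Real.exp (2 * r) * Real.exp (4 * r) := by
        gcongr
    _ = Real.exp (10 * r) := by rw [← Real.exp_add, ← Real.exp_add]; ring_nf
    _ ≤ _ := h8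

theorem isLittleO_sqrt : (fun k : ℕ => 20 * √((k : ℝ) + 1)) =o[Filter.atTop]
    fun k : ℕ => (k : ℝ) := by
  rw [Asymptotics.isLittleO_iff]
  intro c hc
  filter_upwards [Filter.eventually_ge_atTop 1,
    Filter.eventually_ge_atTop ⌈800 / c ^ 2⌉₊] with k hk1 hk2
  have h1 : (1 : ℝ) ≤ k := by exact_mod_cast hk1
  have h2 : 800 / c ^ 2 ≤ k := Nat.ceil_le.mp hk2
  rw [div_le_iff₀ (by positivity)] at h2
  rw [Real.norm_of_nonneg (by positivity), Real.norm_of_nonneg (by positivity)]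
  have : √((k : ℝ) + 1) ≤ c * k / 20 := by
    apply Real.sqrt_le_iff.mpr
    refine ⟨by positivity, ?_⟩
    have := mul_le_mul_of_nonneg_right h2 (by positivity : (0 : ℝ) ≤ k)
    nlinarith
  linarith

end Numerics

/-! ### Reading the input -/

section Input

variable {n : ℕ}

theorem length_encodeArcs (l : List (Fin n × Fin n)) : (encodeArcs l).length = 2 * l.length := by
  induction l with
  | nil => rfl
  | cons a l ih => simp only [encodeArcs, List.flatMap_cons, List.length_append] at ih ⊢
                   simp only [ih, List.length_cons, List.length_nil]; omega

theorem getD_encodeArcs (l : List (Fin n × Fin n)) (r : List ℕ) (d : Fin n × Fin n) {e : ℕ}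
    (he : e < l.length) : (encodeArcs l ++ r).getD (2 * e) 0 = (l.getD e d).1 ∧
      (encodeArcs l ++ r).getD (2 * e + 1) 0 = (l.getD e d).2 := by
  induction l generalizing e with
  | nil => simp at he
  | cons a l ih =>
    have h0 : encodeArcs (a :: l) ++ r = (a.1 : ℕ) :: (a.2 : ℕ) :: (encodeArcs l ++ r) := rfl
    cases e with
    | zero => rw [h0]; exact ⟨rfl, rfl⟩
    | succ e =>
      rw [h0, show 2 * (e + 1) = 2 * e + 1 + 1 by ring]
      simp only [List.getD_cons_succ]
      exact ih (by simpa using he)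

theorem encodeInput_eq (arcs : List (Fin n × Fin n)) (hint : List (Fin n)) (k : ℕ) :
    encodeInput arcs hint k =
      [n, arcs.length, hint.length, k] ++ encodeArcs arcs ++ hint.map Fin.val := by
  simp [encodeInput, List.map_eq_flatMap]

theorem getD_encodeInput_arc (arcs : List (Fin n × Fin n)) (hint : List (Fin n)) (k : ℕ)
    (d : Fin n × Fin n) {e : ℕ} (he : e < arcs.length) :
    (encodeInput arcs hint k).getD (4 + e + e) 0 = (arcs.getD e d).1 ∧
      (encodeInput arcs hint k).getD (4 + e + e + 1) 0 = (arcs.getD e d).2 := by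
  have h0 : encodeInput arcs hint k = n :: arcs.length :: hint.length :: k ::
      (encodeArcs arcs ++ hint.map Fin.val) := encodeInput_eq _ _ _
  rw [h0, show 4 + e + e = 2 * e + 1 + 1 + 1 + 1 by ring]
  simp only [List.getD_cons_succ]
  exact getD_encodeArcs _ _ _ he

theorem getD_encodeInput_hint (arcs : List (Fin n × Fin n)) (hint : List (Fin n)) (k : ℕ) (i : ℕ) :
    (encodeInput arcs hint k).getD (4 + arcs.length + arcs.length + i) 0 =
      (hint.map Fin.val).getD i 0 := by
  rw [encodeInput_eq, List.getD_append_right]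
  · congr 1
    rw [List.length_append, length_encodeArcs]
    simp only [List.length_cons, List.length_nil]
    omega
  · rw [List.length_append, length_encodeArcs]
    simp only [List.length_cons, List.length_nil]
    omega

theorem length_encodeInput (arcs : List (Fin n × Fin n)) (hint : List (Fin n)) (k : ℕ) :
    (encodeInput arcs hint k).length = 4 + 2 * arcs.length + hint.length := by
  simp only [encodeInput_eq, List.length_append, length_encodeArcs, List.length_map,
    List.length_cons, List.length_nil]

/-- Copies the arcs of the input into the arrays. -/
def readArcs : Code := forLoop Reg.m (block [
  .read .u ((4 : Term) + Reg.i + Reg.i),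
  .set .T0 Reg.i Reg.u,
  .read .u ((4 : Term) + Reg.i + Reg.i + 1),
  .set .H0 Reg.i Reg.u,
  .set .ST Reg.i 1])

/-- Marks the hint vertices of the input. -/
def readHint : Code := forLoop Reg.h (block [
  .read .u ((4 : Term) + Reg.m + Reg.m + Reg.i),
  .set .HF Reg.u 1])

/-- Reads the input. -/
def readInput : Code := block [
  .read .n 0, .read .m 1, .read .h 2, .read .k 3, .assign .len (Reg.n + Reg.m + 1),
  readArcs, readHint]

variable {P : List Code} {s : Conf} {arcs : List (Fin n × Fin n)} {hint : List (Fin n)} {k : ℕ}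

theorem wp_readArcs {Q : ℕ → Conf → Prop} (d : Fin n × Fin n)
    (hi : s.inp = encodeInput arcs hint k) (hm : s.reg .m = arcs.length)
    (hQ : ∀ t s', Frame readArcs s s' → t ≤ 7 * arcs.length + 2 →
      (∀ e < arcs.length, s'.mem .T0 e = (arcs.getD e d).1 ∧
        s'.mem .H0 e = (arcs.getD e d).2 ∧ s'.mem .ST e = 1) → Q t s') :
    WP P readArcs s Q := by
  suffices h : WP P readArcs s fun t s' => t ≤ 7 * arcs.length + 2 ∧
      ∀ e < arcs.length, s'.mem .T0 e = (arcs.getD e d).1 ∧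
        s'.mem .H0 e = (arcs.getD e d).2 ∧ s'.mem .ST e = 1 by
    refine h.frame.mono ?_
    rintro t s' ⟨hf, h1, h2⟩
    exact hQ t s' hf h1 h2
  refine wp_forLoop arcs.length 5 (fun j s₁ => s₁.inp = s.inp ∧ s₁.reg .m = arcs.length ∧
    s₁.reg .i = j ∧ ∀ e < j, s₁.mem .T0 e = (arcs.getD e d).1 ∧
        s₁.mem .H0 e = (arcs.getD e d).2 ∧ s₁.mem .ST e = 1) ?_ ?_ ?_ ?_ ?_
  · simp [hm]
  · rintro j s₁ ⟨-, h, -⟩; exact h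
  · rintro j s₁ ⟨-, -, h, -⟩; exact h
  · rintro j hj s₁ ⟨h1, h2, h3, h4⟩ -
    have hlen : s₁.inp.length = 4 + 2 * arcs.length + hint.length := by
      rw [h1, hi, length_encodeInput]
    obtain ⟨g1, g2⟩ := getD_encodeInput_arc arcs hint k d hj
    rw [← hi, ← h1] at g1 g2
    simp only [wp_block_cons, wp_block_one]
    refine wp_read (by simp [h3, hlen]; omega) ?_
    rw [wp_set]
    refine wp_read (by simp [h3, hlen]; omega) ?_
    simp only [wp_set]
    refine ⟨by omega, by simp [h3], by simpa using h1, by simpa using h2, by simp, ?_⟩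
    intro e he
    by_cases hej : e = j
    · subst hej
      simp only [Conf.mem_setReg, Conf.mem_setMem, Conf.reg_setReg, Conf.reg_setMem, Conf.inp_setReg,
        Conf.inp_setMem, Term.eval_add, Term.eval_reg, Term.eval_four, Term.eval_one, h3,
        reduceCtorEq, if_false, if_true, update_self, g1, g2, and_self]
    · have := h4 e (by omega)
      simpa [h3, update_of_ne hej] using this
  · rintro s₁ t ⟨-, -, -, h⟩ ht
    exact ⟨ht, h⟩

theorem wp_readHint {Q : ℕ → Conf → Prop}
    (hi : s.inp = encodeInput arcs hint k) (hm : s.reg .m = arcs.length)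
    (hh : s.reg .h = hint.length) (hHF : s.mem .HF = fun _ => 0)
    (hQ : ∀ t s', Frame readHint s s' → t ≤ 4 * hint.length + 2 →
      (∀ x, s'.mem .HF x ≠ 0 ↔ ∃ v ∈ hint, (v : ℕ) = x) → Q t s') :
    WP P readHint s Q := by
  suffices h : WP P readHint s fun t s' => t ≤ 4 * hint.length + 2 ∧
      ∀ x, s'.mem .HF x ≠ 0 ↔ ∃ v ∈ hint, (v : ℕ) = x by
    refine h.frame.mono ?_
    rintro t s' ⟨hf, h1, h2⟩
    exact hQ t s' hf h1 h2
  refine wp_forLoop hint.length 2 (fun j s₁ => s₁.inp = s.inp ∧ s₁.reg .m = arcs.length ∧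
    s₁.reg .h = hint.length ∧ s₁.reg .i = j ∧ ∀ x, s₁.mem .HF x ≠ 0 ↔
      ∃ i < j, (hint.map Fin.val).getD i 0 = x) ?_ ?_ ?_ ?_ ?_
  · simp [hm, hh, hHF]
  · rintro j s₁ ⟨-, -, h, -⟩; exact h
  · rintro j s₁ ⟨-, -, -, h, -⟩; exact h
  · rintro j hj s₁ ⟨h1, h2, h3, h4, h5⟩ -
    have hlen : s₁.inp.length = 4 + 2 * arcs.length + hint.length := by
      rw [h1, hi, length_encodeInput]
    have g := getD_encodeInput_hint arcs hint k j
    rw [← hi, ← h1] at g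
    simp only [wp_block_cons, wp_block_one]
    refine wp_read (by simp [h2, h4, hlen]; omega) ?_
    rw [wp_set]
    simp only [Term.eval_add, Term.eval_reg, Term.eval_four, Term.eval_one, h2, h4, g]
    refine ⟨by omega, by simp [h4], by simpa using h1, by simpa using h2, by simpa using h3,
      by simp, ?_⟩
    intro x
    simp only [Conf.mem_setReg, Conf.mem_setMem, if_true, Conf.reg_setReg]
    by_cases hx : x = (hint.map Fin.val).getD j 0
    · subst hx
      rw [update_self]
      exact ⟨fun _ => ⟨j, by omega, rfl⟩, fun _ => one_ne_zero⟩
    · rw [update_of_ne hx, h5]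
      constructor
      · rintro ⟨i, hij, h6⟩; exact ⟨i, by omega, h6⟩
      · rintro ⟨i, hij, h6⟩
        refine ⟨i, ?_, h6⟩
        by_contra h7
        obtain rfl : i = j := by omega
        exact hx h6.symm
  · rintro s₁ t ⟨-, -, -, -, h⟩ ht
    refine ⟨ht, fun x => ?_⟩
    rw [h]
    constructor
    · rintro ⟨i, hij, rfl⟩
      refine ⟨hint[i], List.getElem_mem _, ?_⟩
      rw [List.getD_eq_getElem _ _ (by simpa using hij)]
      simp
    · rintro ⟨v, hv, rfl⟩
      obtain ⟨i, hij, rfl⟩ := List.mem_iff_getElem.mp hv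
      refine ⟨i, hij, ?_⟩
      rw [List.getD_eq_getElem _ _ (by simpa using hij)]
      simp

theorem wp_readInput {G : Digraph (Fin n)} {W : Finset (Fin n)} (d : Fin n × Fin n)
    (hG : ∀ u v, (u, v) ∈ arcs ↔ G.Adj u v) (hW : hint.toFinset = W)
    (hi : s.inp = encodeInput arcs hint k) (hHF : s.mem .HF = fun _ => 0) :
    WP P readInput s fun t s' => t ≤ 7 * arcs.length + 4 * hint.length + 9 ∧ s'.out = s.out ∧
      InstanceMem arcs.length (fun e => arcs.getD e d) G W k s' := by
  have hlen : s.inp.length = 4 + 2 * arcs.length + hint.length := by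
    rw [hi, length_encodeInput]
  have g0 : s.inp.getD 0 0 = n := by rw [hi]; rfl
  have g1 : s.inp.getD 1 0 = arcs.length := by rw [hi]; rfl
  have g2 : s.inp.getD 2 0 = hint.length := by rw [hi]; rfl
  have g3 : s.inp.getD 3 0 = k := by rw [hi]; rfl
  simp only [readInput, wp_block_cons, wp_block_one]
  refine wp_read (by simp [hlen]) (wp_read (by simp [hlen]; omega) (wp_read
    (by simp [hlen]; omega) (wp_read (by simp [hlen]; omega) ?_)))
  simp only [wp_assign, Term.eval_zero, Term.eval_one, Term.eval_two, Term.eval_three,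
    Conf.inp_setReg, g0, g1, g2, g3]
  set s₁ := Conf.setReg _ .len _ with hs₁
  have e1 : s₁.reg .n = n := by simp [hs₁]
  have e2 : s₁.reg .m = arcs.length := by simp [hs₁]
  have e3 : s₁.reg .h = hint.length := by simp [hs₁]
  have e4 : s₁.reg .k = k := by simp [hs₁]
  have e5 : s₁.reg .len = n + arcs.length + 1 := by simp [hs₁]
  have e6 : s₁.mem = s.mem := by simp [hs₁]
  have e7 : s₁.inp = s.inp := by simp [hs₁]
  have e8 : s₁.out = s.out := by simp [hs₁]
  clear_value s₁
  refine wp_readArcs d (e7.trans hi) e2 fun t2 s₂ hf2 ht2 h2 => ?_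
  refine wp_readHint (hf2.inp.trans (e7.trans hi)) ((hf2.reg _ rfl).trans e2)
    ((hf2.reg _ rfl).trans e3) (by rw [hf2.mem _ rfl, e6, hHF]) fun t3 s₃ hf3 ht3 h3 => ?_
  refine ⟨by omega, by rw [hf3.out rfl, hf2.out rfl, e8],
    ⟨?_, ?_, ?_, ?_, ?_⟩, ?_, ?_, ⟨?_, ?_⟩, ?_⟩
  · rw [hf3.reg _ rfl, hf2.reg _ rfl, e1]
  · rw [hf3.reg _ rfl, hf2.reg _ rfl, e2]
  · rw [hf3.reg _ rfl, hf2.reg _ rfl, e5]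
  · intro e he; rw [hf3.mem _ rfl]; exact (h2 e he).1
  · intro e he; rw [hf3.mem _ rfl]; exact (h2 e he).2.1
  · intro e he; rw [hf3.mem _ rfl, (h2 e he).2.2]
  · intro u v
    rw [← hG, List.mem_iff_getElem, hf3.mem _ rfl]
    constructor
    · rintro ⟨e, he, h4⟩
      exact ⟨e, he, by rw [(h2 e he).2.2]; decide, (List.getD_eq_getElem _ _ he).trans h4⟩
    · rintro ⟨e, he, -, h4⟩
      exact ⟨e, he, (List.getD_eq_getElem _ _ he).symm.trans h4⟩
  · by_contra hne
    obtain ⟨v, -, hv⟩ := (h3 n).mp hne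
    have := v.isLt; omega
  · intro v
    rw [h3, ← hW, List.mem_toFinset]
    constructor
    · intro hv; exact ⟨v, hv, rfl⟩
    · rintro ⟨u, hu, h4⟩; rwa [← Fin.ext h4]
  · rw [hf3.reg _ rfl, hf2.reg _ rfl, e4]

end Input

/-! ### The random access machine program -/

/-- The procedures of the program. -/
def dfasProcs : List Code := [dfasBody, enumBody]

/-- The main command on the array machine. -/
def dfasMain : Code := .seq readInput (.call 0)

/-- The program: it first computes the length `4 + 2 m + h` of the input, for `m` arcs and `h` hint
vertices, because the arrays begin behind the input. -/
def dfasProgram : Program where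
  procs := dfasProcs.map Code.compile
  main := .seq
    (.assign 0 (.add (.add (.lit 4) (.add (.load (.lit 1)) (.load (.lit 1)))) (.load (.lit 2))))
    dfasMain.compile

/-- Once register `0` holds the length of the input, the initial state represents the configuration
in which all registers and arrays are zero. -/
theorem represents_init {n : ℕ} (arcs : List (Fin n × Fin n)) (hint : List (Fin n)) (k : ℕ) :
    Represents ⟨fun _ => 0, fun _ _ => 0, [], encodeInput arcs hint k⟩
      { initState (encodeInput arcs hint k) with
        reg := update (initState (encodeInput arcs hint k)).reg 0
          (encodeInput arcs hint k).length } where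
  base := by simp
  reg r := by simp [initState]
  mem a i := by
    simp only [initState]
    rw [List.getD_eq_default]
    omega
  out := rfl
  inp i _ := rfl

/-- The factor by which the translation slows the program down. -/
def slowdown : ℕ := dfasMain.stepCost + dfasBody.stepCost + enumBody.stepCost + 1

theorem dfasProgram_spec {n k : ℕ} {G : Digraph (Fin n)} {W : Finset (Fin n)}
    {arcs : List (Fin n × Fin n)} {hint : List (Fin n)} (hn : 0 < n) (harcs : arcs.Nodup)
    (hG : ∀ u v, (u, v) ∈ arcs ↔ G.Adj u v) (hhint : hint.Nodup) (hW : hint.toFinset = W)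
    (hdf : IsDFVS G W) (hWk : W.card ≤ k + 1) :
    ∃ (t : ℕ) (log : List (Event (Fin n))) (res : Option (Finset (Fin n × Fin n))),
      Run G W k log res ∧
      dfasProgram.HaltsWith (encodeInput arcs hint k) t (log.flatMap Event.encode) ∧
      (t : ℝ) ≤ (12 + slowdown * (32 + 3200 * Real.exp 16)) * k.factorial *
        2 ^ (20 * √((k : ℝ) + 1)) * (n + arcs.length) := by
  set d : Fin n × Fin n := (⟨0, hn⟩, ⟨0, hn⟩) with hd
  have hinj : ∀ i < arcs.length, ∀ j < arcs.length, arcs.getD i d = arcs.getD j d → i = j := by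
    intro i hi j hj h
    rw [List.getD_eq_getElem _ _ hi, List.getD_eq_getElem _ _ hj] at h
    exact (harcs.getElem_inj_iff).mp h
  have hr1 : 1 ≤ √((k : ℝ) + 1) := by
    rw [Real.one_le_sqrt]; linarith [Nat.cast_nonneg (α := ℝ) k]
  have hz1 : 1 / (2 * √((k : ℝ) + 1)) ≤ 1 / 2 := by
    rw [div_le_div_iff₀ (by positivity) (by positivity)]; linarith
  have hwp : WP dfasProcs dfasMain ⟨fun _ => 0, fun _ _ => 0, [], encodeInput arcs hint k⟩
      fun t s' => ∃ log res, s'.out = log.flatMap Event.encode ∧ Run G W k log res ∧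
        (t : ℝ) ≤ 7 * arcs.length + 4 * hint.length + 9 + ((n + arcs.length + 1 : ℕ) : ℝ) *
          timeBound (1 / (2 * √((k : ℝ) + 1))) (k + 1) k := by
    rw [dfasMain, wp_seq]
    refine (wp_readInput d hG hW rfl rfl).mono ?_
    rintro t s₁ ⟨ht, ho1, h1⟩
    refine (dfasSpec hinj rfl rfl (by positivity) hz1 (k + 1) s₁ G W k h1 hdf hWk le_rfl).mono ?_
    rintro t' s₂ ⟨log, res, -, ho2, hrun, -, ht'⟩
    refine ⟨log, res, by rw [ho2, ho1]; rfl, hrun, ?_⟩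
    have : (t : ℝ) ≤ 7 * arcs.length + 4 * hint.length + 9 := by exact_mod_cast ht
    push_cast at *
    linarith
  obtain ⟨t, s', hrun, log, res, hout, hR, ht⟩ := hwp
  obtain ⟨t', s'', hexec, hrep, ht'⟩ := hrun.compile (K := slowdown) (by
    intro c hc
    simp only [dfasProcs, List.mem_cons, List.not_mem_nil, or_false] at hc
    rcases hc with rfl | rfl <;> simp only [slowdown] <;> omega)
    (by simp only [slowdown]; omega) (by simp only [slowdown]; omega) _
    (represents_init arcs hint k)
  refine ⟨_, log, res, hR, ⟨s'', .seq (t₁ := t') .assign ?_, hrep.out.trans hout⟩, ?_⟩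
  · have hlen : (encodeInput arcs hint k).length =
        (Expr.add (.add (.lit 4) (.add (.load (.lit 1)) (.load (.lit 1)))) (.load (.lit 2))).eval
          (initState (encodeInput arcs hint k)) := by
      have g1 : (encodeInput arcs hint k).getD 1 0 = arcs.length := rfl
      have g2 : (encodeInput arcs hint k).getD 2 0 = hint.length := rfl
      simp only [Expr.eval, initState, length_encodeInput, g1, g2]
      omega
    rw [hlen] at hexec
    exact hexec
  · have hh : hint.length ≤ n := by simpa using hhint.length_le_card
    have h1 : (1 : ℝ) ≤ n := by exact_mod_cast hn
    have h2 : (hint.length : ℝ) ≤ n := by exact_mod_cast hh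
    have h3 := timeBound_le k
    set F : ℝ := k.factorial * 2 ^ (20 * √((k : ℝ) + 1)) with hF
    have hF1 : 1 ≤ F := by
      have h4 : (1 : ℝ) ≤ k.factorial := by exact_mod_cast Nat.factorial_pos k
      have h5 : (1 : ℝ) ≤ 2 ^ (20 * √((k : ℝ) + 1)) :=
        Real.one_le_rpow (by norm_num) (by positivity)
      rw [hF]; nlinarith
    set N : ℝ := (n : ℝ) + arcs.length with hN
    have hm0 : (0 : ℝ) ≤ arcs.length := Nat.cast_nonneg _
    have hN1 : 1 ≤ N := by rw [hN]; linarith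
    have hNF : N ≤ F * N := le_mul_of_one_le_left (by linarith) hF1
    have h6 : ((n + arcs.length + 1 : ℕ) : ℝ) * timeBound (1 / (2 * √((k : ℝ) + 1))) (k + 1) k ≤
        3200 * Real.exp 16 * (F * N) := by
      have h7 : ((n + arcs.length + 1 : ℕ) : ℝ) ≤ 2 * N := by
        push_cast; rw [hN]; linarith
      calc _ ≤ ((n + arcs.length + 1 : ℕ) : ℝ) * (1600 * Real.exp 16 * F) := by
            refine mul_le_mul_of_nonneg_left ?_ (Nat.cast_nonneg _)
            rw [hF]; linarith
        _ ≤ 2 * N * (1600 * Real.exp 16 * F) := by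
            refine mul_le_mul_of_nonneg_right h7 (by positivity)
        _ = _ := by ring
    have h8 : (t : ℝ) ≤ (32 + 3200 * Real.exp 16) * (F * N) := by
      have : 7 * (arcs.length : ℝ) + 4 * hint.length + 9 ≤ 32 * (F * N) := by
        rw [hN] at hNF ⊢; linarith
      linarith
    have h9 : (t' : ℝ) ≤ slowdown * ((32 + 3200 * Real.exp 16) * (F * N)) :=
      le_trans (by exact_mod_cast ht') (mul_le_mul_of_nonneg_left h8 (Nat.cast_nonneg _))
    have h10 : (1 : ℝ) ≤ F * N := hN1.trans hNF
    simp only [Expr.cost]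
    push_cast
    have : (12 + slowdown * (32 + 3200 * Real.exp 16)) * k.factorial *
        2 ^ (20 * √((k : ℝ) + 1)) * N = 12 * (F * N) +
        slowdown * ((32 + 3200 * Real.exp 16) * (F * N)) := by rw [hF]; ring
    rw [this]
    linarith

end DFAS

/-- There is a unit-cost RAM program that executes `DFAS-V`, reporting every event of the
execution, in time `O(k! 2^{o(k)} (n + m))` on all instances with a hint of size at most `k + 1`. -/
theorem mainTheorem2 :
    ∃ (P : DFAS.Program) (g : ℕ → ℝ) (C : ℝ),
      g =o[Filter.atTop] (fun k : ℕ => (k : ℝ)) ∧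
      ∀ (n k : ℕ) (G : Digraph (Fin n)) (W : Finset (Fin n))
        (arcs : List (Fin n × Fin n)) (hint : List (Fin n)),
        0 < n →
        arcs.Nodup → (∀ u v, (u, v) ∈ arcs ↔ G.Adj u v) →
        hint.Nodup → hint.toFinset = W →
        DFAS.IsDFVS G W → W.card ≤ k + 1 →
        ∃ (t : ℕ) (log : List (DFAS.Event (Fin n))) (res : Option (Finset (Fin n × Fin n))),
          DFAS.Run G W k log res ∧
          P.HaltsWith (DFAS.encodeInput arcs hint k) t (log.flatMap DFAS.Event.encode) ∧
          (t : ℝ) ≤ C * (k.factorial : ℝ) * (2 : ℝ) ^ (g k) * ((n : ℝ) + (arcs.length : ℝ)) :=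
  ⟨DFAS.dfasProgram, fun k => 20 * √((k : ℝ) + 1), _, DFAS.isLittleO_sqrt,
    fun _ _ _ _ _ _ hn harcs hG hhint hW hdf hWk =>
      DFAS.dfasProgram_spec hn harcs hG hhint hW hdf hWk⟩
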